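/- **Theorem (mindiff).** Machine model: a random access machine on words of $w$ bits, in which arithmetic, addressing, copying and comparing cost one unit of time; the values of a function $F$ can be stored, copied and compared with each other; evaluating $F$ costs $t(F)$ and evaluating a function $G$ costs $t(G)$. The machine also has a quantum register for Grover search: at unit cost it can be prepared in a uniform superposition of $|0\rangle,\dots,|K-1\rangle$, reflected about that uniform superposition, and measured; and the sign of the basis states that satisfy a given predicate (which may read the memory and call $F$ and $G$) can be flipped, at the cost of evaluating the predicate up to a constant factor. There are a single program (*mindiff*) for this machine and constants $c, C>0$ such that the following holds for all integers $N,d\ge 1$, all real $0<\epsilon<1$, all functions $F$ from a domain of size $N$ to a linearly ordered set and $G$ from the same domain to the $w$-bit words, all costs $t(F),t(G)\ge 1$, and all word sizes $w$ with $2^w\ge (N+d+\lceil\epsilon^{-1}\rceil)^c$. On input $N$, $d$, $\lceil\epsilon^{-1}\rceil$, the program halts with probability at least $1-\epsilon$ with a result $x_1,\dots,x_d$ in which every $x_i$ is an element of the domain or an "infinity" (a fictitious element with $F(x_i)=\infty$ whose $G$-value differs from that of every domain element and of every other infinity), such that * the values $G(x_1),\dots,G(x_d)$ are pairwise distinct,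 and $F$ is minimized subject to this: for all $x'_1,\dots,x'_d$ (elements of the domain or infinities) with pairwise distinct $G$-values there is a permutation $\sigma$ with $F(x_i)\le F(x'_{\sigma(i)})$ for all $i$; * there is no domain element $y$ such that $F(y)<F(x_i)$ and $G(y)=G(x_i)$ for some $i$; * there is no domain element $y$ such that $F(y)<F(x_i)$ for some $i$ and $G(y)\ne G(x_j)$ for all $j$. Its expected running time is at most $$C\left(\bigl(t(F)+t(G)\bigr)\left(\sqrt{Nd}+\sqrt{N\lg\epsilon^{-1}}\right)+d\,\lg N\,\lg d\right),$$ where $\lg$ is the logarithm to base $2$. -/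

import Mathlib

universe u

namespace QRam

/-! ### The problem

A candidate answer is a `d`-tuple of domain elements or "infinities" (`none`). An infinity has price
`⊤` and a type of its own, different from the type of every other entry and of every element. -/

section Problem

variable {α : Type u} [LinearOrder α] {β : Type*} {N d : ℕ}

/-- The price of an entry: `F y` for a domain element `y`, and `∞` for an infinity. -/
def price (F : Fin N → α) : Option (Fin N) → WithTop α
  | none => ⊤
  | some y => (F y : WithTop α)

/-- The entries have pairwise distinct types. -/
def DistinctTypes (G : Fin N → β) (x : Fin d → Option (Fin N)) : Prop :=
  ∀ i j y z, x i = some y → x j = some z → i ≠ j → G y ≠ G z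

/-- `x` is a minimal choice of `d` objects of different types. -/
structure IsMinDiff (F : Fin N → α) (G : Fin N → β) (x : Fin d → Option (Fin N)) : Prop where
  /-- all types are distinct -/
  distinct : DistinctTypes G x
  /-- prices are minimal: any tuple with distinct types is, after reordering, entrywise at least
  as expensive -/
  minimal : ∀ x' : Fin d → Option (Fin N), DistinctTypes G x' →
    ∃ σ : Equiv.Perm (Fin d), ∀ i, price F (x i) ≤ price F (x' (σ i))
  /-- no `y` is cheaper than an entry of the same type -/
  no_exchange_same : ¬ ∃ y i, (F y : WithTop α) < price F (x i) ∧ ∃ z, x i = some z ∧ G y = G z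
  /-- no `y` whose type is not represented is cheaper than some entry -/
  no_exchange_new : ¬ ∃ y i, (F y : WithTop α) < price F (x i) ∧ ∀ j z, x j = some z → G y ≠ G z

end Problem

/-! ### The machine

A random access machine on words of `w` bits, with unit-cost word operations, value registers which
hold values of `F` (or `⊤`) and can be copied and compared at unit cost, oracle access to `F` and `G`
at costs `tF` and `tG`, and one quantum register for Grover search. The quantum register can be put
into a uniform superposition; a predicate can be evaluated on it coherently, that is, the machine
can read its memory and call the oracles in superposition; it can be reflected about the uniform
superposition; and it can be measured. -/

/-- The fixed data of a run: word size, domain size, the two functions and their evaluation costs. -/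
structure Machine (α : Type u) where
  w : ℕ
  N : ℕ
  F : Fin N → α
  G : Fin N → ℕ
  tF : ℕ
  tG : ℕ

/-- Binary word operations. -/
inductive WOp
  | add | sub | mul | div | mod

/-- Word expressions. Registers and arrays are numbered; `call e` is `G (e)`. -/
inductive WExpr
  | const (n : ℕ)
  | reg (r : ℕ)
  | load (a : ℕ) (e : WExpr)
  | op (o : WOp) (e₁ e₂ : WExpr)
  | call (e : WExpr)

/-- Value expressions; `call e` is `F (e)`. -/
inductive VExpr
  | top
  | reg (r : ℕ)
  | load (a : ℕ) (e : WExpr)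
  | call (e : WExpr)

/-- Predicates. -/
inductive BExpr
  | wlt (e₁ e₂ : WExpr)
  | weq (e₁ e₂ : WExpr)
  | vlt (v₁ v₂ : VExpr)
  | not (b : BExpr)
  | and (b₁ b₂ : BExpr)
  | or (b₁ b₂ : BExpr)

/-- Programs. -/
inductive Cmd
  /-- word register `r := e` -/
  | wset (r : ℕ) (e : WExpr)
  /-- word array `a[i] := e` -/
  | wstore (a : ℕ) (i e : WExpr)
  /-- value register `r := v` -/
  | vset (r : ℕ) (v : VExpr)
  /-- value array `a[i] := v` -/
  | vstore (a : ℕ) (i : WExpr) (v : VExpr)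
  /-- first `c₁`, then `c₂` -/
  | seq (c₁ c₂ : Cmd)
  /-- if `b` then `c₁` else `c₂` -/
  | cond (b : BExpr) (c₁ c₂ : Cmd)
  /-- while `b` do `c` -/
  | loop (b : BExpr) (c : Cmd)
  /-- uniform superposition of `|0⟩, …, |e - 1⟩` in the quantum register (no effect if `e = 0`) -/
  | prep (e : WExpr)
  /-- `|z⟩ ↦ -|z⟩` for those `z` for which `b` holds when word register `r` has the content `z` -/
  | phase (r : ℕ) (b : BExpr)
  /-- reflect the quantum register about the uniform superposition -/
  | diffuse
  /-- measure the quantum register in the computational basis, outcome into word register `r` -/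
  | meas (r : ℕ)

/-- The classical memory. -/
structure Store (α : Type u) where
  reg : ℕ → ℕ
  arr : ℕ → ℕ → ℕ
  vreg : ℕ → WithTop α
  varr : ℕ → ℕ → WithTop α

/-- A pure state of a quantum register of dimension `dim`. -/
structure QState where
  dim : ℕ
  vec : EuclideanSpace ℂ (Fin dim)
  norm_vec : ‖vec‖ = 1

/-- A configuration: the commands still to be executed, the memory, the quantum register, and the
time used so far. -/
structure Config (α : Type u) where
  todo : List Cmd
  store : Store α
  q : QState
  time : ℕ

noncomputable section

/-! ### Evaluation and cost of expressions -/

section Expr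

variable {α : Type u} [LinearOrder α]

def WOp.apply : WOp → ℕ → ℕ → ℕ
  | .add, a, b => a + b
  | .sub, a, b => a - b
  | .mul, a, b => a * b
  | .div, a, b => a / b
  | .mod, a, b => a % b

/-- The answer of the oracle for `G` (`0` outside the domain). -/
def Machine.callG (M : Machine α) (n : ℕ) : ℕ :=
  if h : n < M.N then M.G ⟨n, h⟩ else 0

/-- The answer of the oracle for `F` (`⊤` outside the domain). -/
def Machine.callF (M : Machine α) (n : ℕ) : WithTop α :=
  if h : n < M.N then (M.F ⟨n, h⟩ : WithTop α) else ⊤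

/-- Arithmetic is modulo `2 ^ w`. -/
def WExpr.eval (M : Machine α) (s : Store α) : WExpr → ℕ
  | .const n => n % 2 ^ M.w
  | .reg r => s.reg r
  | .load a e => s.arr a (e.eval M s)
  | .op o e₁ e₂ => o.apply (e₁.eval M s) (e₂.eval M s) % 2 ^ M.w
  | .call e => M.callG (e.eval M s)

def VExpr.eval (M : Machine α) (s : Store α) : VExpr → WithTop α
  | .top => ⊤
  | .reg r => s.vreg r
  | .load a e => s.varr a (e.eval M s)
  | .call e => M.callF (e.eval M s)

def BExpr.Holds (M : Machine α) (s : Store α) : BExpr → Prop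
  | .wlt e₁ e₂ => e₁.eval M s < e₂.eval M s
  | .weq e₁ e₂ => e₁.eval M s = e₂.eval M s
  | .vlt v₁ v₂ => v₁.eval M s < v₂.eval M s
  | .not b => ¬ b.Holds M s
  | .and b₁ b₂ => b₁.Holds M s ∧ b₂.Holds M s
  | .or b₁ b₂ => b₁.Holds M s ∨ b₂.Holds M s

def WExpr.cost (M : Machine α) : WExpr → ℕ
  | .const _ => 1
  | .reg _ => 1
  | .load _ e => e.cost M + 1
  | .op _ e₁ e₂ => e₁.cost M + e₂.cost M + 1
  | .call e => e.cost M + M.tG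

def VExpr.cost (M : Machine α) : VExpr → ℕ
  | .top => 1
  | .reg _ => 1
  | .load _ e => e.cost M + 1
  | .call e => e.cost M + M.tF

def BExpr.cost (M : Machine α) : BExpr → ℕ
  | .wlt e₁ e₂ => e₁.cost M + e₂.cost M + 1
  | .weq e₁ e₂ => e₁.cost M + e₂.cost M + 1
  | .vlt v₁ v₂ => v₁.cost M + v₂.cost M + 1
  | .not b => b.cost M + 1
  | .and b₁ b₂ => b₁.cost M + b₂.cost M + 1
  | .or b₁ b₂ => b₁.cost M + b₂.cost M + 1

end Expr

/-! ### The quantum register -/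

/-- The uniform superposition of `|0⟩, …, |K - 1⟩`. -/
def unif (K : ℕ) : EuclideanSpace ℂ (Fin K) :=
  WithLp.toLp 2 fun _ => (((Real.sqrt K)⁻¹ : ℝ) : ℂ)

theorem norm_unif {K : ℕ} (hK : K ≠ 0) : ‖unif K‖ = 1 := by
  have h : (0 : ℝ) < K := by exact_mod_cast Nat.pos_of_ne_zero hK
  rw [EuclideanSpace.norm_eq, Real.sqrt_eq_one]
  simp [unif, h.le, h.ne']

/-- Preparation of the uniform superposition. -/
def QState.prep (q : QState) (K : ℕ) : QState :=
  if h : K ≠ 0 then ⟨K, unif K, norm_unif h⟩ else q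

open Classical in
/-- Sign flip on the basis states that satisfy `p`. -/
def QState.phase (q : QState) (p : ℕ → Prop) : QState where
  dim := q.dim
  vec := WithLp.toLp 2 fun z => if p z then - q.vec z else q.vec z
  norm_vec := by
    rw [← q.norm_vec, EuclideanSpace.norm_eq, EuclideanSpace.norm_eq]
    congr 1
    refine Finset.sum_congr rfl fun z _ => ?_
    dsimp only
    split_ifs <;> simp

/-- Reflection about the uniform superposition `u`, that is, `ψ ↦ 2 ⟨u, ψ⟩ u - ψ`. -/
def QState.diffuse (q : QState) : QState where
  dim := q.dim
  vec := (Submodule.span ℂ {unif q.dim}).reflection q.vec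
  norm_vec := by rw [LinearIsometryEquiv.norm_map, q.norm_vec]

/-- The basis state `|z⟩`. -/
def QState.basis {K : ℕ} (z : Fin K) : QState :=
  ⟨K, EuclideanSpace.single z 1, by simp⟩

/-- The distribution of the outcome of a measurement in the computational basis. -/
def QState.outcome (q : QState) : PMF (Fin q.dim) :=
  PMF.ofFintype (fun z => ENNReal.ofReal (‖q.vec z‖ ^ 2)) (by
    rw [← ENNReal.ofReal_sum_of_nonneg fun _ _ => by positivity]
    have h := EuclideanSpace.norm_sq_eq q.vec
    rw [q.norm_vec] at h
    rw [← h]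
    simp)

/-! ### Runs -/

section Run

variable {α : Type u} [LinearOrder α]

def Store.setReg (s : Store α) (r n : ℕ) : Store α :=
  { s with reg := Function.update s.reg r n }

def Store.setArr (s : Store α) (a i n : ℕ) : Store α :=
  { s with arr := Function.update s.arr a (Function.update (s.arr a) i n) }

def Store.setVReg (s : Store α) (r : ℕ) (v : WithTop α) : Store α :=
  { s with vreg := Function.update s.vreg r v }

def Store.setVArr (s : Store α) (a i : ℕ) (v : WithTop α) : Store α :=
  { s with varr := Function.update s.varr a (Function.update (s.varr a) i v) }

open Classical in
/-- One step. Everything is deterministic except a measurement. A predicate that is evaluated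
coherently is computed and uncomputed, hence the factor `2`. -/
def step (M : Machine α) (c : Config α) : PMF (Config α) :=
  match c with
  | ⟨[], s, q, t⟩ => PMF.pure ⟨[], s, q, t⟩
  | ⟨.wset r e :: k, s, q, t⟩ =>
      PMF.pure ⟨k, s.setReg r (e.eval M s), q, t + (e.cost M + 1)⟩
  | ⟨.wstore a i e :: k, s, q, t⟩ =>
      PMF.pure ⟨k, s.setArr a (i.eval M s) (e.eval M s), q, t + (i.cost M + e.cost M + 1)⟩
  | ⟨.vset r v :: k, s, q, t⟩ =>
      PMF.pure ⟨k, s.setVReg r (v.eval M s), q, t + (v.cost M + 1)⟩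
  | ⟨.vstore a i v :: k, s, q, t⟩ =>
      PMF.pure ⟨k, s.setVArr a (i.eval M s) (v.eval M s), q, t + (i.cost M + v.cost M + 1)⟩
  | ⟨.seq c₁ c₂ :: k, s, q, t⟩ => PMF.pure ⟨c₁ :: c₂ :: k, s, q, t⟩
  | ⟨.cond b c₁ c₂ :: k, s, q, t⟩ =>
      PMF.pure ⟨(if b.Holds M s then c₁ else c₂) :: k, s, q, t + (b.cost M + 1)⟩
  | ⟨.loop b c :: k, s, q, t⟩ =>
      PMF.pure ⟨if b.Holds M s then c :: .loop b c :: k else k, s, q, t + (b.cost M + 1)⟩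
  | ⟨.prep e :: k, s, q, t⟩ =>
      PMF.pure ⟨k, s, q.prep (e.eval M s), t + (e.cost M + 1)⟩
  | ⟨.phase r b :: k, s, q, t⟩ =>
      PMF.pure ⟨k, s, q.phase fun z => b.Holds M (s.setReg r z), t + (2 * b.cost M + 1)⟩
  | ⟨.diffuse :: k, s, q, t⟩ => PMF.pure ⟨k, s, q.diffuse, t + 1⟩
  | ⟨.meas r :: k, s, q, t⟩ =>
      q.outcome.map fun z : Fin q.dim => ⟨k, s.setReg r z, QState.basis z, t + 1⟩

/-- The distribution of the configuration after `n` steps. -/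
def run (M : Machine α) (c : Config α) : ℕ → PMF (Config α)
  | 0 => PMF.pure c
  | n + 1 => (run M c n).bind (step M)

/-- The initial configuration of program `P`: the inputs are in the word registers `0, 1, 2, …`, all
other words are `0`, all values are `⊤`, and the quantum register is trivial. -/
def start (P : Cmd) (input : List ℕ) : Config α where
  todo := [P]
  store := ⟨fun r => input.getD r 0, fun _ _ => 0, fun _ => ⊤, fun _ _ => ⊤⟩
  q := QState.basis (0 : Fin 1)
  time := 0

/-- The expected running time. -/
def expectedTime (M : Machine α) (P : Cmd) (input : List ℕ) : ENNReal :=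
  ⨆ n, ∑' c, run M (start P input) n c * (c.time : ENNReal)

/-- The probability that the program halts with a memory that satisfies `post`. -/
def haltProb (M : Machine α) (P : Cmd) (input : List ℕ) (post : Store α → Prop) : ENNReal :=
  ⨆ n, (run M (start P input) n).toOuterMeasure {c | c.todo = [] ∧ post c.store}

/-- The answer `x` is written in the cells `0, …, d - 1` of word array `0`; a domain element `y` is
written as `y + 1`, an infinity as `0`. -/
def Outputs {N d : ℕ} (x : Fin d → Option (Fin N)) (s : Store α) : Prop :=
  ∀ i : Fin d, s.arr 0 i = (x i).elim 0 fun y => (y : ℕ) + 1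

end Run

end

end QRam

namespace QRam

set_option linter.unusedSectionVars false

open scoped ENNReal

/-! ### Expected payoff of runs -/

section Runs

variable {α : Type u} [LinearOrder α] {M : Machine α}

/-! The program keeps a set `X` of at most `d` elements of different types, with a table of types
and a tournament tree. An element is improving if it would enter the best choice from `X` and
itself; one table lookup and one comparison decide this. Grover search looks for an improving
element, which is then inserted, and the program stops when a search fails. Once no improving
element is left, an exchange argument shows that the stored tuple is minimal
(`isMinDiff_of_no_exchange`).

Number of rounds: a measurement finds all improving elements with the same probability, and
inserting an element that is not improving leaves the set of improving ones unchanged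
(`improving_insert_of_notMem`). The elements found are therefore distributed like the improving ones
met in a scan of the domain in random order (`scanCost_eq_potential`, `potential_eq`). For such a
scan backward analysis applies: of any `k + 1` elements at most `d` improve on the others, so after
`k` steps on average at most `(N - k) d / (k + 1)` elements are improving (`sum_card_improving_le`).
If a find among `s` improving elements is charged `√(N / s)`, the total is `O(√(N d))`
(`scanCost_sqrt_le`); the expected number of updates is `O(d log N)` (`scanCost_one_le`), and each
costs `O(log d)` in the tree, apart from a few oracle calls.

One search, with `t` improving elements: the quick search, with geometrically growing iteration
numbers, takes expected time `O(√(N / t))` and fails with probability at most `1 / t²`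
(`search_quick`). Only then the slow search runs, in time `O(√(N b))` with `b = O(1 + lg ε⁻¹)`, and
fails with probability at most `1 / (2 E)`, where `E = ⌈ε⁻¹⌉` (`search_slow`). For `t ≤ b` it
guesses `t`, and a last, partial Grover iteration removes nearly all bad amplitude
(`lastFlip_fail`); for `t > b` it makes `b` attempts that fail with probability at most `1 / 2`
each. Since `t` strictly decreases and `∑ 1 / t² ≤ 2`, the total failure probability is at most `1 /
E ≤ ε`, and the slow searches cost `O(√(N b))` altogether, including the final fruitless one.

Formally, `Ev` bounds the expectation of `lam` times the running time plus a terminal penalty. With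
`lam = 1` and no penalty this is the running time; with `lam = 0` and penalty `1` for a wrong result
it is the failure probability. `ev_mainLoop` treats both at once. -/

theorem run_succ_eq (M : Machine α) (c : Config α) (n : ℕ) :
    run M c (n + 1) = (step M c).bind fun c' => run M c' n := by
  induction n generalizing c with
  | zero => simp [run]
  | succ n ih =>
    rw [run, ih, PMF.bind_bind]
    congr 1

theorem tsum_bind_mul {β γ : Type*} (p : PMF β) (f : β → PMF γ) (h : γ → ℝ≥0∞) :
    ∑' c, p.bind f c * h c = ∑' a, p a * ∑' c, f a c * h c := by
  simp only [PMF.bind_apply, ← ENNReal.tsum_mul_right, ← ENNReal.tsum_mul_left]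
  rw [ENNReal.tsum_comm]
  simp only [mul_assoc]

theorem tsum_pure_mul {β : Type*} (a : β) (h : β → ℝ≥0∞) :
    ∑' c, (PMF.pure a) c * h c = h a := by
  rw [tsum_eq_single a]
  · simp
  · intro b hb; simp [hb]

/-- Weighted time plus terminal penalty of a configuration; an unfinished run has penalty `1`. -/
noncomputable def payoff (lam : ℝ≥0∞) (g : Store α → ℝ≥0∞) (c : Config α) : ℝ≥0∞ :=
  lam * c.time + match c.todo with
    | [] => g c.store
    | _ :: _ => 1

/-- All runs of the command list `k` from memory `s` and register `q` have bounded length, and the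
expectation of `lam` times the elapsed time plus the terminal penalty `g` is at most `B`. -/
def Ev (M : Machine α) (lam : ℝ≥0∞) (g : Store α → ℝ≥0∞) (k : List Cmd) (s : Store α) (q : QState)
    (B : ℝ≥0∞) : Prop :=
  ∃ n₀, ∀ n ≥ n₀, ∀ t : ℕ,
    ∑' c, run M ⟨k, s, q, t⟩ n c * payoff lam g c ≤ lam * t + B

variable {lam : ℝ≥0∞} {g : Store α → ℝ≥0∞} {k : List Cmd} {s s' : Store α} {q q' : QState}
  {B B' : ℝ≥0∞}

theorem Ev.mono (h : Ev M lam g k s q B) (hB : B ≤ B') : Ev M lam g k s q B' := by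
  obtain ⟨n₀, h⟩ := h
  exact ⟨n₀, fun n hn t => (h n hn t).trans (by gcongr)⟩

theorem run_nil (M : Machine α) (s : Store α) (q : QState) (t n : ℕ) :
    run M ⟨[], s, q, t⟩ n = PMF.pure ⟨[], s, q, t⟩ := by
  induction n with
  | zero => rfl
  | succ n ih => rw [run, ih, PMF.pure_bind]; rfl

theorem Ev.nil (M : Machine α) (lam : ℝ≥0∞) (g : Store α → ℝ≥0∞) (s : Store α) (q : QState) :
    Ev M lam g [] s q (g s) :=
  ⟨0, fun n _ t => by rw [run_nil, tsum_pure_mul]; simp [payoff]⟩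

theorem Ev.of_step {c : Cmd} {k' : List Cmd} {T : ℕ}
    (hs : ∀ t, step M ⟨c :: k, s, q, t⟩ = PMF.pure ⟨k', s', q', t + T⟩)
    (h : Ev M lam g k' s' q' B) : Ev M lam g (c :: k) s q (lam * T + B) := by
  obtain ⟨n₀, h⟩ := h
  refine ⟨n₀ + 1, fun n hn t => ?_⟩
  obtain ⟨n, rfl⟩ : ∃ m, n = m + 1 := ⟨n - 1, by omega⟩
  rw [run_succ_eq, hs, PMF.pure_bind]
  refine (h n (by omega) _).trans (le_of_eq ?_)
  push_cast
  ring

theorem Ev.meas {r : ℕ} {Bz : Fin q.dim → ℝ≥0∞}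
    (h : ∀ z : Fin q.dim, Ev M lam g k (s.setReg r z) (QState.basis z) (Bz z)) :
    Ev M lam g (.meas r :: k) s q
      (lam * (1 : ℕ) + ∑ z, ENNReal.ofReal (‖q.vec z‖ ^ 2) * Bz z) := by
  choose n₀ h using h
  -- A measurement has finitely many outcomes, so the lengths of the continuations have a common
  -- bound.
  refine ⟨Finset.univ.sup n₀ + 1, fun n hn t => ?_⟩
  obtain ⟨n, rfl⟩ : ∃ m, n = m + 1 := ⟨n - 1, by omega⟩
  rw [run_succ_eq]
  have hst : step M ⟨.meas r :: k, s, q, t⟩ =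
      q.outcome.map fun z : Fin q.dim => ⟨k, s.setReg r z, QState.basis z, t + 1⟩ := rfl
  rw [hst, PMF.bind_map, tsum_bind_mul, tsum_fintype]
  have h1 : ∀ z ∈ Finset.univ, q.outcome z * ∑' c, ((fun c' => run M c' n) ∘ fun z : Fin q.dim =>
      (⟨k, s.setReg r z, QState.basis z, t + 1⟩ : Config α)) z c * payoff lam g c ≤
      q.outcome z * (lam * ((t + 1 : ℕ)) + Bz z) := by
    intro z hz
    gcongr
    exact h z n (by have := Finset.le_sup (f := n₀) hz; omega) _
  refine (Finset.sum_le_sum h1).trans ?_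
  simp only [mul_add, Finset.sum_add_distrib, ← Finset.sum_mul]
  have h2 : ∑ z, q.outcome z = 1 := by rw [← tsum_fintype (L := .unconditional _)]; exact q.outcome.tsum_coe
  rw [h2]
  simp only [QState.outcome, PMF.ofFintype_apply]
  push_cast
  ring_nf
  exact le_refl _

end Runs

/-! ### Deterministic execution, in continuation form -/

section Exec

variable {α : Type u} [LinearOrder α] {M : Machine α} {s s₁ s₂ : Store α} {q q₁ q₂ : QState}
  {c₁ c₂ c : ℕ}

/-- `C` takes `(s, q)` to `(s', q')` deterministically in time at most `c`. -/
def Exec (M : Machine α) (C : Cmd) (s : Store α) (q : QState) (s' : Store α) (q' : QState)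
    (c : ℕ) : Prop :=
  ∀ (lam : ℝ≥0∞) (g : Store α → ℝ≥0∞) (k : List Cmd) (B : ℝ≥0∞),
    Ev M lam g k s' q' B → Ev M lam g (C :: k) s q (lam * c + B)

theorem Exec.mono {C : Cmd} (h : Exec M C s q s₁ q₁ c) (hc : c ≤ c₁) : Exec M C s q s₁ q₁ c₁ :=
  fun lam g k B hk => (h lam g k B hk).mono (by gcongr)

theorem Exec.wset (M : Machine α) (s : Store α) (q : QState) (r : ℕ) (e : WExpr) :
    Exec M (.wset r e) s q (s.setReg r (e.eval M s)) q (e.cost M + 1) :=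
  fun _ _ _ _ hk => Ev.of_step (fun _ => rfl) hk

theorem Exec.wstore (M : Machine α) (s : Store α) (q : QState) (a : ℕ) (i e : WExpr) :
    Exec M (.wstore a i e) s q (s.setArr a (i.eval M s) (e.eval M s)) q
      (i.cost M + e.cost M + 1) :=
  fun _ _ _ _ hk => Ev.of_step (fun _ => rfl) hk

theorem Exec.vstore (M : Machine α) (s : Store α) (q : QState) (a : ℕ) (i : WExpr) (v : VExpr) :
    Exec M (.vstore a i v) s q (s.setVArr a (i.eval M s) (v.eval M s)) q
      (i.cost M + v.cost M + 1) :=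
  fun _ _ _ _ hk => Ev.of_step (fun _ => rfl) hk

theorem Exec.prep (M : Machine α) (s : Store α) (q : QState) (e : WExpr) :
    Exec M (.prep e) s q s (q.prep (e.eval M s)) (e.cost M + 1) :=
  fun _ _ _ _ hk => Ev.of_step (fun _ => rfl) hk

theorem Exec.phase (M : Machine α) (s : Store α) (q : QState) (r : ℕ) (b : BExpr) :
    Exec M (.phase r b) s q s (q.phase fun z => b.Holds M (s.setReg r z)) (2 * b.cost M + 1) :=
  fun _ _ _ _ hk => Ev.of_step (fun _ => rfl) hk

theorem Exec.diffuse (M : Machine α) (s : Store α) (q : QState) :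
    Exec M .diffuse s q s q.diffuse 1 :=
  fun _ _ _ _ hk => Ev.of_step (fun _ => rfl) hk

theorem Exec.seq {C₁ C₂ : Cmd} (h₁ : Exec M C₁ s q s₁ q₁ c₁) (h₂ : Exec M C₂ s₁ q₁ s₂ q₂ c₂) :
    Exec M (.seq C₁ C₂) s q s₂ q₂ (c₁ + c₂) := by
  intro lam g k B hk
  have h := h₁ _ _ _ _ (h₂ _ _ _ _ hk)
  have h' := Ev.of_step (c := .seq C₁ C₂) (T := 0) (k := k) (fun _ => rfl) h
  refine h'.mono (le_of_eq ?_)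
  push_cast
  ring

theorem Ev.seq {lam : ℝ≥0∞} {g : Store α → ℝ≥0∞} {k : List Cmd} {B : ℝ≥0∞} {C₁ C₂ : Cmd}
    (h : Ev M lam g (C₁ :: C₂ :: k) s q B) : Ev M lam g (.seq C₁ C₂ :: k) s q B :=
  (Ev.of_step (T := 0) (fun _ => rfl) h).mono (by simp)

theorem Ev.cond_pos {lam : ℝ≥0∞} {g : Store α → ℝ≥0∞} {k : List Cmd} {B : ℝ≥0∞} {C₁ C₂ : Cmd}
    {b : BExpr} (hb : b.Holds M s) (h : Ev M lam g (C₁ :: k) s q B) :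
    Ev M lam g (.cond b C₁ C₂ :: k) s q (lam * (b.cost M + 1 : ℕ) + B) :=
  Ev.of_step (fun _ => by simp only [step, if_pos hb]) h

theorem Ev.cond_neg {lam : ℝ≥0∞} {g : Store α → ℝ≥0∞} {k : List Cmd} {B : ℝ≥0∞} {C₁ C₂ : Cmd}
    {b : BExpr} (hb : ¬ b.Holds M s) (h : Ev M lam g (C₂ :: k) s q B) :
    Ev M lam g (.cond b C₁ C₂ :: k) s q (lam * (b.cost M + 1 : ℕ) + B) :=
  Ev.of_step (fun _ => by simp only [step, if_neg hb]) h

theorem Ev.loop_pos {lam : ℝ≥0∞} {g : Store α → ℝ≥0∞} {k : List Cmd} {B : ℝ≥0∞} {C : Cmd}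
    {b : BExpr} (hb : b.Holds M s) (h : Ev M lam g (C :: .loop b C :: k) s q B) :
    Ev M lam g (.loop b C :: k) s q (lam * (b.cost M + 1 : ℕ) + B) :=
  Ev.of_step (fun _ => by simp only [step, if_pos hb]) h

theorem Ev.loop_neg {lam : ℝ≥0∞} {g : Store α → ℝ≥0∞} {k : List Cmd} {B : ℝ≥0∞} {C : Cmd}
    {b : BExpr} (hb : ¬ b.Holds M s) (h : Ev M lam g k s q B) :
    Ev M lam g (.loop b C :: k) s q (lam * (b.cost M + 1 : ℕ) + B) :=
  Ev.of_step (fun _ => by simp only [step, if_neg hb]) h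

theorem Exec.cond_pos {C₁ C₂ : Cmd} {b : BExpr} (hb : b.Holds M s) (h : Exec M C₁ s q s₁ q₁ c) :
    Exec M (.cond b C₁ C₂) s q s₁ q₁ (b.cost M + 1 + c) := fun lam g k B hk =>
  (Ev.cond_pos hb (h lam g k B hk)).mono (le_of_eq (by push_cast; ring))

theorem Exec.cond_neg {C₁ C₂ : Cmd} {b : BExpr} (hb : ¬ b.Holds M s) (h : Exec M C₂ s q s₁ q₁ c) :
    Exec M (.cond b C₁ C₂) s q s₁ q₁ (b.cost M + 1 + c) := fun lam g k B hk =>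
  (Ev.cond_neg hb (h lam g k B hk)).mono (le_of_eq (by push_cast; ring))

theorem Exec.loop_pos {C : Cmd} {b : BExpr} (hb : b.Holds M s) (h : Exec M C s q s₁ q₁ c₁)
    (h' : Exec M (.loop b C) s₁ q₁ s₂ q₂ c₂) :
    Exec M (.loop b C) s q s₂ q₂ (b.cost M + 1 + c₁ + c₂) := fun lam g k B hk =>
  (Ev.loop_pos hb (h lam g _ _ (h' lam g k B hk))).mono (le_of_eq (by push_cast; ring))

theorem Exec.loop_neg {C : Cmd} {b : BExpr} (hb : ¬ b.Holds M s) :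
    Exec M (.loop b C) s q s q (b.cost M + 1) := fun _ _ _ _ hk => Ev.loop_neg hb hk

end Exec

/-! ### From `Ev` to running time and success probability -/

section Final

variable {α : Type u} [LinearOrder α] {M : Machine α}

theorem step_time_le (M : Machine α) (c c' : Config α) (h : step M c c' ≠ 0) : c.time ≤ c'.time := by
  obtain ⟨k, s, q, t⟩ := c
  rcases k with _ | ⟨C, k⟩
  · rw [← PMF.mem_support_iff] at h
    simp only [step, PMF.support_pure, Set.mem_singleton_iff] at h
    rw [h]
  · rw [← PMF.mem_support_iff] at h
    cases C <;> simp only [step, PMF.support_pure, Set.mem_singleton_iff, PMF.support_map,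
      Set.mem_image] at h
    all_goals first
      | (rw [h]; simp)
      | (obtain ⟨z, -, rfl⟩ := h; simp)

theorem time_mono (M : Machine α) (c : Config α) (n : ℕ) :
    ∑' c', run M c n c' * (c'.time : ℝ≥0∞) ≤ ∑' c', run M c (n + 1) c' * (c'.time : ℝ≥0∞) := by
  rw [run, tsum_bind_mul]
  refine ENNReal.tsum_le_tsum fun c' => ?_
  gcongr
  calc (c'.time : ℝ≥0∞) = ∑' d, step M c' d * (c'.time : ℝ≥0∞) := by
        rw [ENNReal.tsum_mul_right, PMF.tsum_coe, one_mul]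
    _ ≤ _ := by
        refine ENNReal.tsum_le_tsum fun d => ?_
        by_cases h : step M c' d = 0
        · simp [h]
        · gcongr
          exact step_time_le M c' d h

theorem expectedTime_le {P : Cmd} {input : List ℕ} {B : ℝ≥0∞}
    (h : Ev M 1 (fun _ => 0) [P] (start P input : Config α).store (start P input : Config α).q B) :
    expectedTime M P input ≤ B := by
  obtain ⟨n₀, h⟩ := h
  refine iSup_le fun n => ?_
  -- `Ev` speaks about long runs only; monotonicity in the number of steps covers the short ones.
  have hm : Monotone fun n => ∑' c', run M (start P input) n c' * (c'.time : ℝ≥0∞) :=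
    monotone_nat_of_le_succ fun n => time_mono M _ n
  refine (hm (le_max_left n n₀)).trans ?_
  have h' := h (max n n₀) (le_max_right _ _) 0
  simp only [Nat.cast_zero, mul_zero, zero_add] at h'
  refine le_trans ?_ h'
  refine ENNReal.tsum_le_tsum fun c => ?_
  refine mul_le_mul' le_rfl ?_
  simp only [payoff, one_mul]
  exact le_self_add

/-- With `lam = 0` the payoff is at least `1` on every configuration that is unfinished or has a bad
memory, so its expectation dominates the probability of not succeeding. -/
theorem le_haltProb {P : Cmd} {input : List ℕ} {B : ℝ≥0∞} {post : Store α → Prop}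
    {g : Store α → ℝ≥0∞} (hg : ∀ s, ¬ post s → 1 ≤ g s)
    (h : Ev M 0 g [P] (start P input : Config α).store (start P input : Config α).q B) :
    1 - B ≤ haltProb M P input post := by
  obtain ⟨n₀, h⟩ := h
  refine le_trans ?_ (le_iSup _ n₀)
  have h' := h n₀ le_rfl 0
  simp only [Nat.cast_zero, mul_zero, zero_add] at h'
  rw [tsub_le_iff_right]
  set p := run M (start P input : Config α) n₀
  rw [PMF.toOuterMeasure_apply]
  calc (1 : ℝ≥0∞) = ∑' c, p c := (PMF.tsum_coe p).symm
    _ ≤ ∑' c, (Set.indicator {c : Config α | c.todo = [] ∧ post c.store} p c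
          + p c * payoff 0 g c) := by
        refine ENNReal.tsum_le_tsum fun c => ?_
        by_cases hc : c.todo = [] ∧ post c.store
        · rw [Set.indicator_of_mem (by exact hc)]; exact le_self_add
        · refine le_trans ?_ le_add_self
          conv_lhs => rw [← mul_one (p c)]
          gcongr
          obtain ⟨k, s, q, t⟩ := c
          rcases k with _ | ⟨C, k⟩
          · simp only [payoff, zero_mul, zero_add]
            exact hg _ fun hp => hc ⟨rfl, hp⟩
          · simp [payoff]
    _ ≤ _ := by
        rw [ENNReal.tsum_add]
        gcongr
        exact h'

end Final

/-! ### Grover iterations on pairs of an element and an index -/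

section Quantum

/-- The register has dimension `K` and real amplitudes `f z / √K`. -/
def Amp (q : QState) (K : ℕ) (f : ℕ → ℝ) : Prop :=
  q.dim = K ∧ ∀ z : Fin q.dim, q.vec z = ((f z / Real.sqrt K : ℝ) : ℂ)

theorem Amp.prep (q : QState) {K : ℕ} (hK : K ≠ 0) : Amp (q.prep K) K fun _ => 1 := by
  rw [QState.prep, dif_pos hK]
  refine ⟨rfl, fun z => ?_⟩
  simp [unif]

open Classical in
theorem Amp.phase {q : QState} {K : ℕ} {f : ℕ → ℝ} (h : Amp q K f) (p : ℕ → Prop) :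
    Amp (q.phase p) K fun z => if p z then - f z else f z := by
  refine ⟨h.1, fun z => ?_⟩
  have := h.2 z
  simp only [QState.phase]
  split_ifs
  · rw [this]; push_cast; ring
  · exact this

/-- In these coordinates the reflection is Grover's inversion about the mean: the inner product with
the uniform state is the mean, because both vectors carry a factor `1 / √K`. -/
theorem Amp.diffuse {q : QState} {K : ℕ} {f : ℕ → ℝ} (h : Amp q K f) (hK : K ≠ 0) :
    Amp q.diffuse K fun z => 2 * ((∑ j ∈ Finset.range K, f j) / K) - f z := by
  obtain ⟨n, v, hv⟩ := q
  obtain ⟨rfl, h⟩ := h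
  refine ⟨rfl, fun z => ?_⟩
  simp only at h hK z ⊢
  simp only [QState.diffuse]
  have hn : (0 : ℝ) < n := by exact_mod_cast Nat.pos_of_ne_zero hK
  have hs : Real.sqrt n * Real.sqrt n = n := Real.mul_self_sqrt hn.le
  have hs0 : Real.sqrt n ≠ 0 := (Real.sqrt_pos.2 hn).ne'
  rw [Submodule.reflection_singleton_apply]
  have hin : inner ℂ (unif n) v = (((∑ j ∈ Finset.range n, f j) / n : ℝ) : ℂ) := by
    simp only [PiLp.inner_apply, unif]
    rw [← Fin.sum_univ_eq_sum_range]
    push_cast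
    rw [Finset.sum_div]
    refine Finset.sum_congr rfl fun j _ => ?_
    rw [h j]
    rw [RCLike.inner_apply, map_inv₀, Complex.conj_ofReal, ← Complex.ofReal_natCast,
      ← Complex.ofReal_inv, ← Complex.ofReal_mul, ← Complex.ofReal_div]
    congr 1
    field_simp
    rw [sq, hs]
  rw [hin, norm_unif hK]
  change (2 • (((((∑ j ∈ Finset.range n, f j) / n : ℝ) : ℂ) / ((1 : ℝ) : ℂ) ^ 2) •
    (((Real.sqrt n)⁻¹ : ℝ) : ℂ))) - v z = _
  rw [h z]
  simp only [nsmul_eq_mul, smul_eq_mul]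
  push_cast
  ring

variable {N : ℕ}

/-- The set `S` of domain elements as a predicate on numbers. -/
def Mem (S : Finset (Fin N)) (y : ℕ) : Prop := ∃ h : y < N, (⟨y, h⟩ : Fin N) ∈ S

theorem mem_val {S : Finset (Fin N)} (y : Fin N) : Mem S y ↔ y ∈ S :=
  ⟨fun ⟨_, h⟩ => h, fun h => ⟨y.2, h⟩⟩

theorem sum_range_mul_eq {β : Type*} [AddCommMonoid β] (f : ℕ → β) (m N : ℕ) :
    ∑ z ∈ Finset.range (m * N), f z =
      ∑ r ∈ Finset.range m, ∑ y : Fin N, f (y + N * r) := by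
  rw [← Fin.sum_univ_eq_sum_range, ← Equiv.sum_comp finProdFinEquiv, Fintype.sum_prod_type,
    Finset.sum_range]
  rfl

open Classical in
/-- Amplitude `a` on the bad basis states and `g r` on the good ones of index `r`; a basis state
`z` is the pair of the element `z % N` and the index `z / N`. -/
noncomputable def twoLevel (S : Finset (Fin N)) (a : ℝ) (g : ℕ → ℝ) (z : ℕ) : ℝ :=
  if Mem S (z % N) then g (z / N) else a

open Classical in
theorem twoLevel_pair (S : Finset (Fin N)) (a : ℝ) (g : ℕ → ℝ) (y : Fin N) (r : ℕ) :
    twoLevel S a g (y + N * r) = if y ∈ S then g r else a := by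
  have h1 : ((y : ℕ) + N * r) % N = y := by rw [Nat.add_mul_mod_self_left, Nat.mod_eq_of_lt y.2]
  have h2 : ((y : ℕ) + N * r) / N = r := by
    rw [Nat.add_mul_div_left _ _ (by have := y.2; omega), Nat.div_eq_of_lt y.2, zero_add]
  rw [twoLevel, h1, h2]
  exact if_congr (mem_val y) rfl rfl

open Classical in
theorem sum_ite_mem_real (S : Finset (Fin N)) (x y : ℝ) :
    ∑ i : Fin N, (if i ∈ S then x else y) = S.card * x + (N - S.card) * y := by
  have h : ∀ i : Fin N, (if i ∈ S then x else y) = (if i ∈ S then x - y else 0) + y := by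
    intro i; split_ifs <;> ring
  simp only [h, Finset.sum_add_distrib]
  rw [Finset.sum_ite_mem]
  simp
  ring

/-- The mean of the amplitudes after the sign flip. -/
noncomputable def flipMean (N : ℕ) (t a g x : ℝ) : ℝ := ((N - t) * a + t * (1 - 2 * x) * g) / N

open Classical in
/-- One Grover iteration in which only the good basis states of index below `R` are flipped. -/
theorem Amp.flip {q : QState} {S : Finset (Fin N)} {m R : ℕ} {a g : ℝ} (hN : N ≠ 0) (hm : m ≠ 0)
    (hR : R ≤ m) (h : Amp q (m * N) (twoLevel S a fun _ => g)) {p : ℕ → Prop}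
    (hp : ∀ z, z < m * N → (p z ↔ Mem S (z % N) ∧ z / N < R)) :
    Amp (q.phase p).diffuse (m * N)
      (twoLevel S (2 * flipMean N S.card a g (R / m) - a)
        fun r => 2 * flipMean N S.card a g (R / m) + if r < R then g else -g) := by
  have hN' : (N : ℝ) ≠ 0 := by exact_mod_cast hN
  have hm' : (m : ℝ) ≠ 0 := by exact_mod_cast hm
  have h1 := (h.phase p).diffuse (by positivity)
  refine ⟨h1.1, fun z => ?_⟩
  have hz : (z : ℕ) < m * N := lt_of_lt_of_eq z.2 h1.1
  rw [h1.2 z]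
  -- For each good element exactly `R` of the `m` indices change sign, so the mean depends on the
  -- flipped set only through the fraction `R / m`.
  have hmean : (∑ j ∈ Finset.range (m * N),
      if p j then -twoLevel S a (fun _ => g) j else twoLevel S a (fun _ => g) j) / (m * N : ℕ)
      = flipMean N S.card a g (R / m) := by
    rw [div_eq_iff (by positivity)]
    have e1 : ∀ j ∈ Finset.range (m * N),
        (if p j then -twoLevel S a (fun _ => g) j else twoLevel S a (fun _ => g) j) =
        twoLevel S a (fun r => if r < R then -g else g) j := by
      intro j hj
      have := hp j (Finset.mem_range.1 hj)
      simp only [twoLevel]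
      by_cases h3 : Mem S (j % N) <;> by_cases h4 : j / N < R <;> simp_all
    rw [Finset.sum_congr rfl e1, sum_range_mul_eq]
    simp only [twoLevel_pair, sum_ite_mem_real]
    rw [Finset.sum_add_distrib, ← Finset.mul_sum]
    have e2 : ∑ r ∈ Finset.range m, (if r < R then -g else g) = (m - 2 * R) * g := by
      have : ∀ r, (if r < R then -g else g) = g - 2 * g * (if r < R then 1 else 0) := by
        intro r; split_ifs <;> ring
      simp only [this]
      rw [Finset.sum_sub_distrib, ← Finset.mul_sum, Finset.sum_boole]
      have : (Finset.range m).filter (· < R) = Finset.range R := by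
        ext; simp; omega
      rw [this]
      simp
      ring
    rw [e2]
    simp only [flipMean, Finset.sum_const, Finset.card_range, nsmul_eq_mul]
    push_cast
    field_simp
    ring
  have e3 := hp z hz
  simp only [hmean]
  congr 2
  simp only [twoLevel]
  by_cases h3 : Mem S ((z : ℕ) % N) <;> by_cases h4 : (z : ℕ) / N < R <;>
    simp [h3, h4, e3, sub_eq_add_neg]

/-- When all indices are flipped the good amplitudes stay equal, so the step can be iterated; after
a partial flip they are not. -/
theorem Amp.flip_all {q : QState} {S : Finset (Fin N)} {m : ℕ} {a g : ℝ} (hN : N ≠ 0) (hm : m ≠ 0)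
    (h : Amp q (m * N) (twoLevel S a fun _ => g)) {p : ℕ → Prop}
    (hp : ∀ z, z < m * N → (p z ↔ Mem S (z % N) ∧ z / N < m)) :
    Amp (q.phase p).diffuse (m * N)
      (twoLevel S (2 * flipMean N S.card a g 1 - a) fun _ => 2 * flipMean N S.card a g 1 + g) := by
  have h1 := Amp.flip hN hm le_rfl h hp
  have hm' : (m : ℝ) ≠ 0 := by exact_mod_cast hm
  rw [div_self hm'] at h1
  refine ⟨h1.1, fun z => ?_⟩
  have hz : (z : ℕ) < m * N := lt_of_lt_of_eq z.2 h1.1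
  rw [h1.2 z]
  have : (z : ℕ) / N < m := by rw [Nat.div_lt_iff_lt_mul (by omega)]; exact hz
  simp [twoLevel, this]

/-- The average over `S`, which is `0` if `S` is empty. -/
noncomputable def avg (S : Finset (Fin N)) (A : ℕ → ℝ≥0∞) : ℝ≥0∞ := (∑ y ∈ S, A y) / S.card

/-- Equality fails for the empty set, whose average is `0`. -/
theorem avg_add_const_le (S : Finset (Fin N)) (A : ℕ → ℝ≥0∞) (c : ℝ≥0∞) :
    avg S (fun y => c + A y) ≤ c + avg S A := by
  rcases S.eq_empty_or_nonempty with rfl | hS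
  · simp [avg]
  · have h0 : (S.card : ℝ≥0∞) ≠ 0 := by simpa using hS.ne_empty
    simp only [avg, Finset.sum_add_distrib, Finset.sum_const, nsmul_eq_mul, ENNReal.add_div]
    rw [mul_comm, ENNReal.mul_div_cancel_right h0 (by simp)]

open Classical in
/-- A measurement finds every good element with the same probability. -/
theorem Amp.sum_outcome {q : QState} {S : Finset (Fin N)} {m : ℕ} {a : ℝ} {g : ℕ → ℝ}
    (hN : N ≠ 0) (hm : m ≠ 0) (h : Amp q (m * N) (twoLevel S a g)) (A : ℕ → ℝ≥0∞) (B : ℝ≥0∞) :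
    ∑ z, ENNReal.ofReal (‖q.vec z‖ ^ 2) *
        (if Mem S (z % N) then A (z % N) else avg S A + B) =
      avg S A + ENNReal.ofReal ((N - S.card) / N * a ^ 2) * B := by
  have hN' : (0 : ℝ) < N := by exact_mod_cast Nat.pos_of_ne_zero hN
  have hm' : (0 : ℝ) < m := by exact_mod_cast Nat.pos_of_ne_zero hm
  have hS : (S.card : ℝ) ≤ N := by
    have := Finset.card_le_univ S
    rw [Fintype.card_fin] at this
    exact_mod_cast this
  have key : ∀ F : ℕ → ℝ≥0∞, ∑ z : Fin q.dim, ENNReal.ofReal (‖q.vec z‖ ^ 2) * F z =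
      ∑ r ∈ Finset.range m, ∑ y : Fin N,
        ENNReal.ofReal ((if y ∈ S then g r else a) ^ 2 / (m * N)) * F (y + N * r) := by
    intro F
    have e : ∀ z : Fin q.dim, ENNReal.ofReal (‖q.vec z‖ ^ 2) * F z =
        ENNReal.ofReal (twoLevel S a g z ^ 2 / (m * N)) * F z := by
      intro z
      rw [h.2 z, Complex.norm_real, Real.norm_eq_abs, sq_abs, div_pow, Real.sq_sqrt (by positivity)]
      push_cast
      rfl
    simp only [e]
    rw [Fin.sum_univ_eq_sum_range
      (fun z => ENNReal.ofReal (twoLevel S a g z ^ 2 / (m * N)) * F z), h.1, sum_range_mul_eq]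
    simp only [twoLevel_pair]
  set pb : ℝ≥0∞ := ENNReal.ofReal ((N - S.card) / N * a ^ 2) with hpb
  -- The probability of one particular good element, summed over its indices. The amplitude may
  -- depend on the index but not on the element, so `w` is the same for all of them.
  set w : ℝ≥0∞ := ∑ r ∈ Finset.range m, ENNReal.ofReal (g r ^ 2 / (m * N)) with hw
  have hbad : ∑ r ∈ Finset.range m, ∑ y ∈ Sᶜ, ENNReal.ofReal (a ^ 2 / (m * N)) = pb := by
    simp only [Finset.sum_const, Finset.card_range, Finset.card_compl, Fintype.card_fin,
      nsmul_eq_mul, hpb]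
    rw [← ENNReal.ofReal_natCast, ← ENNReal.ofReal_natCast, ← ENNReal.ofReal_mul (by positivity),
      ← ENNReal.ofReal_mul (by positivity), Nat.cast_sub (by exact_mod_cast hS)]
    congr 1
    field_simp
  have split : ∀ X Y : ℕ → ℝ≥0∞, ∀ Z : ℝ≥0∞, ∑ r ∈ Finset.range m, ∑ y : Fin N,
        ENNReal.ofReal ((if y ∈ S then g r else a) ^ 2 / (m * N)) *
          (if y ∈ S then X y else Z) = (∑ y ∈ S, X y) * w + pb * Z := by
    intro X Y Z
    have : ∀ r : ℕ, ∑ y : Fin N, ENNReal.ofReal ((if y ∈ S then g r else a) ^ 2 / (m * N)) *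
          (if y ∈ S then X y else Z) = ENNReal.ofReal (g r ^ 2 / (m * N)) * (∑ y ∈ S, X y) +
          (∑ y ∈ Sᶜ, ENNReal.ofReal (a ^ 2 / (m * N))) * Z := by
      intro r
      rw [← Finset.sum_add_sum_compl S, Finset.mul_sum, Finset.sum_mul]
      congr 1
      · exact Finset.sum_congr rfl fun y hy => by simp [hy]
      · exact Finset.sum_congr rfl fun y hy => by simp [Finset.mem_compl.1 hy]
    simp only [this, Finset.sum_add_distrib, ← Finset.sum_mul, hbad]
    rw [← hw, mul_comm w]
  -- The unit norm of the state, split into its good and bad parts.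
  have htot : (S.card : ℝ≥0∞) * w + pb = 1 := by
    have h1 : ∑ z : Fin q.dim, ENNReal.ofReal (‖q.vec z‖ ^ 2) * 1 = 1 := by
      simp only [mul_one]
      rw [← ENNReal.ofReal_sum_of_nonneg fun _ _ => by positivity, ← EuclideanSpace.norm_sq_eq,
        q.norm_vec]
      simp
    have h2 := key fun _ => 1
    rw [h1] at h2
    have h3 := split (fun _ => 1) (fun _ => 1) 1
    simp only [ite_self] at h3
    rw [← h2] at h3
    simpa using h3.symm
  rw [key fun z => if Mem S (z % N) then A (z % N) else avg S A + B]
  have e : ∀ (r : ℕ) (y : Fin N), (if Mem S (((y : ℕ) + N * r) % N) then A ((y + N * r) % N)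
      else avg S A + B) = if y ∈ S then A y else avg S A + B := by
    intro r y
    have h1 : ((y : ℕ) + N * r) % N = y := by rw [Nat.add_mul_mod_self_left, Nat.mod_eq_of_lt y.2]
    rw [h1]
    exact if_congr (mem_val y) rfl rfl
  simp only [e]
  rw [split A A]
  have hA : ∑ y ∈ S, A y = S.card * avg S A := by
    rcases S.eq_empty_or_nonempty with rfl | hS
    · simp
    · rw [avg, ENNReal.mul_div_cancel (by simpa using hS.ne_empty) (by simp)]
  calc (∑ y ∈ S, A y) * w + pb * (avg S A + B) = (S.card * w + pb) * avg S A + pb * B := by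
        rw [hA]; ring
    _ = _ := by rw [htot, one_mul]

end Quantum

/-! ### Improving elements -/

section Improving

variable {ι κ β : Type*} [Fintype ι] [DecidableEq ι] [LinearOrder κ] [DecidableEq β]

/-- The types of the elements of `A` that are cheaper than `y`. -/
def cheapTypes (key : ι → κ) (G : ι → β) (A : Finset ι) (y : ι) : Finset β :=
  (A.filter fun x => key x < key y).image G

/-- The elements outside `A` that belong to the best choice of `d` different types from `A` and
themselves. -/
def improving (key : ι → κ) (G : ι → β) (d : ℕ) (A : Finset ι) : Finset ι :=
  Finset.univ.filter fun y =>
    y ∉ A ∧ G y ∉ cheapTypes key G A y ∧ (cheapTypes key G A y).card < d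

variable {key : ι → κ} {G : ι → β} {d : ℕ} {A B : Finset ι} {y z : ι}

theorem mem_improving : y ∈ improving key G d A ↔
    y ∉ A ∧ G y ∉ cheapTypes key G A y ∧ (cheapTypes key G A y).card < d := by
  simp [improving]

theorem cheapTypes_mono (h : A ⊆ B) : cheapTypes key G A y ⊆ cheapTypes key G B y :=
  Finset.image_subset_image (Finset.filter_subset_filter _ h)

theorem cheapTypes_mono_key (h : key y ≤ key z) : cheapTypes key G A y ⊆ cheapTypes key G A z :=
  Finset.image_subset_image fun x hx => by
    simp only [Finset.mem_filter] at hx ⊢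
    exact ⟨hx.1, hx.2.trans_le h⟩

theorem improving_anti (h : A ⊆ B) : improving key G d B ⊆ improving key G d A := by
  intro y hy
  rw [mem_improving] at hy ⊢
  exact ⟨fun hA => hy.1 (h hA), fun hc => hy.2.1 (cheapTypes_mono h hc),
    (Finset.card_le_card (cheapTypes_mono h)).trans_lt hy.2.2⟩

/-- If `z` is cheaper than an improving `y`, the type of `z` is already among the cheap types of
`y`: otherwise it would also be missing from the cheap types of `z`, which are fewer than `d`, and
`z` would be improving. So `z` adds no cheap type to any improving `y`. -/
theorem improving_insert_of_notMem (hz : z ∉ improving key G d A) :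
    improving key G d (insert z A) = improving key G d A := by
  by_cases hzA : z ∈ A
  · rw [Finset.insert_eq_self.2 hzA]
  refine (improving_anti (Finset.subset_insert _ _)).antisymm fun y hy => ?_
  have hyz : y ≠ z := by rintro rfl; exact hz hy
  rw [mem_improving] at hy ⊢
  rw [mem_improving] at hz
  refine ⟨by simp [hyz, hy.1], ?_⟩
  suffices h : cheapTypes key G (insert z A) y = cheapTypes key G A y by rw [h]; exact hy.2
  by_cases hk : key z < key y
  · have hsub := cheapTypes_mono_key (G := G) (A := A) hk.le
    have hGz : G z ∈ cheapTypes key G A y := by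
      by_contra hc
      exact hz ⟨hzA, fun h => hc (hsub h), (Finset.card_le_card hsub).trans_lt hy.2.2⟩
    rw [cheapTypes, Finset.filter_insert, if_pos hk, Finset.image_insert]
    exact Finset.insert_eq_self.2 hGz
  · rw [cheapTypes, Finset.filter_insert, if_neg hk]
    rfl

theorem improving_union_of_disjoint {D : Finset ι} (hD : Disjoint D (improving key G d A)) :
    improving key G d (A ∪ D) = improving key G d A := by
  induction D using Finset.induction_on with
  | empty => simp
  | insert z D hz ih =>
    rw [Finset.disjoint_insert_left] at hD
    rw [Finset.union_insert, improving_insert_of_notMem, ih hD.2]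
    rw [ih hD.2]
    exact hD.1

/-- The elements of `B` that improve on the others are at most `d`. -/
theorem card_filter_mem_improving_le (hk : Function.Injective key) (hd : 1 ≤ d) (B : Finset ι) :
    (B.filter fun z => z ∈ improving key G d (B.erase z)).card ≤ d := by
  set O := B.filter fun z => z ∈ improving key G d (B.erase z) with hO
  rcases O.eq_empty_or_nonempty with h | h
  · simp [h]
  -- All other improving elements are cheaper than the costliest one `m`, so their types are cheap
  -- types of `m`, of which there are fewer than `d`. They have different types, since of two
  -- elements of one type the costlier is blocked by the cheaper.
  obtain ⟨m, hm, hmax⟩ := O.exists_max_image key h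
  have hlt : ∀ x ∈ O, x ≠ m → key x < key m := fun x hx hne =>
    lt_of_le_of_ne (hmax x hx) fun he => hne (hk he)
  have hmi := (mem_improving.1 (Finset.mem_filter.1 hm).2).2.2
  have hinj : Set.InjOn G (O.erase m : Finset ι) := by
    have key' : ∀ x ∈ O, ∀ x' ∈ O, G x = G x' → ¬ key x < key x' := by
      intro x hx x' hx' hG hlt
      have h2 := (mem_improving.1 (Finset.mem_filter.1 hx').2).2.1
      apply h2
      rw [← hG]
      refine Finset.mem_image_of_mem _ (Finset.mem_filter.2 ⟨Finset.mem_erase.2 ⟨?_, ?_⟩, hlt⟩)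
      · rintro rfl; exact lt_irrefl _ hlt
      · exact (Finset.mem_filter.1 hx).1
    intro x hx x' hx' hG
    have hx1 := (Finset.mem_erase.1 (Finset.mem_coe.1 hx)).2
    have hx2 := (Finset.mem_erase.1 (Finset.mem_coe.1 hx')).2
    exact hk (le_antisymm (not_lt.1 (key' _ hx2 _ hx1 hG.symm)) (not_lt.1 (key' _ hx1 _ hx2 hG)))
  have hsub : (O.erase m).image G ⊆ cheapTypes key G (B.erase m) m := by
    refine Finset.image_subset_image fun x hx => ?_
    rw [Finset.mem_erase] at hx
    exact Finset.mem_filter.2 ⟨Finset.mem_erase.2 ⟨hx.1, (Finset.mem_filter.1 hx.2).1⟩,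
      hlt x hx.2 hx.1⟩
  have h1 := Finset.card_le_card hsub
  rw [Finset.card_image_of_injOn hinj, Finset.card_erase_of_mem hm] at h1
  omega

end Improving

/-! ### Scans in random order and backward analysis -/

section Potential

variable {ι : Type*} [Fintype ι] [DecidableEq ι]

/-- The expected total cost of a scan, in random order, of the elements outside `A`, where an
element is charged `c` of the number of improving elements when it is improving itself. The first
argument is the number of elements still to be scanned. -/
noncomputable def scanCost (I : Finset ι → Finset ι) (c : ℕ → ℝ) : ℕ → Finset ι → ℝ
  | 0, _ => 0
  | n + 1, A => ((I A).card * c (I A).card + ∑ z ∈ Aᶜ, scanCost I c n (insert z A)) / (n + 1)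

variable {I : Finset ι → Finset ι} {c : ℕ → ℝ}

/-- An element that is not improving is free and changes nothing, so it may be deleted from the
random order. In the induction the sum over the next element splits into `z` itself and the others;
for the others `z` remains not improving, and the induction hypothesis removes it. -/
theorem scanCost_insert (hmono : ∀ A z, I (insert z A) ⊆ I A)
    (hI : ∀ A z, z ∉ I A → I (insert z A) = I A) (hd : ∀ A, Disjoint (I A) A) (n : ℕ) (A : Finset ι) (hA : Aᶜ.card = n + 1) {z : ι}
    (hzA : z ∉ A) (hz : z ∉ I A) : scanCost I c n (insert z A) = scanCost I c (n + 1) A := by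
  induction n generalizing A with
  | zero =>
    obtain ⟨x, hx⟩ := Finset.card_eq_one.1 hA
    have hzx : z ∈ Aᶜ := Finset.mem_compl.2 hzA
    have : I A = ∅ := by
      refine Finset.eq_empty_of_forall_notMem fun y hy => ?_
      have hy' : y ∈ Aᶜ := Finset.mem_compl.2 (Finset.disjoint_left.1 (hd A) hy)
      rw [hx, Finset.mem_singleton] at hy' hzx
      exact hz (by rw [hzx, ← hy']; exact hy)
    simp [scanCost, this]
  | succ n ih =>
    have hc : (insert z A)ᶜ.card = n + 1 := by
      rw [Finset.compl_insert, Finset.card_erase_of_mem (Finset.mem_compl.2 hzA), hA]; rfl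
    have e1 : ∀ y ∈ (insert z A)ᶜ, scanCost I c (n + 1) (insert y A) =
        scanCost I c n (insert y (insert z A)) := by
      intro y hy
      rw [Finset.mem_compl, Finset.mem_insert, not_or] at hy
      rw [Finset.insert_comm]
      refine (ih (insert y A) ?_ ?_ ?_).symm
      · rw [Finset.compl_insert, Finset.card_erase_of_mem (Finset.mem_compl.2 hy.2), hA]; rfl
      · simp [hzA, Ne.symm hy.1]
      · exact fun hzI => hz (hmono _ _ hzI)
    have e2 : ∑ y ∈ Aᶜ, scanCost I c (n + 1) (insert y A) = scanCost I c (n + 1) (insert z A) +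
        ∑ y ∈ (insert z A)ᶜ, scanCost I c n (insert y (insert z A)) := by
      rw [← Finset.sum_congr rfl e1, Finset.compl_insert, ← Finset.add_sum_erase _ _
        (Finset.mem_compl.2 hzA)]
    have e3 : ∑ y ∈ (insert z A)ᶜ, scanCost I c n (insert y (insert z A)) =
        (n + 1) * scanCost I c (n + 1) (insert z A) - (I A).card * c (I A).card := by
      rw [scanCost, hI _ _ hz]
      field_simp
      ring
    rw [scanCost.eq_2 (n := n + 1), e2, e3]
    push_cast
    field_simp
    ring

/-- The expected cost still to be paid when the improving elements are those of `A`. -/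
noncomputable def potential (I : Finset ι → Finset ι) (c : ℕ → ℝ) (A : Finset ι) : ℝ :=
  scanCost I c (I A).card (I A)ᶜ

/-- The unscanned elements that are not improving are deleted one at a time by `scanCost_insert`. -/
theorem scanCost_eq_potential (hmono : ∀ A z, I (insert z A) ⊆ I A)
    (hI : ∀ A z, z ∉ I A → I (insert z A) = I A) (hd : ∀ A, Disjoint (I A) A) (A : Finset ι) :
    scanCost I c Aᶜ.card A = potential I c A := by
  induction h : (Aᶜ \ I A).card generalizing A with
  | zero =>
    rw [Finset.card_eq_zero, Finset.sdiff_eq_empty_iff_subset] at h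
    have : Aᶜ = I A := h.antisymm fun x hx => Finset.mem_compl.2 (Finset.disjoint_left.1 (hd A) hx)
    rw [potential, ← this, compl_compl]
  | succ n ih =>
    obtain ⟨z, hz⟩ : (Aᶜ \ I A).Nonempty := Finset.card_pos.1 (by omega)
    have hz' := Finset.mem_sdiff.1 hz
    have hzA := Finset.mem_compl.1 hz'.1
    have hc : Aᶜ.card = (insert z A)ᶜ.card + 1 := by
      rw [Finset.compl_insert, Finset.card_erase_add_one hz'.1]
    rw [hc, ← scanCost_insert hmono hI hd _ _ hc hzA hz'.2, ih, potential, potential,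
      hI _ _ hz'.2]
    rw [hI _ _ hz'.2, Finset.compl_insert, Finset.erase_sdiff_comm, Finset.card_erase_of_mem hz, h]
    rfl

theorem improving_closed (hI : ∀ A z, z ∉ I A → I (insert z A) = I A)
    (hd : ∀ A, Disjoint (I A) A) (A : Finset ι) : I (I A)ᶜ = I A := by
  have h : ∀ D : Finset ι, Disjoint D (I A) → I (A ∪ D) = I A := by
    intro D
    induction D using Finset.induction_on with
    | empty => simp
    | insert z D hz ih =>
      intro hD
      rw [Finset.disjoint_insert_left] at hD
      rw [Finset.union_insert, hI, ih hD.2]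
      rw [ih hD.2]
      exact hD.1
  have := h (I A)ᶜ disjoint_compl_left
  rwa [Finset.union_eq_right.2] at this
  intro x hx
  exact Finset.mem_compl.2 (Finset.disjoint_right.1 (hd A) hx)

/-- With everything outside `I A` regarded as scanned, the next element of the scan is uniform in `I
A`, exactly like the outcome of a successful search. This recursion matches one round of the main
loop. -/
theorem potential_eq (hmono : ∀ A z, I (insert z A) ⊆ I A)
    (hI : ∀ A z, z ∉ I A → I (insert z A) = I A) (hd : ∀ A, Disjoint (I A) A) (A : Finset ι)
    (hA : (I A).Nonempty) :
    potential I c A = c (I A).card +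
      (∑ z ∈ I A, potential I c (insert z (I A)ᶜ)) / (I A).card := by
  obtain ⟨n, hn⟩ : ∃ n, (I A).card = n + 1 := ⟨(I A).card - 1, by have := hA.card_pos; omega⟩
  have h1 : ∀ z ∈ I A, scanCost I c n (insert z (I A)ᶜ) = potential I c (insert z (I A)ᶜ) := by
    intro z hz
    rw [← scanCost_eq_potential hmono hI hd]
    congr 1
    rw [Finset.compl_insert, compl_compl, Finset.card_erase_of_mem hz, hn]
    rfl
  rw [potential, hn, scanCost, improving_closed hI hd, compl_compl, Finset.sum_congr rfl h1, hn]
  push_cast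
  field_simp

theorem potential_congr {A B : Finset ι} (h : I A = I B) : potential I c A = potential I c B := by
  rw [potential, potential, h]

/-- Backward analysis: a set with a next element is the same as a larger set with a last element. -/
theorem sum_powersetCard_compl (F : Finset ι → ι → ℝ) (k : ℕ) :
    ∑ A ∈ Finset.powersetCard k Finset.univ, ∑ z ∈ Aᶜ, F A z =
      ∑ B ∈ Finset.powersetCard (k + 1) Finset.univ, ∑ z ∈ B, F (B.erase z) z := by
  rw [Finset.sum_sigma', Finset.sum_sigma']
  refine Finset.sum_bij' (fun x _ => ⟨insert x.2 x.1, x.2⟩) (fun x _ => ⟨x.1.erase x.2, x.2⟩)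
    ?_ ?_ ?_ ?_ ?_
  · rintro ⟨A, z⟩ h
    simp only [Finset.mem_sigma, Finset.mem_powersetCard_univ, Finset.mem_compl] at h ⊢
    exact ⟨by rw [Finset.card_insert_of_notMem h.2, h.1], Finset.mem_insert_self _ _⟩
  · rintro ⟨B, z⟩ h
    simp only [Finset.mem_sigma, Finset.mem_powersetCard_univ, Finset.mem_compl] at h ⊢
    exact ⟨by rw [Finset.card_erase_of_mem h.2, h.1]; rfl, Finset.notMem_erase _ _⟩
  · rintro ⟨A, z⟩ h
    simp only [Finset.mem_sigma, Finset.mem_compl] at h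
    simp [h.2]
  · rintro ⟨B, z⟩ h
    simp only [Finset.mem_sigma] at h
    simp [h.2]
  · rintro ⟨A, z⟩ h
    simp only [Finset.mem_sigma, Finset.mem_compl] at h
    simp [h.2]

/-- After `k` steps from the empty set the scanned set is a uniformly random `k`-subset, so the
hypothesis says that the mean charge of step `k` is at most `b k`. The induction runs backwards from
the full set; each set of size `k + 1` has `k + 1` predecessors. -/
theorem scanCost_empty_le {b : ℕ → ℝ}
    (hb : ∀ k < Fintype.card ι, ∑ A ∈ Finset.powersetCard k (Finset.univ : Finset ι),
      (I A).card * c (I A).card ≤ (Fintype.card ι).choose k * (Fintype.card ι - k : ℕ) * b k) :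
    scanCost I c (Fintype.card ι) ∅ ≤ ∑ k ∈ Finset.range (Fintype.card ι), b k := by
  set N := Fintype.card ι with hN
  have key : ∀ j ≤ N, ∑ A ∈ Finset.powersetCard (N - j) (Finset.univ : Finset ι),
      scanCost I c j A ≤ N.choose (N - j) * ∑ k ∈ Finset.Ico (N - j) N, b k := by
    intro j
    induction j with
    | zero => simp [scanCost]
    | succ j ih =>
      intro hj
      specialize ih (by omega)
      set k := N - (j + 1) with hk
      have hkj : N - j = k + 1 := by omega
      have hNk : N - k = j + 1 := by omega
      have hb' := hb k (by omega)
      rw [hkj] at ih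
      rw [Finset.sum_eq_sum_Ico_succ_bot (by omega)]
      have hch : ((N.choose (k + 1) : ℕ) : ℝ) * (k + 1) = N.choose k * (j + 1) := by
        have := Nat.choose_succ_right_eq N k
        rw [hNk] at this
        exact_mod_cast this
      have hsum : ∑ A ∈ Finset.powersetCard k (Finset.univ : Finset ι),
          ∑ z ∈ Aᶜ, scanCost I c j (insert z A) =
          (k + 1) * ∑ B ∈ Finset.powersetCard (k + 1) (Finset.univ : Finset ι),
            scanCost I c j B := by
        rw [sum_powersetCard_compl fun A z => scanCost I c j (insert z A), Finset.mul_sum]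
        refine Finset.sum_congr rfl fun B hB => ?_
        rw [Finset.mem_powersetCard_univ] at hB
        rw [Finset.sum_congr rfl fun z hz => by rw [Finset.insert_erase hz], Finset.sum_const, hB]
        simp
      simp only [scanCost, ← Finset.sum_div, Finset.sum_add_distrib]
      rw [hsum, div_le_iff₀ (by positivity)]
      rw [hNk] at hb'
      push_cast at hb'
      calc _ ≤ N.choose k * (j + 1) * b k +
            (k + 1) * (N.choose (k + 1) * ∑ i ∈ Finset.Ico (k + 1) N, b i) := by gcongr
        _ = _ := by linear_combination (∑ i ∈ Finset.Ico (k + 1) N, b i) * hch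
  have h := key N le_rfl
  simpa using h

/-- Count the pairs of a `k`-set `A` and `z ∈ I A` by the set `B = A ∪ {z}`: each `B` contributes at
most `d`. -/
theorem sum_card_improving_le {d : ℕ}
    (hcard : ∀ B : Finset ι, (B.filter fun z => z ∈ I (B.erase z)).card ≤ d)
    (hd : ∀ A, Disjoint (I A) A) {k : ℕ} :
    ∑ A ∈ Finset.powersetCard k (Finset.univ : Finset ι), ((I A).card : ℝ) ≤
      (Fintype.card ι).choose k * (Fintype.card ι - k : ℕ) * (d / (k + 1)) := by
  have h1 : ∀ A : Finset ι, ((I A).card : ℝ) = ∑ z ∈ Aᶜ, if z ∈ I A then (1 : ℝ) else 0 := by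
    intro A
    rw [Finset.sum_boole]
    congr 2
    ext x
    simp only [Finset.mem_filter, Finset.mem_compl]
    exact ⟨fun h => ⟨Finset.disjoint_left.1 (hd A) h, h⟩, fun h => h.2⟩
  rw [Finset.sum_congr rfl fun A _ => h1 A, sum_powersetCard_compl fun A z => if z ∈ I A then 1 else 0]
  have hch := Nat.choose_succ_right_eq (Fintype.card ι) k
  have hch' : (((Fintype.card ι).choose (k + 1) : ℕ) : ℝ) * (k + 1) =
      (Fintype.card ι).choose k * (Fintype.card ι - k : ℕ) := by exact_mod_cast hch
  calc _ ≤ ∑ B ∈ Finset.powersetCard (k + 1) (Finset.univ : Finset ι), (d : ℝ) := by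
        refine Finset.sum_le_sum fun B _ => ?_
        rw [Finset.sum_boole]
        exact_mod_cast hcard B
    _ = _ := by
        rw [Finset.sum_const, Finset.card_powersetCard, Finset.card_univ, ← hch']
        simp only [nsmul_eq_mul]
        field_simp

/-- Unit charge counts the updates; the step bounds `d / (k + 1)` form a harmonic sum. -/
theorem scanCost_one_le {d : ℕ}
    (hcard : ∀ B : Finset ι, (B.filter fun z => z ∈ I (B.erase z)).card ≤ d)
    (hd : ∀ A, Disjoint (I A) A) :
    scanCost I (fun _ => 1) (Fintype.card ι) ∅ ≤ d * (1 + Real.log (Fintype.card ι)) := by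
  refine (scanCost_empty_le (b := fun k => d / (k + 1)) fun k _ => ?_).trans ?_
  · simpa using sum_card_improving_le hcard hd
  · have h := harmonic_le_one_add_log (Fintype.card ι)
    rw [harmonic] at h
    push_cast at h
    calc _ = d * ∑ k ∈ Finset.range (Fintype.card ι), ((k : ℝ) + 1)⁻¹ := by
          rw [Finset.mul_sum]; rfl
      _ ≤ _ := by gcongr

theorem sum_inv_sqrt_le (n : ℕ) :
    ∑ j ∈ Finset.range n, 1 / Real.sqrt (j + 1) ≤ 2 * Real.sqrt n := by
  induction n with
  | zero => simp
  | succ n ih =>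
    rw [Finset.sum_range_succ]
    have h1 : 0 < Real.sqrt (n + 1) := Real.sqrt_pos.2 (by positivity)
    have h2 := Real.sqrt_nonneg (n : ℝ)
    have h3 : Real.sqrt (n + 1) ^ 2 = n + 1 := Real.sq_sqrt (by positivity)
    have h4 : Real.sqrt n ^ 2 = n := Real.sq_sqrt (by positivity)
    have h5 : Real.sqrt n ≤ Real.sqrt (n + 1) := Real.sqrt_le_sqrt (by linarith)
    have h6 : 1 / Real.sqrt (n + 1) ≤ 2 * (Real.sqrt (n + 1) - Real.sqrt n) := by
      rw [div_le_iff₀ h1]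
      nlinarith
    push_cast
    linarith

/-- The charge `s * √(N / s) = √(N s)` is concave in `s`, so it may be evaluated at the bound for
the mean of `s`. Step `k` then costs `√(N d) / √((k + 1) (N - k))`, which is split into two summable
terms, each contributing at most `2 √(N d)`. -/
theorem scanCost_sqrt_le {d : ℕ} (hd1 : 1 ≤ d)
    (hcard : ∀ B : Finset ι, (B.filter fun z => z ∈ I (B.erase z)).card ≤ d)
    (hd : ∀ A, Disjoint (I A) A) :
    scanCost I (fun s => Real.sqrt (Fintype.card ι / s)) (Fintype.card ι) ∅ ≤
      4 * Real.sqrt (Fintype.card ι * d) := by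
  set N := Fintype.card ι with hN
  have hd0 : (0 : ℝ) < d := by exact_mod_cast hd1
  refine (scanCost_empty_le (b := fun k => Real.sqrt (N * d) *
    (1 / Real.sqrt (k + 1) + 1 / Real.sqrt (N - k : ℕ)) / Real.sqrt N) fun k hk => ?_).trans ?_
  · rw [← hN] at hk ⊢
    have hN0 : (0 : ℝ) < N := by exact_mod_cast (by omega : 0 < N)
    obtain ⟨m, hm⟩ : ∃ m, m = N - k := ⟨_, rfl⟩
    have hm0 : (0 : ℝ) < m := by exact_mod_cast (by omega : 0 < m)
    have hNm : (N : ℝ) = m + k := by exact_mod_cast (by omega : N = m + k)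
    have h := sum_card_improving_le (k := k) hcard hd
    rw [← hN, ← hm] at h
    rw [← hm]
    -- `x ^ 2` bounds the average of `(I A).card`; the concavity is used in the form `2 √s ≤ s / x +
    -- x`.
    set x := Real.sqrt (d * m / (k + 1)) with hx
    have hx0 : 0 < x := Real.sqrt_pos.2 (by positivity)
    have hx2 : x ^ 2 = d * m / (k + 1) := Real.sq_sqrt (by positivity)
    have h1 : ∀ s : ℕ, (s : ℝ) * Real.sqrt (N / s) ≤ Real.sqrt N * ((s / x + x) / 2) := by
      intro s
      rcases Nat.eq_zero_or_pos s with rfl | hs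
      · simp; positivity
      have hs : (0 : ℝ) < s := by exact_mod_cast hs
      have e : (s : ℝ) * Real.sqrt (N / s) = Real.sqrt N * Real.sqrt s := by
        rw [Real.sqrt_div hN0.le]
        have := Real.mul_self_sqrt hs.le
        have h0 := Real.sqrt_pos.2 hs
        field_simp
        nlinarith
      rw [e]
      gcongr
      have h2 : Real.sqrt s ^ 2 = s := Real.sq_sqrt hs.le
      have : (s : ℝ) / x + x - 2 * Real.sqrt s = (Real.sqrt s - x) ^ 2 / x := by
        field_simp
        linear_combination -h2
      have : 0 ≤ (Real.sqrt s - x) ^ 2 / x := by positivity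
      linarith
    refine (Finset.sum_le_sum fun A _ => h1 _).trans ?_
    rw [← Finset.mul_sum, ← Finset.sum_div, Finset.sum_add_distrib, ← Finset.sum_div,
      Finset.sum_const, Finset.card_powersetCard, Finset.card_univ, ← hN]
    have h2 : (∑ A ∈ Finset.powersetCard k (Finset.univ : Finset ι), ((I A).card : ℝ)) / x ≤
        N.choose k * x := by
      rw [div_le_iff₀ hx0]
      refine h.trans (le_of_eq ?_)
      rw [mul_assoc, mul_assoc, ← sq, hx2]
      ring
    have h3 : Real.sqrt N * x ≤ m * (Real.sqrt (N * d) *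
        (1 / Real.sqrt (k + 1) + 1 / Real.sqrt m) / Real.sqrt N) := by
      have hk0 : 0 < Real.sqrt (k + 1) := Real.sqrt_pos.2 (by positivity)
      have hms : 0 < Real.sqrt m := Real.sqrt_pos.2 hm0
      have hNs : 0 < Real.sqrt N := Real.sqrt_pos.2 hN0
      have e1 : x = Real.sqrt d * Real.sqrt m / Real.sqrt (k + 1) := by
        rw [hx, Real.sqrt_div (by positivity), Real.sqrt_mul hd0.le]
      have e2 : (m : ℝ) = Real.sqrt m ^ 2 := (Real.sq_sqrt hm0.le).symm
      -- Turns the product `1 / (√m √(k + 1))` into the sum `(1 / √m + 1 / √(k + 1)) / √N`, because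
      -- `N ≤ m + (k + 1)`.
      have e3 : Real.sqrt N ≤ Real.sqrt m + Real.sqrt (k + 1) := by
        rw [Real.sqrt_le_left (by positivity)]
        have := Real.sq_sqrt (show (0 : ℝ) ≤ k + 1 by positivity)
        nlinarith [mul_pos hms hk0]
      rw [Real.sqrt_mul hN0.le, e1]
      have e4 : (m : ℝ) * (Real.sqrt N * Real.sqrt d * (1 / Real.sqrt (k + 1) + 1 / Real.sqrt m) /
          Real.sqrt N) = Real.sqrt d * Real.sqrt m / Real.sqrt (k + 1) *
            (Real.sqrt m + Real.sqrt (k + 1)) := by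
        nth_rewrite 1 [e2]
        field_simp
      rw [e4, mul_comm]
      gcongr
    rw [nsmul_eq_mul]
    calc _ ≤ Real.sqrt N * ((N.choose k * x + N.choose k * x) / 2) := by gcongr
      _ = N.choose k * (Real.sqrt N * x) := by ring
      _ ≤ _ := by rw [mul_assoc]; gcongr
  · rw [← Finset.sum_div, ← Finset.mul_sum, Finset.sum_add_distrib]
    have h1 := sum_inv_sqrt_le N
    have h2 : ∑ k ∈ Finset.range N, 1 / Real.sqrt (N - k : ℕ) =
        ∑ k ∈ Finset.range N, 1 / Real.sqrt (k + 1) := by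
      rw [← Finset.sum_range_reflect]
      refine Finset.sum_congr rfl fun k hk => ?_
      rw [Finset.mem_range] at hk
      have : N - (N - 1 - k) = k + 1 := by omega
      rw [this]
      push_cast
      rfl
    rw [h2]
    rcases Nat.eq_zero_or_pos N with h0 | h0
    · simp [h0]
    have hNs : 0 < Real.sqrt N := Real.sqrt_pos.2 (by exact_mod_cast h0)
    rw [div_le_iff₀ hNs]
    have := Real.sqrt_nonneg (N * d : ℝ)
    nlinarith

end Potential
-- Memory updates, and evaluation without overflow
section StoreLemmas

variable {α : Type u} (s : Store α) (r r' a a' i i' n : ℕ) (v : WithTop α)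

@[simp] theorem setReg_reg : (s.setReg r n).reg r' = if r' = r then n else s.reg r' :=
  Function.update_apply ..
@[simp] theorem setReg_arr : (s.setReg r n).arr = s.arr := rfl
@[simp] theorem setReg_varr : (s.setReg r n).varr = s.varr := rfl
@[simp] theorem setArr_reg : (s.setArr a i n).reg = s.reg := rfl
@[simp] theorem setArr_varr : (s.setArr a i n).varr = s.varr := rfl
@[simp] theorem setArr_arr : (s.setArr a i n).arr a' i' =
    if a' = a ∧ i' = i then n else s.arr a' i' := by
  simp only [Store.setArr, Function.update_apply]
  by_cases h : a' = a <;> by_cases h' : i' = i <;> simp [h, h']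
@[simp] theorem setVArr_reg : (s.setVArr a i v).reg = s.reg := rfl
@[simp] theorem setVArr_arr : (s.setVArr a i v).arr = s.arr := rfl
@[simp] theorem setVArr_varr : (s.setVArr a i v).varr a' i' =
    if a' = a ∧ i' = i then v else s.varr a' i' := by
  simp only [Store.setVArr, Function.update_apply]
  by_cases h : a' = a <;> by_cases h' : i' = i <;> simp [h, h']

theorem setReg_self : s.setReg r (s.reg r) = s := by
  simp [Store.setReg]

end StoreLemmas

section EvalLemmas

variable {α : Type u} [LinearOrder α] {M : Machine α} {s : Store α} {e₁ e₂ : WExpr} {a b : ℕ}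

theorem eval_const (h : a < 2 ^ M.w) : (WExpr.const a).eval M s = a := Nat.mod_eq_of_lt h

theorem eval_add (h₁ : e₁.eval M s = a) (h₂ : e₂.eval M s = b) (h : a + b < 2 ^ M.w) :
    (WExpr.op .add e₁ e₂).eval M s = a + b := by
  simp only [WExpr.eval, WOp.apply, h₁, h₂, Nat.mod_eq_of_lt h]

theorem eval_mul (h₁ : e₁.eval M s = a) (h₂ : e₂.eval M s = b) (h : a * b < 2 ^ M.w) :
    (WExpr.op .mul e₁ e₂).eval M s = a * b := by
  simp only [WExpr.eval, WOp.apply, h₁, h₂, Nat.mod_eq_of_lt h]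

theorem eval_sub (h₁ : e₁.eval M s = a) (h₂ : e₂.eval M s = b) (h : a - b < 2 ^ M.w) :
    (WExpr.op .sub e₁ e₂).eval M s = a - b := by
  simp only [WExpr.eval, WOp.apply, h₁, h₂, Nat.mod_eq_of_lt h]

theorem eval_div (h₁ : e₁.eval M s = a) (h₂ : e₂.eval M s = b) (h : a < 2 ^ M.w) :
    (WExpr.op .div e₁ e₂).eval M s = a / b := by
  simp only [WExpr.eval, WOp.apply, h₁, h₂, Nat.mod_eq_of_lt ((Nat.div_le_self a b).trans_lt h)]

theorem eval_mod (h₁ : e₁.eval M s = a) (h₂ : e₂.eval M s = b) (h : a < 2 ^ M.w) :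
    (WExpr.op .mod e₁ e₂).eval M s = a % b := by
  simp only [WExpr.eval, WOp.apply, h₁, h₂, Nat.mod_eq_of_lt ((Nat.mod_le a b).trans_lt h)]

theorem Exec.wset_of {q : QState} {r : ℕ} (h : e₁.eval M s = a) :
    Exec M (.wset r e₁) s q (s.setReg r a) q (e₁.cost M + 1) := h ▸ Exec.wset M s q r e₁

theorem Exec.wstore_of {q : QState} {n : ℕ} (h₁ : e₁.eval M s = a) (h₂ : e₂.eval M s = b) :
    Exec M (.wstore n e₁ e₂) s q (s.setArr n a b) q (e₁.cost M + e₂.cost M + 1) :=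
  h₁ ▸ h₂ ▸ Exec.wstore M s q n e₁ e₂

theorem Exec.vstore_of {q : QState} {n : ℕ} {v : VExpr} {x : WithTop α} (h₁ : e₁.eval M s = a)
    (h₂ : v.eval M s = x) :
    Exec M (.vstore n e₁ v) s q (s.setVArr n a x) q (e₁.cost M + v.cost M + 1) :=
  h₁ ▸ h₂ ▸ Exec.vstore M s q n e₁ v

end EvalLemmas

/-! ### The program: data structure -/

/-- The node of the tournament tree against which `e` has to compete. -/
def rival (e : WExpr) : WExpr := .load 1 (.call e)

/-- The element `e` is improving. -/
def improves (e : WExpr) : BExpr :=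
  .or (.vlt (.call e) (.load 0 (rival e)))
    (.and (.not (.vlt (.load 0 (rival e)) (.call e)))
      (.wlt (.op .add e (.const 1)) (.load 2 (rival e))))

/-- The content of node `e₁` of the tree is smaller than that of node `e₂`. -/
def nodeLt (e₁ e₂ : WExpr) : BExpr :=
  .or (.vlt (.load 0 e₁) (.load 0 e₂))
    (.and (.not (.vlt (.load 0 e₂) (.load 0 e₁))) (.wlt (.load 2 e₁) (.load 2 e₂)))

/-- Registers `0` to `4` hold `N`, the number of leaves, `E`, the number of occupied leaves and `b`.
Register `5` holds the found element plus one, or `0` if nothing has been found, so rewriting it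
with its own content is harmless. Word array `0` is the output, `1` maps a type to its leaf (`0` if
it has none), `2` and value array `0` hold the nodes of the tree. -/
def nop : Cmd := .wset 5 (.reg 5)

/-- Recompute node `reg 19` from its children and move to its parent. -/
def fixNode : Cmd :=
  .seq (.cond (nodeLt (.op .mul (.const 2) (.reg 19)) (.op .add (.op .mul (.const 2) (.reg 19)) (.const 1)))
      (.wset 20 (.op .add (.op .mul (.const 2) (.reg 19)) (.const 1)))
      (.wset 20 (.op .mul (.const 2) (.reg 19)))) <|
  .seq (.wstore 2 (.reg 19) (.load 2 (.reg 20))) <|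
  .seq (.vstore 0 (.reg 19) (.load 0 (.reg 20))) <|
  .wset 19 (.op .div (.reg 19) (.const 2))

def fixPath : Cmd := .loop (.wlt (.const 0) (.reg 19)) fixNode

/-- Node `0` is a copy of the root. Since the table of types has default `0`, an element of a type
that is not represented is thereby compared with the costliest entry, without a case distinction. -/
def fixTop : Cmd :=
  .seq (.wstore 2 (.const 0) (.load 2 (.const 1))) (.vstore 0 (.const 0) (.load 0 (.const 1)))

/-- Choose the leaf into which the element `reg 7`, of type `reg 18`, is written. -/
def chooseLeaf : Cmd :=
  .cond (.weq (.reg 19) (.const 0))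
    (.cond (.wlt (.reg 3) (.reg 1))
      (.seq (.wset 19 (.op .add (.reg 1) (.reg 3))) (.wset 3 (.op .add (.reg 3) (.const 1))))
      (.seq (.wset 20 (.call (.op .sub (.load 2 (.const 0)) (.const 1))))
        (.seq (.wset 19 (.load 1 (.reg 20))) (.wstore 1 (.reg 20) (.const 0)))))
    nop

def writeLeaf : Cmd :=
  .seq (.wstore 1 (.reg 18) (.reg 19)) <|
  .seq (.wstore 2 (.reg 19) (.reg 5)) <|
  .seq (.vstore 0 (.reg 19) (.call (.reg 7))) <|
  .seq (.wstore 0 (.op .sub (.reg 19) (.reg 1)) (.reg 5)) <|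
  .wset 19 (.op .div (.reg 19) (.const 2))

/-- Insert the element `reg 5 - 1` into the current choice. -/
def update : Cmd :=
  .seq (.wset 7 (.op .sub (.reg 5) (.const 1))) <|
  .seq (.wset 18 (.call (.reg 7))) <|
  .seq (.wset 19 (.load 1 (.reg 18))) <|
  .seq chooseLeaf <| .seq writeLeaf <| .seq fixPath fixTop

/-! ### The represented choice and the test for improving elements -/

section Rep

variable {α : Type u} [LinearOrder α] {M : Machine α}

/-- How an entry is stored in a word. -/
def code {N : ℕ} (x : Option (Fin N)) : ℕ := x.elim 0 fun y => (y : ℕ) + 1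

/-- Price with ties broken by the index. -/
def key (M : Machine α) (y : Fin M.N) : α ×ₗ Fin M.N := toLex (M.F y, y)

theorem key_injective (M : Machine α) : Function.Injective (key M) := fun x y h => by
  have := congrArg (fun p => (ofLex p).2) h
  exact this

/-- The key of an entry, `⊤` for an infinity. -/
def keyTop (M : Machine α) : Option (Fin M.N) → WithTop (α ×ₗ Fin M.N)
  | none => ⊤
  | some y => (key M y : WithTop (α ×ₗ Fin M.N))

theorem keyTop_injective (M : Machine α) : Function.Injective (keyTop M) := by
  intro x y h
  rcases x with _ | x <;> rcases y with _ | y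
  · rfl
  · simp [keyTop] at h
  · simp [keyTop] at h
  · simp only [keyTop, WithTop.coe_inj] at h
    rw [key_injective M h]

/-- The right-hand side is the comparison made by the machine. Only infinities have price `⊤`, so a
tie never pits an infinity against an element. -/
theorem keyTop_lt_iff (x y : Option (Fin M.N)) : keyTop M x < keyTop M y ↔
    price M.F x < price M.F y ∨ ¬ price M.F y < price M.F x ∧ code x < code y := by
  rcases x with _ | x <;> rcases y with _ | y
  · simp [keyTop, price, code]
  · simp [keyTop, price, code]
  · simp [keyTop, price, code]
  · simp only [keyTop, price, code, WithTop.coe_lt_coe, key, Prod.Lex.toLex_lt_toLex, not_lt,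
      Option.elim]
    rw [Fin.lt_def]
    constructor
    · rintro (h | ⟨h, h'⟩)
      · exact Or.inl h
      · exact Or.inr ⟨h.le, by omega⟩
    · rintro (h | ⟨h, h'⟩)
      · exact Or.inl h
      · rcases h.lt_or_eq with h | h
        · exact Or.inl h
        · exact Or.inr ⟨h, by omega⟩

theorem price_le_of_keyTop_le {x y : Option (Fin M.N)} (h : keyTop M x ≤ keyTop M y) :
    price M.F x ≤ price M.F y := by
  by_contra hc
  exact absurd ((keyTop_lt_iff y x).2 (Or.inl (not_le.1 hc))) (not_lt.2 h)

/-- The improving elements for the current choice `X`. -/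
abbrev imp (M : Machine α) (d : ℕ) (X : Finset (Fin M.N)) : Finset (Fin M.N) :=
  improving (key M) M.G d X

/-- The leaves `nd (d + j)` of the tree hold the set `X`, whose elements have distinct types, and
registers, output cells and the table of types fit to it. -/
structure LeafRep (M : Machine α) (d E b : ℕ) (s : Store α) (X : Finset (Fin M.N))
    (nd : ℕ → Option (Fin M.N)) : Prop where
  reg0 : s.reg 0 = M.N
  reg1 : s.reg 1 = d
  reg2 : s.reg 2 = E
  reg3 : s.reg 3 = X.card
  reg4 : s.reg 4 = b
  out : ∀ j < d, s.arr 0 j = code (nd (d + j))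
  out_ge : ∀ j, d ≤ j → s.arr 0 j = 0
  free : ∀ j, X.card ≤ j → j < d → nd (d + j) = none
  used : ∀ j < X.card, nd (d + j) ≠ none
  mem : ∀ j < d, ∀ y, nd (d + j) = some y → y ∈ X
  exists_leaf : ∀ y ∈ X, ∃ j < d, nd (d + j) = some y
  card_le : X.card ≤ d
  pos : ∀ j < d, ∀ y, nd (d + j) = some y → s.arr 1 (M.G y) = d + j
  absent : ∀ γ, (∀ y ∈ X, M.G y ≠ γ) → s.arr 1 γ = 0

/-- The nodes of the tree are stored. -/
def NodeRep (M : Machine α) (d : ℕ) (s : Store α) (nd : ℕ → Option (Fin M.N)) : Prop :=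
  ∀ v < 2 * d, s.arr 2 v = code (nd v) ∧ s.varr 0 v = price M.F (nd v)

/-- Every inner node of the tree, except possibly `p`, is the maximum of its children. -/
def TreeExcept (M : Machine α) (d : ℕ) (nd : ℕ → Option (Fin M.N)) (p : ℕ) : Prop :=
  ∀ v, 1 ≤ v → v < d → v ≠ p → keyTop M (nd v) = max (keyTop M (nd (2 * v))) (keyTop M (nd (2 * v + 1)))

/-- The memory represents the current choice `X`. -/
def Rep (M : Machine α) (d E b : ℕ) (s : Store α) (X : Finset (Fin M.N)) : Prop :=
  ∃ nd, LeafRep M d E b s X nd ∧ NodeRep M d s nd ∧ TreeExcept M d nd 0 ∧ nd 0 = nd 1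

/-- `s'` differs from `s` in scratch registers only. -/
def Agree (s s' : Store α) : Prop :=
  s'.arr = s.arr ∧ s'.varr = s.varr ∧ ∀ r < 5, s'.reg r = s.reg r

theorem Agree.refl (s : Store α) : Agree s s := ⟨rfl, rfl, fun _ _ => rfl⟩

theorem Agree.trans {s s' s'' : Store α} (h : Agree s s') (h' : Agree s' s'') : Agree s s'' :=
  ⟨h'.1.trans h.1, h'.2.1.trans h.2.1, fun r hr => (h'.2.2 r hr).trans (h.2.2 r hr)⟩

theorem Agree.setReg {s s' : Store α} (h : Agree s s') {r n : ℕ} (hr : 5 ≤ r) :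
    Agree s (s'.setReg r n) :=
  ⟨h.1, h.2.1, fun r' hr' => by rw [setReg_reg, if_neg (by omega)]; exact h.2.2 r' hr'⟩

variable {d E b : ℕ} {s s' : Store α} {X : Finset (Fin M.N)} {nd : ℕ → Option (Fin M.N)}

theorem LeafRep.congr (h : LeafRep M d E b s X nd) (hr : ∀ r < 5, s'.reg r = s.reg r)
    (h0 : s'.arr 0 = s.arr 0) (h1 : s'.arr 1 = s.arr 1) : LeafRep M d E b s' X nd := by
  obtain ⟨a0, a1, a2, a3, a4, a5, a6, a7, a8, a9, a10, a11, a12, a13⟩ := h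
  refine ⟨?_, ?_, ?_, ?_, ?_, ?_, ?_, a7, a8, a9, a10, a11, ?_, ?_⟩
  any_goals rw [hr _ (by norm_num)]; assumption
  · rwa [h0]
  · rwa [h0]
  · rwa [h1]
  · rwa [h1]

theorem Rep.congr (h : Rep M d E b s X) (hs : Agree s s') : Rep M d E b s' X := by
  obtain ⟨nd, h1, h2, h3, h4⟩ := h
  refine ⟨nd, h1.congr hs.2.2 (by rw [hs.1]) (by rw [hs.1]), ?_, h3, h4⟩
  intro v hv
  rw [hs.1, hs.2.1]
  exact h2 v hv

theorem TreeExcept.le_root (h : TreeExcept M d nd 0) (v : ℕ) (h1 : 1 ≤ v) (h2 : v < 2 * d) :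
    keyTop M (nd v) ≤ keyTop M (nd 1) := by
  induction v using Nat.strong_induction_on with
  | _ v ih =>
    rcases Nat.lt_or_ge v 2 with h3 | h3
    · have : v = 1 := by omega
      rw [this]
    · refine le_trans ?_ (ih (v / 2) (by omega) (by omega) (by omega))
      rw [h (v / 2) (by omega) (by omega) (by omega)]
      rcases Nat.even_or_odd' v with ⟨w, rfl | rfl⟩
      · rw [Nat.mul_div_cancel_left _ (by norm_num)]; exact le_max_left _ _
      · have : (2 * w + 1) / 2 = w := by omega
        rw [this]; exact le_max_right _ _

/-- Descend from the root to a child that attains the maximum. The nodes are numbered like a heap,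
with leaves `d, …, 2 d - 1`, so `d` need not be a power of two. -/
theorem TreeExcept.exists_leaf (h : TreeExcept M d nd 0) (hd : 1 ≤ d) :
    ∃ j < d, nd 1 = nd (d + j) := by
  have key : ∀ n v, 1 ≤ v → v < 2 * d → 2 * d - v ≤ n → ∃ j < d, nd v = nd (d + j) := by
    intro n
    induction n with
    | zero => intro v _ h2 h3; omega
    | succ n ih =>
      intro v h1 h2 h3
      rcases Nat.lt_or_ge v d with h4 | h4
      · have h5 := h v h1 h4 (by omega)
        rcases max_choice (keyTop M (nd (2 * v))) (keyTop M (nd (2 * v + 1))) with h6 | h6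
        · rw [h6] at h5
          obtain ⟨j, hj, hj'⟩ := ih (2 * v) (by omega) (by omega) (by omega)
          exact ⟨j, hj, (keyTop_injective M h5).trans hj'⟩
        · rw [h6] at h5
          obtain ⟨j, hj, hj'⟩ := ih (2 * v + 1) (by omega) (by omega) (by omega)
          exact ⟨j, hj, (keyTop_injective M h5).trans hj'⟩
      · exact ⟨v - d, by omega, by rw [show d + (v - d) = v by omega]⟩
  exact key (2 * d) 1 le_rfl (by omega) (by omega)

theorem LeafRep.inj (h : LeafRep M d E b s X nd) {x y : Fin M.N} (hx : x ∈ X) (hy : y ∈ X)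
    (hG : M.G x = M.G y) : x = y := by
  obtain ⟨i, hi, hi'⟩ := h.exists_leaf x hx
  obtain ⟨j, hj, hj'⟩ := h.exists_leaf y hy
  have h1 := h.pos i hi x hi'
  have h2 := h.pos j hj y hj'
  rw [hG, h2] at h1
  rw [h1, hi'] at hj'
  exact Option.some_injective _ hj'

/-- The bound on the number of cheap types is automatic: if `y` is cheaper than `x`, then `x` itself
is not counted among the at most `d` elements of `X`. -/
theorem LeafRep.mem_imp_of_mem (h : LeafRep M d E b s X nd) {x y : Fin M.N} (hx : x ∈ X)
    (hG : M.G x = M.G y) : y ∈ imp M d X ↔ key M y < key M x := by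
  rw [mem_improving]
  constructor
  · rintro ⟨h1, h2, -⟩
    by_contra hc
    rcases (not_lt.1 hc).lt_or_eq with h3 | h3
    · exact h2 (Finset.mem_image.2 ⟨x, Finset.mem_filter.2 ⟨hx, h3⟩, hG⟩)
    · exact h1 (key_injective M h3 ▸ hx)
  · intro hlt
    refine ⟨fun hy => ?_, fun hc => ?_, ?_⟩
    · rw [h.inj hx hy hG] at hlt; exact lt_irrefl _ hlt
    · obtain ⟨z, hz, hz'⟩ := Finset.mem_image.1 hc
      rw [Finset.mem_filter] at hz
      rw [h.inj hz.1 hx (hz'.trans hG.symm)] at hz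
      exact lt_asymm hlt hz.2
    · refine (Finset.card_image_le).trans_lt (lt_of_lt_of_le ?_ h.card_le)
      refine Finset.card_lt_card ⟨Finset.filter_subset _ _, fun hsub => ?_⟩
      exact lt_asymm hlt (Finset.mem_filter.1 (hsub hx)).2

/-- If a leaf is free the root is `⊤` and a new type is always welcome. If all `d` leaves are taken,
fewer than `d` entries are cheaper exactly when the costliest one, at the root, is not. -/
theorem LeafRep.mem_imp_of_forall (h : LeafRep M d E b s X nd) (ht : TreeExcept M d nd 0)
    (hd : 1 ≤ d) {y : Fin M.N} (hG : ∀ x ∈ X, M.G x ≠ M.G y) :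
    y ∈ imp M d X ↔ keyTop M (some y) < keyTop M (nd 1) := by
  have hyX : y ∉ X := fun hy => hG y hy rfl
  have habs : M.G y ∉ cheapTypes (key M) M.G X y := fun hc => by
    obtain ⟨z, hz, hz'⟩ := Finset.mem_image.1 hc
    exact hG z (Finset.mem_filter.1 hz).1 hz'
  have hcard : (cheapTypes (key M) M.G X y).card = (X.filter fun x => key M x < key M y).card := by
    refine Finset.card_image_of_injOn fun x hx x' hx' hxx => ?_
    exact h.inj (Finset.mem_filter.1 (Finset.mem_coe.1 hx)).1
      (Finset.mem_filter.1 (Finset.mem_coe.1 hx')).1 hxx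
  rw [mem_improving, hcard]
  constructor
  · rintro ⟨-, -, h3⟩
    rcases h.card_le.lt_or_eq with h4 | h4
    · have h5 := ht.le_root (d + X.card) (by omega) (by omega)
      rw [h.free _ le_rfl h4] at h5
      exact lt_of_lt_of_le (WithTop.coe_lt_top _) h5
    · by_contra hc
      have : X.filter (fun x => key M x < key M y) = X := by
        refine Finset.filter_true_of_mem fun x hx => ?_
        obtain ⟨j, hj, hj'⟩ := h.exists_leaf x hx
        have h5 := ht.le_root (d + j) (by omega) (by omega)
        have h6 := h5.trans (not_lt.1 hc)
        rw [hj'] at h6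
        refine lt_of_le_of_ne (WithTop.coe_le_coe.1 h6) fun he => hyX ?_
        rw [← key_injective M he]
        exact hx
      rw [this] at h3
      omega
  · intro hlt
    refine ⟨hyX, habs, ?_⟩
    rcases h.card_le.lt_or_eq with h4 | h4
    · exact (Finset.card_filter_le _ _).trans_lt h4
    · obtain ⟨j, hj, hj'⟩ := ht.exists_leaf hd
      rw [hj'] at hlt
      obtain ⟨x, hx⟩ := Option.ne_none_iff_exists'.1 (h.used j (by omega))
      rw [hx] at hlt
      refine lt_of_lt_of_le (Finset.card_lt_card ⟨Finset.filter_subset _ _, fun hsub => ?_⟩) h.card_le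
      exact lt_asymm (WithTop.coe_lt_coe.1 hlt) (Finset.mem_filter.1 (hsub (h.mem j hj x hx))).2

theorem LeafRep.arr_lt (h : LeafRep M d E b s X nd) (hd : 1 ≤ d) (γ : ℕ) : s.arr 1 γ < 2 * d := by
  by_cases hc : ∃ y ∈ X, M.G y = γ
  · obtain ⟨y, hy, rfl⟩ := hc
    obtain ⟨j, hj, hj'⟩ := h.exists_leaf y hy
    rw [h.pos j hj y hj']
    omega
  · push Not at hc
    rw [h.absent γ hc]
    omega

/-- The table lookup selects the leaf of the same type or, by default, node `0`; these are the cases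
of the two preceding membership criteria. Hence the Grover predicate costs only `O(tF + tG)`. -/
theorem improves_holds (h : Rep M d E b s X) (hd : 1 ≤ d) (hw : M.N < 2 ^ M.w) {e : WExpr} {y : ℕ}
    (he : e.eval M s = y) (hy : y < M.N) : (improves e).Holds M s ↔ Mem (imp M d X) y := by
  obtain ⟨nd, h1, h2, h3, h4⟩ := h
  have hF : M.callF y = price M.F (some ⟨y, hy⟩) := by simp [Machine.callF, hy, price]
  have hG : M.callG y = M.G ⟨y, hy⟩ := by simp [Machine.callG, hy]
  have hc : (WExpr.op .add e (.const 1)).eval M s = code (some (⟨y, hy⟩ : Fin M.N)) :=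
    eval_add he (eval_const (by omega)) (by omega)
  have hr : (rival e).eval M s = s.arr 1 (M.G ⟨y, hy⟩) := by simp [rival, WExpr.eval, he, hG]
  have hlt := h1.arr_lt hd (M.G ⟨y, hy⟩)
  have hm : Mem (imp M d X) y ↔ (⟨y, hy⟩ : Fin M.N) ∈ imp M d X := mem_val (⟨y, hy⟩ : Fin M.N)
  have key1 : (improves e).Holds M s ↔
      keyTop M (some ⟨y, hy⟩) < keyTop M (nd (s.arr 1 (M.G ⟨y, hy⟩))) := by
    rw [keyTop_lt_iff, ← hc, ← hF, ← (h2 _ hlt).1, ← (h2 _ hlt).2]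
    simp only [improves, BExpr.Holds, VExpr.eval, hr, he]
    rw [WExpr.eval, hr]
  rw [key1, hm]
  by_cases hx : ∃ x ∈ X, M.G x = M.G ⟨y, hy⟩
  · obtain ⟨x, hx, hxG⟩ := hx
    obtain ⟨j, hj, hj'⟩ := h1.exists_leaf x hx
    rw [h1.mem_imp_of_mem hx hxG, ← hxG, h1.pos j hj x hj', hj']
    exact WithTop.coe_lt_coe
  · push Not at hx
    rw [h1.mem_imp_of_forall h3 hd hx, h1.absent _ hx, h4]

end Rep

/-! ### Local optimality implies minimality -/

section MinDiff

variable {α : Type u} [LinearOrder α] {N d : ℕ} {F : Fin N → α} {G : Fin N → ℕ}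

/-- Match each entry of `x'` with the entry of `x` of the same type, if there is one; this is
injective and extends to a permutation. A matched entry is not cheaper because no exchange within
its type helps. An unmatched element has a type missing from `x`, so it is not cheaper than any
entry. -/
theorem isMinDiff_of_no_exchange {x : Fin d → Option (Fin N)} (h1 : DistinctTypes G x)
    (h2 : ¬ ∃ y i, (F y : WithTop α) < price F (x i) ∧ ∃ z, x i = some z ∧ G y = G z)
    (h3 : ¬ ∃ y i, (F y : WithTop α) < price F (x i) ∧ ∀ j z, x j = some z → G y ≠ G z) :
    IsMinDiff F G x := by
  classical
  refine ⟨h1, fun x' hx' => ?_, h2, h3⟩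
  let s : Finset (Fin d) := Finset.univ.filter fun i =>
    ∃ y j z, x' i = some y ∧ x j = some z ∧ G y = G z
  have hs : ∀ i ∈ s, ∃ j y z, x' i = some y ∧ x j = some z ∧ G y = G z := by
    intro i hi
    obtain ⟨y, j, z, h⟩ := (Finset.mem_filter.1 hi).2
    exact ⟨j, y, z, h⟩
  choose! f hf using hs
  have hinj : Set.InjOn f s := by
    intro i hi i' hi' hff
    obtain ⟨y, z, ha, hb, hc⟩ := hf i hi
    obtain ⟨y', z', ha', hb', hc'⟩ := hf i' hi'
    rw [hff, hb'] at hb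
    have hzz : z' = z := Option.some_injective _ hb
    by_contra hne
    exact hx' i i' y y' ha ha' hne (by rw [hc, hc', hzz])
  obtain ⟨g, hg⟩ := Finset.exists_equiv_extend_of_card_eq (α := Fin d) (t := Finset.univ)
    (by simp) (Finset.subset_univ (s.image f)) hinj
  let τ : Equiv.Perm (Fin d) := g.trans (Equiv.subtypeUnivEquiv fun _ => Finset.mem_univ _)
  have hτ : ∀ i ∈ s, τ i = f i := hg
  have key : ∀ i, price F (x (τ i)) ≤ price F (x' i) := by
    intro i
    by_cases hi : i ∈ s
    · obtain ⟨y, z, ha, hb, hc⟩ := hf i hi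
      rw [hτ i hi, ha]
      by_contra hlt
      exact h2 ⟨y, f i, not_le.1 hlt, z, hb, hc⟩
    · rcases hx : x' i with _ | y
      · exact le_top
      · by_contra hlt
        refine h3 ⟨y, τ i, not_le.1 hlt, fun j z hj hG => hi ?_⟩
        exact Finset.mem_filter.2 ⟨Finset.mem_univ _, y, j, z, hx, hj, hG⟩
  refine ⟨τ.symm, fun i => ?_⟩
  have := key (τ.symm i)
  rwa [Equiv.apply_symm_apply] at this

/-- Only `d' = min d N` leaves are used; the remaining entries are infinities, and their output
cells still contain the initial `0`. -/
theorem exists_isMinDiff {M : Machine α} {d' E b : ℕ} {s : Store α} {X : Finset (Fin M.N)}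
    (h : Rep M d' E b s X) (hd : 1 ≤ d') (hdd : d' = min d M.N) (hX : imp M d' X = ∅) :
    ∃ x : Fin d → Option (Fin M.N), Outputs x s ∧ IsMinDiff M.F M.G x := by
  obtain ⟨nd, h1, h2, h3, h4⟩ := h
  have himp : ∀ y, y ∉ imp M d' X := by simp [hX]
  let x : Fin d → Option (Fin M.N) := fun i => if (i : ℕ) < d' then nd (d' + i) else none
  have hx : ∀ i z, x i = some z → (i : ℕ) < d' ∧ nd (d' + i) = some z := by
    intro i z hi
    simp only [x] at hi
    split_ifs at hi with hlt
    exact ⟨hlt, hi⟩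
  refine ⟨x, ?_, isMinDiff_of_no_exchange ?_ ?_ ?_⟩
  · intro i
    simp only [x]
    split_ifs with hi
    · exact h1.out i hi
    · exact h1.out_ge i (not_lt.1 hi)
  · intro i j y z hy hz hij hG
    obtain ⟨hi, hy⟩ := hx i y hy
    obtain ⟨hj, hz⟩ := hx j z hz
    have e1 := h1.pos i hi y hy
    have e2 := h1.pos j hj z hz
    rw [hG, e2] at e1
    exact hij (Fin.ext (by omega))
  · rintro ⟨y, i, hlt, z, hz, hG⟩
    obtain ⟨hi, hz'⟩ := hx i z hz
    refine himp y ((h1.mem_imp_of_mem (h1.mem i hi z hz') hG.symm).2 ?_)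
    rw [hz] at hlt
    exact Prod.Lex.toLex_lt_toLex.2 (Or.inl (WithTop.coe_lt_coe.1 hlt))
  · rintro ⟨y, i, hlt, hG⟩
    have hG' : ∀ z ∈ X, M.G z ≠ M.G y := by
      intro z hz he
      obtain ⟨j, hj, hj'⟩ := h1.exists_leaf z hz
      have hjd : j < d := lt_of_lt_of_le hj (hdd ▸ min_le_left _ _)
      exact hG ⟨j, hjd⟩ z (by simp [x, hj, hj']) he.symm
    have hroot : keyTop M (nd 1) ≤ keyTop M (some y) :=
      not_lt.1 fun hc => himp y ((h1.mem_imp_of_forall h3 hd hG').2 hc)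
    by_cases hi : (i : ℕ) < d'
    · have h5 := (h3.le_root (d' + i) (by omega) (by omega)).trans hroot
      have h6 := price_le_of_keyTop_le h5
      have h7 : x i = nd (d' + i) := by simp [x, hi]
      rw [h7] at hlt
      exact absurd h6 (not_le.2 hlt)
    -- Here `d' = N`. Since the root is at most `y`, no leaf is free, so all `N` elements are in `X`
    -- and `y` has no new type.
    · have hid := i.2
      have hN : d' = M.N := by omega
      have hcard : X.card = d' := by
        refine h1.card_le.antisymm (not_lt.1 fun hc => ?_)
        have h5 := (h3.le_root (d' + X.card) (by omega) (by omega)).trans hroot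
        rw [h1.free _ le_rfl hc] at h5
        exact absurd h5 (not_le.2 (WithTop.coe_lt_top _))
      have huniv : X = Finset.univ := Finset.eq_univ_of_card _ (by simp [hcard, hN])
      exact hG' y (huniv ▸ Finset.mem_univ y) rfl

end MinDiff

/-! ### Updating the tournament tree -/

section Update

variable {α : Type u} [LinearOrder α] {M : Machine α} {d E b : ℕ} {s : Store α} {q : QState}
  {X : Finset (Fin M.N)} {nd : ℕ → Option (Fin M.N)}

theorem nodeLt_holds (h : NodeRep M d s nd) {e₁ e₂ : WExpr} {v₁ v₂ : ℕ} (h₁ : e₁.eval M s = v₁)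
    (h₂ : e₂.eval M s = v₂) (hv₁ : v₁ < 2 * d) (hv₂ : v₂ < 2 * d) :
    (nodeLt e₁ e₂).Holds M s ↔ keyTop M (nd v₁) < keyTop M (nd v₂) := by
  rw [keyTop_lt_iff, ← (h _ hv₁).1, ← (h _ hv₁).2, ← (h _ hv₂).1, ← (h _ hv₂).2]
  simp only [nodeLt, BExpr.Holds, VExpr.eval, WExpr.eval, h₁, h₂]

theorem LeafRep.update_node (h : LeafRep M d E b s X nd) {v : ℕ} (hv : v < d)
    (x : Option (Fin M.N)) : LeafRep M d E b s X (Function.update nd v x) := by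
  have e : ∀ j, Function.update nd v x (d + j) = nd (d + j) := fun j =>
    Function.update_of_ne (by omega) _ _
  obtain ⟨a0, a1, a2, a3, a4, a5, a6, a7, a8, a9, a10, a11, a12, a13⟩ := h
  refine ⟨a0, a1, a2, a3, a4, ?_, a6, ?_, ?_, ?_, ?_, a11, ?_, a13⟩ <;> simpa only [e]

/-- Recomputing node `p` can only spoil its parent `p / 2`. Exception `0` means no exception, as the
inner nodes start at `1`. -/
theorem exec_fixNode {p : ℕ} (hp : 1 ≤ p) (hpd : p < d) (hw : 2 * d < 2 ^ M.w)
    (h1 : LeafRep M d E b s X nd) (h2 : NodeRep M d s nd) (h3 : TreeExcept M d nd p)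
    (hr : s.reg 19 = p) :
    ∃ s' nd', Exec M fixNode s q s' q 70 ∧ LeafRep M d E b s' X nd' ∧ NodeRep M d s' nd' ∧
      TreeExcept M d nd' (p / 2) ∧ s'.reg 19 = p / 2 := by
  have hm : ∀ s' : Store α, s'.reg 19 = p →
      (WExpr.op .mul (.const 2) (.reg 19)).eval M s' = 2 * p := fun s' hr =>
    eval_mul (eval_const (by omega)) hr (by omega)
  have hm1 : ∀ s' : Store α, s'.reg 19 = p →
      (WExpr.op .add (.op .mul (.const 2) (.reg 19)) (.const 1)).eval M s' = 2 * p + 1 :=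
    fun s' hr => eval_add (hm s' hr) (eval_const (by omega)) (by omega)
  obtain ⟨ch, hch, hchd, hexec⟩ : ∃ ch, keyTop M (nd ch) =
      max (keyTop M (nd (2 * p))) (keyTop M (nd (2 * p + 1))) ∧ (ch < 2 * d ∧ 2 ≤ ch ∧ ch ≠ p) ∧
      Exec M (.cond (nodeLt (.op .mul (.const 2) (.reg 19))
        (.op .add (.op .mul (.const 2) (.reg 19)) (.const 1)))
        (.wset 20 (.op .add (.op .mul (.const 2) (.reg 19)) (.const 1)))
        (.wset 20 (.op .mul (.const 2) (.reg 19)))) s q (s.setReg 20 ch) q 55 := by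
    have hc := nodeLt_holds h2 (hm s hr) (hm1 s hr) (by omega) (by omega)
    by_cases hlt : keyTop M (nd (2 * p)) < keyTop M (nd (2 * p + 1))
    · refine ⟨2 * p + 1, (max_eq_right hlt.le).symm, by omega, ?_⟩
      have := Exec.cond_pos (hc.2 hlt) (Exec.wset M s q 20
        (.op .add (.op .mul (.const 2) (.reg 19)) (.const 1)))
        (C₂ := (.wset 20 (.op .mul (.const 2) (.reg 19))))
      rw [hm1 s hr] at this
      exact this.mono (by simp [nodeLt, BExpr.cost, VExpr.cost, WExpr.cost])
    · refine ⟨2 * p, (max_eq_left (not_lt.1 hlt)).symm, by omega, ?_⟩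
      have := Exec.cond_neg (fun h => hlt (hc.1 h)) (Exec.wset M s q 20
        (.op .mul (.const 2) (.reg 19)))
        (C₁ := (.wset 20 (.op .add (.op .mul (.const 2) (.reg 19)) (.const 1))))
      rw [hm s hr] at this
      exact this.mono (by simp [nodeLt, BExpr.cost, VExpr.cost, WExpr.cost])
  refine ⟨_, Function.update nd p (nd ch), (hexec.seq ((Exec.wstore M _ q 2 (.reg 19)
    (.load 2 (.reg 20))).seq ((Exec.vstore M _ q 0 (.reg 19) (.load 0 (.reg 20))).seq
    (Exec.wset M _ q 19 (.op .div (.reg 19) (.const 2)))))).mono ?_, ?_, ?_, ?_, ?_⟩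
  · simp [WExpr.cost, VExpr.cost]
  · refine (h1.congr ?_ ?_ ?_).update_node hpd _
    · intro r hr'
      simp [show r ≠ 19 by omega, show r ≠ 20 by omega]
    · ext i; simp
    · ext i; simp
  · intro v hv
    by_cases hvp : v = p
    · subst hvp
      simp [WExpr.eval, VExpr.eval, hr, h2 ch hchd.1]
    · simp [WExpr.eval, VExpr.eval, hr, hvp, h2 v hv]
  · intro v hv1 hv2 hv3
    by_cases hvp : v = p
    · subst hvp
      rw [Function.update_self, Function.update_of_ne (by omega), Function.update_of_ne (by omega)]
      exact hch
    · rw [Function.update_of_ne hvp, Function.update_of_ne (by omega),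
        Function.update_of_ne (by omega)]
      exact h3 v hv1 hv2 hvp
  · exact eval_div (a := p) (b := 2) (by simp [WExpr.eval, hr]) (eval_const (by omega)) (by omega)

theorem exec_fixPath (hw : 2 * d < 2 ^ M.w) (n : ℕ) {p : ℕ} (hn : p < 2 ^ n) (hd : 1 ≤ d)
    (hpd : p < d) (h1 : LeafRep M d E b s X nd) (h2 : NodeRep M d s nd)
    (h3 : TreeExcept M d nd p) (hr : s.reg 19 = p) :
    ∃ s' nd', Exec M fixPath s q s' q (80 * (n + 1)) ∧ LeafRep M d E b s' X nd' ∧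
      NodeRep M d s' nd' ∧ TreeExcept M d nd' 0 := by
  have hcond : ∀ (s : Store α), (BExpr.wlt (.const 0) (.reg 19)).Holds M s ↔ 0 < s.reg 19 := by
    intro s; simp [BExpr.Holds, WExpr.eval]
  induction n generalizing p s nd with
  | zero =>
    have hp0 : p = 0 := by omega
    subst hp0
    exact ⟨s, nd, (Exec.loop_neg (by rw [hcond]; omega)).mono (by simp [BExpr.cost, WExpr.cost]),
      h1, h2, h3⟩
  | succ n ih =>
    rcases Nat.eq_zero_or_pos p with rfl | hp
    · exact ⟨s, nd, (Exec.loop_neg (by rw [hcond]; omega)).mono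
        (by simp [BExpr.cost, WExpr.cost]; omega), h1, h2, h3⟩
    · obtain ⟨s₁, nd₁, e1, l1, n1, t1, r1⟩ := exec_fixNode (q := q) hp hpd hw h1 h2 h3 hr
      obtain ⟨s₂, nd₂, e2, l2, n2, t2⟩ := ih (p := p / 2) (by omega) (by omega) l1 n1 t1 r1
      refine ⟨s₂, nd₂, (Exec.loop_pos (by rw [hcond]; omega) e1 e2).mono ?_, l2, n2, t2⟩
      simp [BExpr.cost, WExpr.cost]
      omega

theorem exec_fixTop (hw : 2 * d < 2 ^ M.w) (hd : 1 ≤ d)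
    (h1 : LeafRep M d E b s X nd) (h2 : NodeRep M d s nd) (h3 : TreeExcept M d nd 0) :
    ∃ s', Exec M fixTop s q s' q 10 ∧ Rep M d E b s' X := by
  have hc : 1 % 2 ^ M.w = 1 := Nat.mod_eq_of_lt (by omega)
  refine ⟨_, ((Exec.wstore M _ q 2 _ _).seq (Exec.vstore M _ q 0 _ _)).mono ?_,
    Function.update nd 0 (nd 1), (h1.congr ?_ ?_ ?_).update_node (by omega) _, ?_, ?_, ?_⟩
  · simp [WExpr.cost, VExpr.cost]
  · simp
  · ext i; simp
  · ext i; simp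
  · intro v hv
    by_cases hv0 : v = 0
    · subst hv0
      simp [WExpr.eval, VExpr.eval, hc, h2 1 (by omega)]
    · simp [WExpr.eval, VExpr.eval, hv0, h2 v hv]
  · intro v hv1 hv2 hv3
    rw [Function.update_of_ne (by omega), Function.update_of_ne (by omega),
        Function.update_of_ne (by omega)]
    exact h3 v hv1 hv2 hv3
  · simp

/-- What the choice of the leaf achieves: the element `y` may be written into leaf `d + j`, which
makes the choice `X'`. -/
structure LeafChosen (M : Machine α) (d E b : ℕ) (s : Store α) (X : Finset (Fin M.N))
    (nd : ℕ → Option (Fin M.N)) (y : Fin M.N) (j : ℕ) (X' : Finset (Fin M.N)) : Prop where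
  lt : j < d
  reg0 : s.reg 0 = M.N
  reg1 : s.reg 1 = d
  reg2 : s.reg 2 = E
  reg3 : s.reg 3 = X'.card
  reg4 : s.reg 4 = b
  reg19 : s.reg 19 = d + j
  out : ∀ j < d, s.arr 0 j = code (nd (d + j))
  out_ge : ∀ j, d ≤ j → s.arr 0 j = 0
  card_le : X'.card ≤ d
  lt_card : j < X'.card
  free : ∀ j, X'.card ≤ j → j < d → nd (d + j) = none
  used : ∀ i < X'.card, i ≠ j → nd (d + i) ≠ none
  mem_iff : ∀ z, z ∈ X' ↔ z = y ∨ ∃ i < d, i ≠ j ∧ nd (d + i) = some z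
  pos : ∀ i < d, i ≠ j → ∀ z, nd (d + i) = some z → M.G z ≠ M.G y ∧ s.arr 1 (M.G z) = d + i
  absent : ∀ γ, γ ≠ M.G y → (∀ i < d, i ≠ j → ∀ z, nd (d + i) = some z → M.G z ≠ γ) →
    s.arr 1 γ = 0
  improving_eq : imp M d X' = imp M d (insert y X)

/-- Evicting `x` is harmless if it does not improve on what remains: inserting it again changes
nothing. -/
theorem imp_insert_erase {x y : Fin M.N} (hx : x ∈ X)
    (h : x ∉ imp M d (insert y (X.erase x))) :
    imp M d (insert y (X.erase x)) = imp M d (insert y X) := by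
  rw [imp, imp, ← improving_insert_of_notMem h, Finset.insert_comm, Finset.insert_erase hx]

theorem LeafRep.chosen_of_replace (h1 : LeafRep M d E b s X nd) {s' : Store α} {y x : Fin M.N}
    {j : ℕ} (hj : j < d) (hjx : nd (d + j) = some x) (hy : y ∉ X)
    (hyX : ∀ z ∈ X, z ≠ x → M.G z ≠ M.G y) (himp : x ∉ imp M d (insert y (X.erase x)))
    (hr : ∀ r < 5, s'.reg r = s.reg r) (hr19 : s'.reg 19 = d + j) (h0 : s'.arr 0 = s.arr 0)
    (harr : ∀ γ, γ ≠ M.G x → s'.arr 1 γ = s.arr 1 γ)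
    (hx0 : M.G x ≠ M.G y → s'.arr 1 (M.G x) = 0) :
    LeafChosen M d E b s' X nd y j (insert y (X.erase x)) := by
  have hx := h1.mem j hj x hjx
  have hxy : x ≠ y := fun h => hy (h ▸ hx)
  have hcard : (insert y (X.erase x)).card = X.card := by
    rw [Finset.card_insert_of_notMem (fun h => hy (Finset.mem_of_mem_erase h)),
      Finset.card_erase_add_one hx]
  have huniq : ∀ i < d, i ≠ j → ∀ z, nd (d + i) = some z → z ∈ X ∧ z ≠ x ∧ M.G z ≠ M.G x := by
    intro i hi hij z hz
    have hzX := h1.mem i hi z hz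
    have hG : M.G z ≠ M.G x := fun hG => hij (by
      have e1 := h1.pos i hi z hz
      rw [hG, h1.pos j hj x hjx] at e1
      omega)
    exact ⟨hzX, fun h => hG (by rw [h]), hG⟩
  refine ⟨hj, (hr 0 (by norm_num)).trans h1.reg0, (hr 1 (by norm_num)).trans h1.reg1,
    (hr 2 (by norm_num)).trans h1.reg2, ?_, (hr 4 (by norm_num)).trans h1.reg4, hr19,
    by rw [h0]; exact h1.out, by rw [h0]; exact h1.out_ge, by rw [hcard]; exact h1.card_le,
    ?_, by rw [hcard]; exact h1.free, ?_, ?_, ?_, ?_, imp_insert_erase hx himp⟩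
  · rw [hcard, hr 3 (by norm_num), h1.reg3]
  · rw [hcard]
    by_contra hc
    rw [h1.free j (not_lt.1 hc) hj] at hjx
    cases hjx
  · intro i hi _
    exact h1.used i (by omega)
  · intro z
    rw [Finset.mem_insert, Finset.mem_erase]
    constructor
    · rintro (h | ⟨h, h'⟩)
      · exact Or.inl h
      · obtain ⟨i, hi, hi'⟩ := h1.exists_leaf z h'
        refine Or.inr ⟨i, hi, ?_, hi'⟩
        rintro rfl
        rw [hjx] at hi'
        exact h (Option.some_injective _ hi').symm
    · rintro (h | ⟨i, hi, hij, hz⟩)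
      · exact Or.inl h
      · obtain ⟨a, b, -⟩ := huniq i hi hij z hz
        exact Or.inr ⟨b, a⟩
  · intro i hi hij z hz
    obtain ⟨a, b, c⟩ := huniq i hi hij z hz
    exact ⟨hyX z a b, by rw [harr _ c, h1.pos i hi z hz]⟩
  · intro γ hγ hall
    by_cases hγx : γ = M.G x
    · rw [hγx]; exact hx0 (fun h => hγ (by rw [hγx, h]))
    · rw [harr γ hγx]
      refine h1.absent γ fun z hz hG => ?_
      obtain ⟨i, hi, hi'⟩ := h1.exists_leaf z hz
      refine hall i hi ?_ z hi' hG
      rintro rfl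
      rw [hjx] at hi'
      rw [← Option.some_injective _ hi'] at hG
      exact hγx hG.symm

/-- There are three cases: the type of `y` is represented and its leaf is reused; the type is new
and a leaf is free; or all leaves are taken and the costliest entry is evicted and its type cleared.
An evicted element is never improving afterwards. -/
theorem exec_chooseLeaf (hw : 2 * d < 2 ^ M.w) (hwN : M.N < 2 ^ M.w) (hd : 1 ≤ d)
    (h1 : LeafRep M d E b s X nd) (h2 : NodeRep M d s nd) (h3 : TreeExcept M d nd 0)
    (h4 : nd 0 = nd 1) {y : Fin M.N} (hy : y ∈ imp M d X) (hr : s.reg 19 = s.arr 1 (M.G y)) :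
    ∃ s' j X', Exec M chooseLeaf s q s' q (30 + M.tG) ∧ LeafChosen M d E b s' X nd y j X' ∧
      s'.arr 2 = s.arr 2 ∧ s'.varr = s.varr ∧ (∀ r, 5 ≤ r → r < 19 → s'.reg r = s.reg r) := by
  have hyX : y ∉ X := (mem_improving.1 hy).1
  have hc0 : ∀ s : Store α, (BExpr.weq (.reg 19) (.const 0)).Holds M s ↔ s.reg 19 = 0 := by
    intro s; simp [BExpr.Holds, WExpr.eval]
  by_cases hx : ∃ x ∈ X, M.G x = M.G y
  · obtain ⟨x, hx, hxG⟩ := hx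
    obtain ⟨j, hj, hjx⟩ := h1.exists_leaf x hx
    have hp := h1.pos j hj x hjx
    rw [hxG] at hp
    have hlt := (h1.mem_imp_of_mem hx hxG).1 hy
    refine ⟨s, j, insert y (X.erase x), (Exec.cond_neg (s₁ := s) (q₁ := q) (c := 2) ?_ ?_).mono ?_,
      h1.chosen_of_replace hj hjx hyX ?_ ?_ (fun _ _ => rfl) (hr.trans hp) rfl (fun _ _ => rfl) ?_,
      rfl, rfl, fun _ _ _ => rfl⟩
    · rw [hc0, hr, hp]; omega
    · have := Exec.wset M s q 5 (.reg 5)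
      simp only [WExpr.eval, setReg_self] at this
      exact this
    · simp [BExpr.cost, WExpr.cost]; omega
    · intro z hz hzx hzG
      exact hzx (h1.inj hz hx (hzG.trans hxG.symm))
    -- The evicted `x` is blocked by the cheaper `y` of the same type.
    · intro hc
      refine (mem_improving.1 hc).2.1 (Finset.mem_image.2 ⟨y, Finset.mem_filter.2
        ⟨Finset.mem_insert_self _ _, hlt⟩, hxG.symm⟩)
    · exact fun h => absurd hxG h
  · push Not at hx
    have hp := h1.absent _ hx
    rw [hp] at hr
    have hroot := (h1.mem_imp_of_forall h3 hd hx).1 hy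
    have hclt : (BExpr.wlt (.reg 3) (.reg 1)).Holds M s ↔ X.card < d := by
      simp [BExpr.Holds, WExpr.eval, h1.reg3, h1.reg1]
    rcases h1.card_le.lt_or_eq with hcard | hcard
    · have ha : (WExpr.op .add (.reg 1) (.reg 3)).eval M s = d + X.card :=
        eval_add h1.reg1 h1.reg3 (by omega)
      refine ⟨_, X.card, insert y X, (Exec.cond_pos ((hc0 s).2 hr) (Exec.cond_pos (hclt.2 hcard)
        ((Exec.wset M s q 19 _).seq (Exec.wset M _ q 3 _)))).mono ?_, ?_, rfl, rfl, ?_⟩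
      · simp [BExpr.cost, WExpr.cost]; omega
      · have hcc : (insert y X).card = X.card + 1 := Finset.card_insert_of_notMem hyX
        have ha' : (WExpr.op .add (.reg 3) (.const 1)).eval M
            (s.setReg 19 ((WExpr.op .add (.reg 1) (.reg 3)).eval M s)) = X.card + 1 :=
          eval_add (by simp [WExpr.eval, h1.reg3]) (eval_const (by omega)) (by omega)
        refine ⟨hcard, ?_, ?_, ?_, ?_, ?_, ?_, ?_, ?_, by omega, by omega, ?_, ?_, ?_, ?_, ?_, rfl⟩
        · simp [h1.reg0]
        · simp [h1.reg1]
        · simp [h1.reg2]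
        · simp [ha', hcc]
        · simp [h1.reg4]
        · simp [ha]
        · simpa using h1.out
        · simpa using h1.out_ge
        · intro i hi hi'; exact h1.free i (by omega) hi'
        · intro i hi hi'; exact h1.used i (by omega)
        · intro z
          rw [Finset.mem_insert]
          constructor
          · rintro (h | h)
            · exact Or.inl h
            · obtain ⟨i, hi, hi'⟩ := h1.exists_leaf z h
              refine Or.inr ⟨i, hi, ?_, hi'⟩
              rintro rfl
              rw [h1.free _ le_rfl hcard] at hi'
              cases hi'
          · rintro (h | ⟨i, hi, -, hz⟩)
            · exact Or.inl h
            · exact Or.inr (h1.mem i hi z hz)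
        · intro i hi _ z hz
          exact ⟨hx z (h1.mem i hi z hz), by simpa using h1.pos i hi z hz⟩
        · intro γ hγ hall
          simp only [setReg_arr]
          refine h1.absent γ fun z hz hzG => ?_
          obtain ⟨i, hi, hi'⟩ := h1.exists_leaf z hz
          refine hall i hi ?_ z hi' hzG
          rintro rfl
          rw [h1.free _ le_rfl hcard] at hi'
          cases hi'
      · intro r h5 h19
        simp [show r ≠ 3 by omega, show r ≠ 19 by omega]
    · obtain ⟨j, hj, hj'⟩ := h3.exists_leaf hd
      obtain ⟨x, hjx⟩ := Option.ne_none_iff_exists'.1 (h1.used j (by omega))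
      have hxX := h1.mem j hj x hjx
      have h0x : nd 0 = some x := by rw [h4, hj', hjx]
      have hrootx : key M y < key M x := by
        rw [hj', hjx] at hroot
        exact WithTop.coe_lt_coe.1 hroot
      have hmax : ∀ z ∈ X, z ≠ x → key M z < key M x := by
        intro z hz hzx
        obtain ⟨i, hi, hi'⟩ := h1.exists_leaf z hz
        have := h3.le_root (d + i) (by omega) (by omega)
        rw [hi', hj', hjx] at this
        exact lt_of_le_of_ne (WithTop.coe_le_coe.1 this) fun h => hzx (key_injective M h)
      have e0 : (WExpr.op .sub (.load 2 (.const 0)) (.const 1)).eval M s = x := by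
        have := eval_sub (M := M) (s := s) (e₁ := .load 2 (.const 0)) (e₂ := .const 1)
          (a := (x : ℕ) + 1) (b := 1)
          (by simp [WExpr.eval, (h2 0 (by omega)).1, h0x, code]) (eval_const (by omega))
          (by have := x.2; omega)
        simpa using this
      have e1 : (WExpr.call (.op .sub (.load 2 (.const 0)) (.const 1))).eval M s = M.G x := by
        rw [WExpr.eval, e0]
        simp [Machine.callG]
      have e2 : (WExpr.load 1 (.reg 20)).eval M (s.setReg 20 (M.G x)) = d + j := by
        simp [WExpr.eval, h1.pos j hj x hjx]
      have e3 : (WExpr.reg 20).eval M ((s.setReg 20 (M.G x)).setReg 19 (d + j)) = M.G x := by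
        simp [WExpr.eval]
      have e4 : (WExpr.const 0).eval M ((s.setReg 20 (M.G x)).setReg 19 (d + j)) = 0 := by
        simp [WExpr.eval]
      refine ⟨_, j, insert y (X.erase x), (Exec.cond_pos ((hc0 s).2 hr) (Exec.cond_neg
        (mt hclt.1 (by omega)) ((Exec.wset_of e1).seq ((Exec.wset_of (a := d + j) e2).seq
          (Exec.wstore_of (a := M.G x) (b := 0) e3 e4))))).mono ?_, h1.chosen_of_replace hj hjx hyX ?_ ?_ ?_ ?_ ?_ ?_ ?_,
        ?_, rfl, ?_⟩
      · simp [BExpr.cost, WExpr.cost]; omega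
      · exact fun z hz _ => hx z hz
      -- The evicted `x` is costlier than all the remaining entries, which represent `d` different
      -- types.
      · intro hc
        have := (mem_improving.1 hc).2.2
        have hsub : (insert y (X.erase x)).image M.G ⊆
            cheapTypes (key M) M.G (insert y (X.erase x)) x := by
          refine Finset.image_subset_image fun z hz => Finset.mem_filter.2 ⟨hz, ?_⟩
          rcases Finset.mem_insert.1 hz with rfl | hz
          · exact hrootx
          · exact hmax z (Finset.mem_of_mem_erase hz) (Finset.ne_of_mem_erase hz)
        have hle := Finset.card_le_card hsub
        rw [Finset.card_image_of_injOn, Finset.card_insert_of_notMem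
          (fun h => hyX (Finset.mem_of_mem_erase h)), Finset.card_erase_add_one hxX] at hle
        · omega
        · intro z hz z' hz' hzz
          rcases Finset.mem_insert.1 (Finset.mem_coe.1 hz) with h | h <;>
            rcases Finset.mem_insert.1 (Finset.mem_coe.1 hz') with h' | h'
          · rw [h, h']
          · exact absurd (hzz.symm.trans (by rw [h])) (hx z' (Finset.mem_of_mem_erase h'))
          · exact absurd (hzz.trans (by rw [h'])) (hx z (Finset.mem_of_mem_erase h))
          · exact h1.inj (Finset.mem_of_mem_erase h) (Finset.mem_of_mem_erase h') hzz
      · intro r hr5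
        simp [show r ≠ 19 by omega, show r ≠ 20 by omega]
      · simp
      · ext i; simp
      · intro γ hγ
        simp [hγ]
      · simp
      · ext i; simp
      · intro r h5 h19
        simp [show r ≠ 20 by omega, show r ≠ 19 by omega]

theorem exec_writeLeaf (hw : 2 * d < 2 ^ M.w) {y : Fin M.N} {j : ℕ}
    {X' : Finset (Fin M.N)} (h : LeafChosen M d E b s X nd y j X') (hn : NodeRep M d s nd)
    (ht : TreeExcept M d nd 0) (h5 : s.reg 5 = y + 1) (h7 : s.reg 7 = y) (h18 : s.reg 18 = M.G y) :
    ∃ s' nd', Exec M writeLeaf s q s' q (20 + M.tF) ∧ LeafRep M d E b s' X' nd' ∧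
      NodeRep M d s' nd' ∧ TreeExcept M d nd' ((d + j) / 2) ∧ s'.reg 19 = (d + j) / 2 := by
  have hj := h.lt
  have e1 : ∀ s' : Store α, s'.reg = s.reg →
      (WExpr.op .sub (.reg 19) (.reg 1)).eval M s' = j := fun s' hs => by
    have := eval_sub (M := M) (s := s') (e₁ := .reg 19) (e₂ := .reg 1) (a := d + j) (b := d)
      (by simp [WExpr.eval, hs, h.reg19]) (by simp [WExpr.eval, hs, h.reg1]) (by omega)
    rw [this]; omega
  have e2 : ∀ s' : Store α, s'.reg = s.reg →
      (WExpr.op .div (.reg 19) (.const 2)).eval M s' = (d + j) / 2 := fun s' hs =>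
    eval_div (by simp [WExpr.eval, hs, h.reg19]) (eval_const (by omega)) (by omega)
  have e3 : ∀ s' : Store α, s'.reg = s.reg → (WExpr.reg 19).eval M s' = d + j := fun s' hs => by
    simp [WExpr.eval, hs, h.reg19]
  have e4 : ∀ s' : Store α, s'.reg = s.reg → (WExpr.reg 5).eval M s' = y + 1 := fun s' hs => by
    simp [WExpr.eval, hs, h5]
  have e5 : ∀ s' : Store α, s'.reg = s.reg → (WExpr.reg 18).eval M s' = M.G y := fun s' hs => by
    simp [WExpr.eval, hs, h18]
  have e6 : ∀ s' : Store α, s'.reg = s.reg →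
      (VExpr.call (.reg 7)).eval M s' = price M.F (some y) := fun s' hs => by
    simp [VExpr.eval, WExpr.eval, hs, h7, Machine.callF, price]
  have hupd : ∀ i, i ≠ j → Function.update nd (d + j) (some y) (d + i) = nd (d + i) := fun i hi =>
    Function.update_of_ne (by omega) _ _
  have x1 := Exec.wstore_of (q := q) (n := 1) (e5 s rfl) (e3 s rfl)
  have x2 := Exec.wstore_of (q := q) (n := 2) (e3 (s.setArr 1 (M.G y) (d + j)) rfl) (e4 _ rfl)
  have x3 := Exec.vstore_of (q := q) (n := 0)
    (e3 ((s.setArr 1 (M.G y) (d + j)).setArr 2 (d + j) (y + 1)) rfl) (e6 _ rfl)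
  have x4 := Exec.wstore_of (q := q) (n := 0) (e1 (((s.setArr 1 (M.G y) (d + j)).setArr 2 (d + j)
    (y + 1)).setVArr 0 (d + j) (price M.F (some y))) rfl) (e4 _ rfl)
  refine ⟨_, Function.update nd (d + j) (some y), (x1.seq (x2.seq (x3.seq
    (x4.seq (Exec.wset_of (e2 _ rfl)))))).mono ?_,
    ⟨?_, ?_, ?_, ?_, ?_, ?_, ?_, ?_, ?_, ?_, ?_, h.card_le, ?_, ?_⟩, ?_, ?_, ?_⟩
  · simp [WExpr.cost, VExpr.cost]; omega
  · simp [h.reg0]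
  · simp [h.reg1]
  · simp [h.reg2]
  · simp [h.reg3]
  · simp [h.reg4]
  · intro i hi
    by_cases hij : i = j
    · subst hij; simp [code]
    · rw [hupd i hij]; simp [hij, h.out i hi]
  · intro i hi
    have : i ≠ j := by omega
    simp [this, h.out_ge i hi]
  · intro i hi hid
    have := h.lt_card
    rw [hupd i (by omega)]
    exact h.free i hi hid
  · intro i hi
    by_cases hij : i = j
    · subst hij; simp
    · rw [hupd i hij]; exact h.used i hi hij
  · intro i hi z hz
    rw [h.mem_iff]
    by_cases hij : i = j
    · subst hij
      rw [Function.update_self] at hz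
      exact Or.inl (Option.some_injective _ hz).symm
    · rw [hupd i hij] at hz
      exact Or.inr ⟨i, hi, hij, hz⟩
  · intro z hz
    rcases (h.mem_iff z).1 hz with rfl | ⟨i, hi, hij, hz⟩
    · exact ⟨j, hj, by simp⟩
    · exact ⟨i, hi, by rw [hupd i hij, hz]⟩
  · intro i hi z hz
    by_cases hij : i = j
    · subst hij
      rw [Function.update_self] at hz
      rw [← Option.some_injective _ hz]
      simp
    · rw [hupd i hij] at hz
      obtain ⟨a, c⟩ := h.pos i hi hij z hz
      simp [a, c]
  · intro γ hγ
    have h1 : γ ≠ M.G y := fun he => hγ y ((h.mem_iff y).2 (Or.inl rfl)) he.symm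
    have h2 := h.absent γ h1 fun i hi hij z hz => hγ z ((h.mem_iff z).2 (Or.inr ⟨i, hi, hij, hz⟩))
    simp [h1, h2]
  · intro v hv
    by_cases hvj : v = d + j
    · subst hvj; simp [code]
    · rw [Function.update_of_ne hvj]; simp [hvj, hn v hv]
  · intro v hv1 hv2 hv3
    rw [Function.update_of_ne (by omega), Function.update_of_ne (by omega),
        Function.update_of_ne (by omega)]
    exact ht v hv1 hv2 (by omega)
  · simp

theorem exec_update (hw : 2 * d < 2 ^ M.w) (hwN : M.N < 2 ^ M.w) (hd : 1 ≤ d)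
    (h : Rep M d E b s X) {y : Fin M.N} (hy : y ∈ imp M d X) (h5 : s.reg 5 = y + 1) :
    ∃ s' X', Exec M update s q s' q (240 + 80 * Nat.log 2 d + (M.tF + 2 * M.tG)) ∧
      Rep M d E b s' X' ∧ imp M d X' = imp M d (insert y X) := by
  obtain ⟨nd, h1, h2, h3, h4⟩ := h
  have e1 : (WExpr.op .sub (.reg 5) (.const 1)).eval M s = y := by
    have := eval_sub (M := M) (s := s) (e₁ := .reg 5) (e₂ := .const 1) (a := (y : ℕ) + 1) (b := 1)
      (by simp [WExpr.eval, h5]) (eval_const (by omega)) (by have := y.2; omega)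
    simpa using this
  have e2 : (WExpr.call (.reg 7)).eval M (s.setReg 7 y) = M.G y := by
    simp [WExpr.eval, Machine.callG]
  have e3 : (WExpr.load 1 (.reg 18)).eval M ((s.setReg 7 y).setReg 18 (M.G y)) =
      s.arr 1 (M.G y) := by
    simp [WExpr.eval]
  set s₁ := ((s.setReg 7 y).setReg 18 (M.G y)).setReg 19 (s.arr 1 (M.G y)) with hs₁
  have l1 : LeafRep M d E b s₁ X nd := by
    refine h1.congr ?_ rfl rfl
    intro r hr
    simp [hs₁, show r ≠ 7 by omega, show r ≠ 18 by omega, show r ≠ 19 by omega]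
  obtain ⟨s₂, j, X', x2, l2, ha, hv, hr⟩ := exec_chooseLeaf (q := q) hw hwN hd l1 h2 h3 h4 hy
    (by simp [hs₁])
  have n2 : NodeRep M d s₂ nd := by
    intro v hv'
    rw [ha, hv]
    exact h2 v hv'
  obtain ⟨s₃, nd₃, x3, l3, n3, t3, r3⟩ := exec_writeLeaf (q := q) hw l2 n2 h3
    (by rw [hr 5 le_rfl (by norm_num)]; simp [hs₁, h5])
    (by rw [hr 7 (by norm_num) (by norm_num)]; simp [hs₁])
    (by rw [hr 18 (by norm_num) (by norm_num)]; simp [hs₁])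
  have hj := l2.lt
  have hlog : (d + j) / 2 < 2 ^ (Nat.log 2 d + 1) := by
    have := Nat.lt_pow_succ_log_self (b := 2) (by norm_num) d
    omega
  obtain ⟨s₄, nd₄, x4, l4, n4, t4⟩ := exec_fixPath (q := q) hw (Nat.log 2 d + 1) hlog hd (by omega)
    l3 n3 t3 r3
  obtain ⟨s₅, x5, hrep⟩ := exec_fixTop (q := q) hw hd l4 n4 t4
  refine ⟨s₅, X', ((Exec.wset_of e1).seq ((Exec.wset_of e2).seq ((Exec.wset_of e3).seq
    (x2.seq (x3.seq (x4.seq x5)))))).mono ?_, hrep, l2.improving_eq⟩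
  simp [WExpr.cost]
  omega

end Update
-- Grover amplitudes as rotations
/-- The amplitudes, relative to the uniform superposition, of the bad and of the good elements after
`k` Grover iterations, for `t` good ones among `N`. -/
noncomputable def groverAmp (N : ℕ) (t : ℝ) : ℕ → ℝ × ℝ
  | 0 => (1, 1)
  | k + 1 => (2 * flipMean N t (groverAmp N t k).1 (groverAmp N t k).2 1 - (groverAmp N t k).1,
      2 * flipMean N t (groverAmp N t k).1 (groverAmp N t k).2 1 + (groverAmp N t k).2)

/-- The probability that `k` Grover iterations fail. -/
noncomputable def groverFail (N t k : ℕ) : ℝ≥0∞ :=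
  ENNReal.ofReal ((N - t) / N * (groverAmp N t k).1 ^ 2)

section Trig

variable {N t : ℕ}

/-- The Grover angle. -/
noncomputable def groverAngle (N t : ℕ) : ℝ := Real.arcsin (Real.sqrt (t / N))

theorem sin_groverAngle (ht : t ≤ N) : Real.sin (groverAngle N t) = Real.sqrt (t / N) := by
  refine Real.sin_arcsin (by linarith [Real.sqrt_nonneg (t / N : ℝ)]) ?_
  rw [Real.sqrt_le_one]
  exact div_le_one_of_le₀ (by exact_mod_cast ht) (by positivity)

theorem cos_groverAngle_sq (hN : N ≠ 0) (ht : t ≤ N) :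
    Real.cos (groverAngle N t) ^ 2 = (N - t) / N := by
  have h := Real.sin_sq_add_cos_sq (groverAngle N t)
  rw [sin_groverAngle ht, Real.sq_sqrt (by positivity)] at h
  have : (N : ℝ) ≠ 0 := by exact_mod_cast hN
  rw [sub_div, div_self this]
  linarith

/-- In the plane of the normalized bad and good states an iteration is a rotation by `2 θ`: with `φ
= (2 k + 1) θ`, the mean after the sign flip is `cos (φ + θ)`. The factors `cos θ` and `sin θ` on
the left avoid divisions by zero. -/
theorem groverAmp_closed (hN : N ≠ 0) (ht : t ≤ N) (k : ℕ) :
    Real.cos (groverAngle N t) * (groverAmp N t k).1 = Real.cos ((2 * k + 1) * groverAngle N t) ∧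
    Real.sin (groverAngle N t) * (groverAmp N t k).2 = Real.sin ((2 * k + 1) * groverAngle N t) := by
  have hc := cos_groverAngle_sq hN ht
  have hs : Real.sin (groverAngle N t) ^ 2 = t / N := by
    rw [sin_groverAngle ht, Real.sq_sqrt (by positivity)]
  set θ := groverAngle N t
  induction k with
  | zero => simp [groverAmp]
  | succ k ih =>
    have hN' : (N : ℝ) ≠ 0 := by exact_mod_cast hN
    obtain ⟨h1, h2⟩ := ih
    set φ := (2 * (k : ℝ) + 1) * θ with hφ
    have e : (2 * ((k + 1 : ℕ) : ℝ) + 1) * θ = (φ + θ) + θ := by rw [hφ]; push_cast; ring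
    have hm : flipMean N t (groverAmp N t k).1 (groverAmp N t k).2 1 = Real.cos (φ + θ) := by
      have : flipMean N t (groverAmp N t k).1 (groverAmp N t k).2 1 =
          (N - t) / N * (groverAmp N t k).1 - t / N * (groverAmp N t k).2 := by
        rw [flipMean]; field_simp; ring
      rw [this, Real.cos_add, ← h1, ← h2, ← hc, ← hs]
      ring
    have hd : Real.cos φ = Real.cos (φ + θ) * Real.cos θ + Real.sin (φ + θ) * Real.sin θ := by
      rw [← Real.cos_sub]; congr 1; ring
    have hd' : Real.sin φ = Real.sin (φ + θ) * Real.cos θ - Real.cos (φ + θ) * Real.sin θ := by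
      rw [← Real.sin_sub]; congr 1; ring
    rw [e]
    simp only [groverAmp, hm]
    rw [Real.cos_add (φ + θ), Real.sin_add (φ + θ)]
    constructor
    · linear_combination -1 * h1 - hd
    · linear_combination h2 + hd'

theorem groverFail_eq (hN : N ≠ 0) (ht : t ≤ N) (k : ℕ) :
    groverFail N t k = ENNReal.ofReal (Real.cos ((2 * k + 1) * groverAngle N t) ^ 2) := by
  rw [groverFail, ← (groverAmp_closed hN ht k).1, mul_pow, cos_groverAngle_sq hN ht]

theorem groverFail_le_one (hN : N ≠ 0) (ht : t ≤ N) (k : ℕ) : groverFail N t k ≤ 1 := by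
  rw [groverFail_eq hN ht, ENNReal.ofReal_le_one]
  exact Real.cos_sq_le_one _

theorem sqrt_le_groverAngle (ht : t ≤ N) : Real.sqrt (t / N) ≤ groverAngle N t := by
  rw [← sin_groverAngle ht]
  refine Real.sin_le ?_
  exact Real.arcsin_nonneg.2 (Real.sqrt_nonneg _)

/-- Among the iteration numbers `0, 1, 4, 13, …` below `√(N / t)` one succeeds with probability at
least `1 / 2`. -/
theorem exists_groverFail_le_half (hN : N ≠ 0) (ht : t ≤ N) {L : ℕ} (hL : N ≤ 9 ^ L * t) :
    ∃ i ≤ L, ∀ k : ℕ, 2 * k + 1 = 3 ^ i → groverFail N t k ≤ 1 / 2 := by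
  have hN' : (0 : ℝ) < N := by exact_mod_cast Nat.pos_of_ne_zero hN
  have hpi := Real.pi_pos
  have hpi4 := Real.pi_lt_four
  have h1 : (1 : ℝ) ≤ 3 ^ L * groverAngle N t := by
    refine le_trans ?_ (mul_le_mul_of_nonneg_left (sqrt_le_groverAngle ht) (by positivity))
    rw [← Real.sqrt_sq (by positivity : (0 : ℝ) ≤ 3 ^ L), ← Real.sqrt_mul (by positivity)]
    rw [Real.one_le_sqrt, ← pow_mul, mul_comm L 2, pow_mul]
    norm_num
    rw [← mul_div_assoc, one_le_div hN']
    exact_mod_cast hL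
  have hex : ∃ i, Real.pi / 4 ≤ 3 ^ i * groverAngle N t := ⟨L, by linarith⟩
  classical
  -- Take the first `i` with `3 ^ i * θ ≥ π / 4`. By minimality, or by `θ ≤ π / 2` if `i = 0`, this
  -- multiple is at most `3 π / 4`, so the squared cosine is at most `1 / 2`. Level `L` qualifies
  -- because `3 ^ L * θ ≥ 3 ^ L * √(t / N) ≥ 1`.
  refine ⟨Nat.find hex, Nat.find_min' hex (by linarith), fun k hk => ?_⟩
  have h2 := Nat.find_spec hex
  have h3 : (3 : ℝ) ^ Nat.find hex * groverAngle N t ≤ 3 * Real.pi / 4 := by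
    rcases Nat.eq_zero_or_pos (Nat.find hex) with h0 | h0
    · rw [h0]
      have := Real.arcsin_le_pi_div_two (Real.sqrt (t / N))
      rw [pow_zero, one_mul, groverAngle]
      linarith
    · obtain ⟨j, hj⟩ : ∃ j, Nat.find hex = j + 1 := ⟨Nat.find hex - 1, by omega⟩
      have := Nat.find_min hex (m := j) (by omega)
      rw [hj, pow_succ]
      linarith
  have h4 : (2 * (k : ℝ) + 1) = 3 ^ Nat.find hex := by exact_mod_cast hk
  rw [groverFail_eq hN ht, h4, ENNReal.ofReal_le_iff_le_toReal (by simp)]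
  set x := (3 : ℝ) ^ Nat.find hex * groverAngle N t
  have h5 : Real.cos (2 * x) ≤ 0 := Real.cos_nonpos_of_pi_div_two_le_of_le (by linarith) (by linarith)
  rw [Real.cos_sq]
  simp
  linarith

end Trig

/-! ### The program: Grover search -/

def found0 : BExpr := .weq (.reg 5) (.const 0)

/-- One Grover iteration on pairs of an element `reg 7 % N` and an index `reg 7 / N`; of the
improving elements those with an index below `reg 12` are flipped. -/
def flip : Cmd :=
  .seq (.phase 7 (.and (.wlt (.op .div (.reg 7) (.reg 0)) (.reg 12))
    (improves (.op .mod (.reg 7) (.reg 0))))) .diffuse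

/-- Measure and test the outcome. -/
def finish : Cmd :=
  .seq (.meas 7) <| .seq (.wset 7 (.op .mod (.reg 7) (.reg 0))) <|
    .cond (improves (.reg 7)) (.wset 5 (.op .add (.reg 7) (.const 1))) nop

def flipLoop : Cmd :=
  .loop (.wlt (.reg 9) (.reg 8)) (.seq flip (.wset 9 (.op .add (.reg 9) (.const 1))))

/-- Grover search with `reg 8` iterations. -/
def attempt : Cmd :=
  .seq (.wset 12 (.const 1)) <| .seq (.prep (.reg 0)) <| .seq (.wset 9 (.const 0)) <|
    .seq flipLoop finish

/-- Grover search with `0, 1, 4, 13, …` iterations, up to `reg 10`. -/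
def sweepLoop : Cmd :=
  .loop (.and found0 (.not (.wlt (.reg 10) (.reg 8)))) (.seq attempt
    (.cond found0 (.wset 8 (.op .add (.op .mul (.const 3) (.reg 8)) (.const 1))) nop))

def sweep : Cmd := .seq (.wset 8 (.const 0)) sweepLoop

/-- `n` times `C`, or until something is found. -/
def rep (C : Cmd) : ℕ → Cmd
  | 0 => nop
  | n + 1 => .seq C (.cond found0 (rep C n) nop)

def triple10 : Cmd := .wset 10 (.op .add (.op .mul (.const 3) (.reg 10)) (.const 1))

/-- `2 * reg 10 + 1` -/
def span10 : WExpr := .op .add (.op .mul (.const 2) (.reg 10)) (.const 1)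

/-- At level `L` the bound `reg 10` is `(3 ^ L - 1) / 2`, so the test reads `9 ^ L < 9 * N`. Seven
sweeps bring the failure probability of a sufficient level below `1 / 114`; this beats the growth of
the cost per level, and it is below the `1 / 81` per level needed for total failure `1 / t²`. -/
def quickLoop : Cmd :=
  .loop (.and found0 (.wlt (.op .mul span10 span10) (.op .mul (.const 9) (.reg 0))))
    (.seq (rep sweep 7) (.cond found0 triple10 nop))

/-- The search whose expected time is small when there are many improving elements. -/
def quickSearch : Cmd := .seq (.seq (.wset 17 (.const 0)) (.wset 10 (.const 0))) quickLoop

/-! ### Calculus of randomized searches -/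

section Search

variable {α : Type u} [LinearOrder α] {M : Machine α} {d E b : ℕ} {X : Finset (Fin M.N)}

/-- Size assumptions. -/
structure Fits (M : Machine α) (d E b : ℕ) : Prop where
  N_pos : 1 ≤ M.N
  d_pos : 1 ≤ d
  d_le : d ≤ M.N
  E_pos : 1 ≤ E
  tF_pos : 1 ≤ M.tF
  tG_pos : 1 ≤ M.tG
  b_le : b ≤ M.N
  word : (64 * M.N * E) ^ 6 < 2 ^ M.w

theorem Fits.lt_word (h : Fits M d E b) : 1000 * M.N < 2 ^ M.w := by
  refine lt_of_le_of_lt ?_ h.word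
  have h1 : M.N ≤ M.N * E := Nat.le_mul_of_pos_right _ h.E_pos
  have h2 : M.N * E ≤ (M.N * E) ^ 6 := Nat.le_self_pow (by norm_num) _
  calc 1000 * M.N ≤ 64 ^ 6 * (M.N * E) ^ 6 := Nat.mul_le_mul (by norm_num) (h1.trans h2)
    _ = _ := by ring

/-- Unit of cost. -/
def unit (M : Machine α) : ℕ := 100 * (M.tF + M.tG)

/-- From every memory that represents `X` and satisfies `P`, the search `C` finds every improving
element with the same probability, and nothing (and then `Q` holds) with probability at most `p`;
its expected time is at most `c`. -/
def Search (M : Machine α) (d E b : ℕ) (X : Finset (Fin M.N)) (P Q : Store α → Prop) (C : Cmd)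
    (c p : ℝ≥0∞) : Prop :=
  ∀ (lam : ℝ≥0∞) (g : Store α → ℝ≥0∞) (k : List Cmd) (A : ℕ → ℝ≥0∞) (B : ℝ≥0∞) (s : Store α)
    (q : QState), Rep M d E b s X → s.reg 5 = 0 → P s →
    (∀ y : Fin M.N, y ∈ imp M d X → ∀ s' q', Rep M d E b s' X → s'.reg 5 = y + 1 →
      Ev M lam g k s' q' (A y)) →
    (∀ s' q', Rep M d E b s' X → s'.reg 5 = 0 → Q s' →
      Ev M lam g k s' q' (avg (imp M d X) A + B)) →
    Ev M lam g (C :: k) s q (lam * c + avg (imp M d X) A + p * B)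

variable {P P' Q Q' R : Store α → Prop} {C C₁ C₂ : Cmd} {c c' c₁ c₂ p p' p₁ p₂ : ℝ≥0∞}

theorem Search.mono (h : Search M d E b X P Q C c p) (hP : ∀ s, P' s → P s)
    (hQ : ∀ s, Q s → Q' s) (hc : c ≤ c') (hp : p ≤ p') : Search M d E b X P' Q' C c' p' := by
  intro lam g k A B s q h1 h2 h3 h4 h5
  refine (h lam g k A B s q h1 h2 (hP s h3) h4 fun s' q' a1 a2 a3 => h5 s' q' a1 a2 (hQ s' a3)).mono ?_
  gcongr

theorem avg_mono {N : ℕ} (S : Finset (Fin N)) {A A' : ℕ → ℝ≥0∞} (h : ∀ y, A y ≤ A' y) :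
    avg S A ≤ avg S A' := by
  rw [avg, avg]
  gcongr
  exact h _

theorem Search.exec_seq {n : ℕ} (h₁ : ∀ s q, Rep M d E b s X → s.reg 5 = 0 → P s →
    ∃ s' q', Exec M C₁ s q s' q' n ∧ Agree s s' ∧ s'.reg 5 = 0 ∧ Q s')
    (h₂ : Search M d E b X Q R C₂ c p) : Search M d E b X P R (.seq C₁ C₂) (n + c) p := by
  intro lam g k A B s q a1 a2 a3 a4 a5
  obtain ⟨s', q', e1, e2, e3, e4⟩ := h₁ s q a1 a2 a3
  refine (Ev.seq (e1 _ _ _ _ (h₂ lam g k A B s' q' (a1.congr e2) e3 e4 a4 a5))).mono (le_of_eq ?_)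
  ring

theorem Search.of_exec {n : ℕ} (h : ∀ s q, Rep M d E b s X → s.reg 5 = 0 → P s →
    ∃ s' q', Exec M C s q s' q' n ∧ Agree s s' ∧ s'.reg 5 = 0 ∧ Q s') :
    Search M d E b X P Q C n 1 := by
  intro lam g k A B s q a1 a2 a3 _ a5
  obtain ⟨s', q', e1, e2, e3, e4⟩ := h s q a1 a2 a3
  refine (e1 _ _ _ _ (a5 s' q' (a1.congr e2) e3 e4)).mono (le_of_eq ?_)
  ring

/-- Both searches are uniform on success, so the failure branch of the first may again be charged
the same average plus an extra term. Therefore costs add with weight `p₁`, and failure probabilities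
multiply. The constants `6` and `4` pay the test of `found0` after success and after failure. -/
theorem Search.seq (h₁ : Search M d E b X P Q C₁ c₁ p₁) (h₂ : Search M d E b X Q R C₂ c₂ p₂) :
    Search M d E b X P R (.seq C₁ (.cond found0 C₂ nop)) (c₁ + 6 + p₁ * (c₂ + 4)) (p₁ * p₂) := by
  intro lam g k A B s q a1 a2 a3 a4 a5
  refine (Ev.seq (h₁ lam g _ (fun y => lam * 6 + A y) (lam * 4 + lam * c₂ + p₂ * B) s q a1 a2 a3
    ?_ ?_)).mono ?_
  · intro y hy s' q' b1 b2
    refine (Ev.cond_neg ?_ (Exec.wset M s' q' 5 (.reg 5) lam g k (A y) ?_)).mono (le_of_eq ?_)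
    · simp [found0, BExpr.Holds, WExpr.eval, b2]
    · simp only [WExpr.eval, setReg_self]
      exact a4 y hy s' q' b1 b2
    · simp [found0, BExpr.cost, WExpr.cost]
      rw [← add_assoc, ← mul_add]
      norm_num
  · intro s' q' b1 b2 b3
    refine (Ev.cond_pos ?_ (h₂ lam g k A B s' q' b1 b2 b3 a4 a5)).mono ?_
    · simp [found0, BExpr.Holds, WExpr.eval, b2]
    · have : avg (imp M d X) A ≤ avg (imp M d X) (fun y => lam * 6 + A y) :=
        avg_mono _ fun y => le_add_self
      simp [found0, BExpr.cost, WExpr.cost]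
      calc _ = avg (imp M d X) A + (lam * 4 + lam * c₂ + p₂ * B) := by ring
        _ ≤ _ := by gcongr
  · calc _ ≤ lam * c₁ + (lam * 6 + avg (imp M d X) A) + p₁ * (lam * 4 + lam * c₂ + p₂ * B) := by
          gcongr; exact avg_add_const_le _ _ _
      _ = _ := by ring

/-- The loop test is paid before the body and again after a success; after a failure the second test
belongs to `c₂`. -/
theorem Search.loop_pos {bx : BExpr} (hb : ∀ s, Rep M d E b s X → P s → bx.Holds M s)
    (h₁ : Search M d E b X P Q C c₁ p₁)
    (h₂ : Search M d E b X Q R (.loop (.and found0 bx) C) c₂ p₂) :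
    Search M d E b X P R (.loop (.and found0 bx) C) (c₁ + 2 * (bx.cost M + 5) + p₁ * c₂)
      (p₁ * p₂) := by
  intro lam g k A B s q a1 a2 a3 a4 a5
  have hcost : (BExpr.and found0 bx).cost M + 1 = bx.cost M + 5 := by
    simp [found0, BExpr.cost, WExpr.cost]; omega
  have hh : (BExpr.and found0 bx).Holds M s :=
    ⟨by simp [found0, BExpr.Holds, WExpr.eval, a2], hb s a1 a3⟩
  refine (Ev.loop_pos hh (h₁ lam g _ (fun y => lam * (bx.cost M + 5 : ℕ) + A y)
    (lam * c₂ + p₂ * B) s q a1 a2 a3 ?_ ?_)).mono ?_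
  · intro y hy s' q' b1 b2
    rw [← hcost]
    exact Ev.loop_neg (by simp [found0, BExpr.Holds, WExpr.eval, b2]) (a4 y hy s' q' b1 b2)
  · intro s' q' b1 b2 b3
    refine (h₂ lam g k A B s' q' b1 b2 b3 a4 a5).mono ?_
    have : avg (imp M d X) A ≤ avg (imp M d X) (fun y => lam * (bx.cost M + 5 : ℕ) + A y) :=
      avg_mono _ fun y => le_add_self
    calc _ = avg (imp M d X) A + (lam * c₂ + p₂ * B) := by ring
      _ ≤ _ := by gcongr
  · rw [hcost]
    calc _ ≤ lam * (bx.cost M + 5 : ℕ) + (lam * c₁ + (lam * (bx.cost M + 5 : ℕ) +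
            avg (imp M d X) A) + p₁ * (lam * c₂ + p₂ * B)) := by
          gcongr; exact avg_add_const_le _ _ _
      _ = _ := by push_cast; ring

theorem Search.loop_neg {bx : BExpr} (hb : ∀ s, Rep M d E b s X → P s → ¬ bx.Holds M s) :
    Search M d E b X P P (.loop (.and found0 bx) C) (bx.cost M + 5) 1 := by
  have hcost : (BExpr.and found0 bx).cost M + 1 = bx.cost M + 5 := by
    simp [found0, BExpr.cost, WExpr.cost]; omega
  have := Search.of_exec (M := M) (d := d) (E := E) (b := b) (X := X) (P := P) (Q := P)
    (C := .loop (.and found0 bx) C) (n := bx.cost M + 5) fun s q h1 h2 h3 =>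
      ⟨s, q, hcost ▸ Exec.loop_neg fun h => hb s h1 h3 h.2, Agree.refl s, h2, h3⟩
  exact_mod_cast this

theorem Search.rep (h : Search M d E b X P P C c p) (hp : p ≤ 1) (n : ℕ) :
    Search M d E b X P P (rep C n) (n * (c + 12) + 2) (p ^ n) := by
  induction n with
  | zero =>
    rw [pow_zero]
    refine (Search.of_exec (n := 2) fun s q h1 h2 h3 => ⟨s, q, ?_, Agree.refl s, h2, h3⟩).mono
      (fun _ h => h) (fun _ h => h) (by simp) le_rfl
    have := Exec.wset M s q 5 (.reg 5)
    rw [WExpr.eval, setReg_self] at this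
    exact this
  | succ n ih =>
    rw [pow_succ']
    refine (h.seq ih).mono (fun _ h => h) (fun _ h => h) ?_ le_rfl
    calc _ ≤ c + 6 + 1 * (n * (c + 12) + 2 + 4) := by gcongr
      _ = (((n + 1 : ℕ) : ℝ≥0∞)) * (c + 12) := by push_cast; ring
      _ ≤ _ := le_self_add

/-- The counters. -/
def Ctr (k K n : ℕ) (s : Store α) : Prop := s.reg 8 = k ∧ s.reg 10 = K ∧ s.reg 17 = n

theorem improves_cost (M : Machine α) (e : WExpr) :
    (improves e).cost M = 6 * e.cost M + 2 * M.tF + 3 * M.tG + 14 := by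
  simp only [improves, rival, BExpr.cost, VExpr.cost, WExpr.cost]
  omega

theorem flip_holds (hf : Fits M d E b) {s : Store α} (h : Rep M d E b s X) {z : ℕ}
    (hz : z < 2 ^ M.w) : (BExpr.and (.wlt (.op .div (.reg 7) (.reg 0)) (.reg 12))
      (improves (.op .mod (.reg 7) (.reg 0)))).Holds M (s.setReg 7 z) ↔
    Mem (imp M d X) (z % M.N) ∧ z / M.N < s.reg 12 := by
  have hw := hf.lt_word
  have hN := hf.N_pos
  have h7 : (WExpr.reg 7).eval M (s.setReg 7 z) = z := by simp [WExpr.eval]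
  obtain ⟨nd, hl, -⟩ := id h
  have h0 : (WExpr.reg 0).eval M (s.setReg 7 z) = M.N := by simp [WExpr.eval, hl.reg0]
  have e1 := improves_holds (h.congr ((Agree.refl s).setReg (r := 7) (n := z) (by norm_num)))
    hf.d_pos (by omega) (eval_mod h7 h0 hz) (Nat.mod_lt _ (by omega))
  have e2 := eval_div h7 h0 hz
  rw [← e1, BExpr.Holds, BExpr.Holds, e2, and_comm]
  simp [WExpr.eval]

theorem flip_cost (hf : Fits M d E b) : 2 * (BExpr.and (.wlt (.op .div (.reg 7) (.reg 0)) (.reg 12))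
      (improves (.op .mod (.reg 7) (.reg 0)))).cost M + 1 + 1 ≤ unit M := by
  simp only [BExpr.cost, WExpr.cost, improves_cost, unit]
  have := hf.tF_pos
  have := hf.tG_pos
  omega

theorem exec_flip_all (hf : Fits M d E b) {s : Store α} {q : QState} (h : Rep M d E b s X) {m : ℕ}
    {a g : ℝ} (hm : m ≠ 0) (hmw : m * M.N < 2 ^ M.w) (hR : s.reg 12 = m)
    (hq : Amp q (m * M.N) (twoLevel (imp M d X) a fun _ => g)) :
    ∃ q', Exec M flip s q s q' (unit M) ∧ Amp q' (m * M.N)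
      (twoLevel (imp M d X) (2 * flipMean M.N (imp M d X).card a g 1 - a)
        fun _ => 2 * flipMean M.N (imp M d X).card a g 1 + g) := by
  have hN := hf.N_pos
  exact ⟨_, ((Exec.phase M s q 7 _).seq (Exec.diffuse M s _)).mono (flip_cost hf),
    Amp.flip_all (by omega) hm hq fun z hz => by rw [flip_holds hf h (hz.trans hmw), hR]⟩

theorem exec_flip (hf : Fits M d E b) {s : Store α} {q : QState} (h : Rep M d E b s X) {m : ℕ}
    {a g : ℝ} (hm : m ≠ 0) (hmw : m * M.N < 2 ^ M.w) (hR : s.reg 12 ≤ m)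
    (hq : Amp q (m * M.N) (twoLevel (imp M d X) a fun _ => g)) :
    ∃ q', Exec M flip s q s q' (unit M) ∧ Amp q' (m * M.N)
      (twoLevel (imp M d X) (2 * flipMean M.N (imp M d X).card a g ((s.reg 12 : ℕ) / m) - a)
        fun r => 2 * flipMean M.N (imp M d X).card a g ((s.reg 12 : ℕ) / m) +
          if r < s.reg 12 then g else -g) := by
  have hN := hf.N_pos
  exact ⟨_, ((Exec.phase M s q 7 _).seq (Exec.diffuse M s _)).mono (flip_cost hf),
    Amp.flip (by omega) hm hR hq fun z hz => flip_holds hf h (hz.trans hmw)⟩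

/-- The measured element is tested classically, so only improving elements are ever reported; the
distribution of the outcome is `Amp.sum_outcome`. -/
theorem ev_finish (hf : Fits M d E b) {s : Store α} {q : QState} (h : Rep M d E b s X) {m : ℕ}
    {a : ℝ} {g : ℕ → ℝ} (hm : m ≠ 0) (hmw : m * M.N < 2 ^ M.w)
    (hq : Amp q (m * M.N) (twoLevel (imp M d X) a g)) (h5 : s.reg 5 = 0)
    {lam : ℝ≥0∞} {gg : Store α → ℝ≥0∞} {k : List Cmd} {A : ℕ → ℝ≥0∞} {B : ℝ≥0∞}
    (h1 : ∀ y : Fin M.N, y ∈ imp M d X → ∀ s' q', Rep M d E b s' X → s'.reg 5 = y + 1 →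
      Ev M lam gg k s' q' (A y))
    (h2 : ∀ s' q', Rep M d E b s' X → s'.reg 5 = 0 → (∀ r, 8 ≤ r → s'.reg r = s.reg r) →
      Ev M lam gg k s' q' (avg (imp M d X) A + B)) :
    Ev M lam gg (finish :: k) s q (lam * (unit M : ℕ) + avg (imp M d X) A +
      ENNReal.ofReal ((M.N - (imp M d X).card) / M.N * a ^ 2) * B) := by
  classical
  have hw := hf.lt_word
  have hN := hf.N_pos
  obtain ⟨nd, hl, -⟩ := id h
  set c := (improves (.reg 7)).cost M + 10 with hc
  have key : ∀ z : Fin q.dim, Ev M lam gg (.seq (.wset 7 (.op .mod (.reg 7) (.reg 0)))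
      (.cond (improves (.reg 7)) (.wset 5 (.op .add (.reg 7) (.const 1))) nop) :: k)
      (s.setReg 7 z) (QState.basis z)
      (lam * c + if Mem (imp M d X) (z % M.N) then A (z % M.N) else avg (imp M d X) A + B) := by
    intro z
    have hz : (z : ℕ) < m * M.N := lt_of_lt_of_eq z.2 hq.1
    have h7 : (WExpr.reg 7).eval M (s.setReg 7 z) = z := by simp [WExpr.eval]
    have h0 : (WExpr.reg 0).eval M (s.setReg 7 z) = M.N := by simp [WExpr.eval, hl.reg0]
    have x1 := Exec.wset_of (q := QState.basis z) (r := 7) (eval_mod h7 h0 (hz.trans hmw))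
    set s₁ := (s.setReg 7 z).setReg 7 (z % M.N) with hs₁
    have hag : Agree s s₁ :=
      ((Agree.refl s).setReg (r := 7) (by norm_num)).setReg (r := 7) (by norm_num)
    have hlt : (z : ℕ) % M.N < M.N := Nat.mod_lt _ (by omega)
    have h7' : (WExpr.reg 7).eval M s₁ = z % M.N := by simp [WExpr.eval, hs₁]
    have e1 := improves_holds (h.congr hag) hf.d_pos (by omega) h7' hlt
    refine Ev.seq ?_
    split_ifs with hmem
    · refine (x1 _ _ _ _ (Ev.cond_pos (e1.2 hmem) (Exec.wset_of (eval_add h7' (eval_const (by omega))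
        (by omega)) _ _ _ _ (h1 ⟨z % M.N, hlt⟩ ((mem_val (⟨z % M.N, hlt⟩ : Fin M.N)).1 hmem) _ _ (h.congr (hag.setReg (by norm_num)))
          (by simp))))).mono ?_
      simp only [WExpr.cost, hc]
      rw [← add_assoc, ← add_assoc, ← mul_add, ← mul_add]
      gcongr
      norm_cast
      omega
    · refine (x1 _ _ _ _ (Ev.cond_neg (fun h => hmem (e1.1 h)) (Exec.wset M s₁ _ 5 (.reg 5) _ _ _ _
        (h2 _ _ (h.congr (hag.setReg (by norm_num))) ?_ ?_)))).mono ?_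
      · simp [WExpr.eval, hs₁, h5]
      · intro r hr
        simp [hs₁, show r ≠ 5 by omega, show r ≠ 7 by omega]
      · simp only [WExpr.cost, hc]
        rw [← add_assoc, ← add_assoc, ← mul_add, ← mul_add]
        gcongr
        norm_cast
        omega
  refine (Ev.seq (Ev.meas key)).mono ?_
  simp only [mul_add, Finset.sum_add_distrib]
  rw [Amp.sum_outcome (by omega) hm hq, ← Finset.sum_mul]
  have htot : ∑ z, ENNReal.ofReal (‖q.vec z‖ ^ 2) = 1 := by
    rw [← ENNReal.ofReal_sum_of_nonneg fun _ _ => by positivity, ← EuclideanSpace.norm_sq_eq,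
      q.norm_vec]
    simp
  rw [htot, one_mul, ← add_assoc, ← add_assoc, ← mul_add]
  gcongr
  norm_cast
  rw [hc, improves_cost, unit]
  have := hf.tF_pos
  have := hf.tG_pos
  simp only [WExpr.cost]
  omega

end Search

/-! ### The quick search, level by level -/

section QuickSearch

variable {α : Type u} [LinearOrder α] {M : Machine α} {d E b : ℕ} {X : Finset (Fin M.N)}

theorem Rep.reg_zero {s : Store α} (h : Rep M d E b s X) : s.reg 0 = M.N := by
  obtain ⟨nd, hl, -⟩ := h; exact hl.reg0

theorem Fits.two_hundred_le (hf : Fits M d E b) : 200 ≤ unit M := by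
  have := hf.tF_pos
  have := hf.tG_pos
  unfold unit
  omega

theorem card_imp_le (M : Machine α) (d : ℕ) (X : Finset (Fin M.N)) : (imp M d X).card ≤ M.N := by
  simpa using Finset.card_le_univ (imp M d X)

/-- Ordinary Grover search: there is a single index, `m = 1`. -/
theorem exec_flipLoop (hf : Fits M d E b) {k : ℕ} (hk : k < 2 ^ M.w) (j : ℕ) {i : ℕ}
    (hij : i + j = k) {s : Store α} {q : QState} (h : Rep M d E b s X) (h8 : s.reg 8 = k)
    (h9 : s.reg 9 = i) (h12 : s.reg 12 = 1)
    (hq : Amp q (1 * M.N) (twoLevel (imp M d X) (groverAmp M.N (imp M d X).card i).1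
      fun _ => (groverAmp M.N (imp M d X).card i).2)) :
    ∃ q', Exec M flipLoop s q (s.setReg 9 k) q' (2 * unit M * j + 4) ∧
      Amp q' (1 * M.N) (twoLevel (imp M d X) (groverAmp M.N (imp M d X).card k).1
        fun _ => (groverAmp M.N (imp M d X).card k).2) := by
  have hw := hf.lt_word
  have hU := hf.two_hundred_le
  have hc : ∀ s : Store α, (BExpr.wlt (.reg 9) (.reg 8)).Holds M s ↔ s.reg 9 < s.reg 8 := by
    intro s; simp [BExpr.Holds, WExpr.eval]
  induction j generalizing i s q with
  | zero =>
    have : i = k := by omega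
    subst this
    refine ⟨q, ?_, hq⟩
    rw [← h9, setReg_self]
    exact Exec.loop_neg (by rw [hc]; omega)
  | succ j ih =>
    obtain ⟨q₁, e1, hq1⟩ := exec_flip_all hf h one_ne_zero (by omega) h12 hq
    have e2 := Exec.wset_of (M := M) (q := q₁) (r := 9) (e₁ := .op .add (.reg 9) (.const 1))
      (s := s) (a := i + 1) (eval_add h9 (eval_const (by omega)) (by omega))
    obtain ⟨q₂, e3, hq2⟩ := ih (i := i + 1) (by omega) (s := s.setReg 9 (i + 1)) (q := q₁)
      (h.congr ((Agree.refl s).setReg (by norm_num))) (by simpa using h8) (by simp)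
      (by simpa using h12) hq1
    refine ⟨q₂, ?_, hq2⟩
    have e4 := Exec.loop_pos ((hc s).2 (by omega)) (e1.seq e2) e3
    have : (s.setReg 9 (i + 1)).setReg 9 k = s.setReg 9 k := by
      simp [Store.setReg]
    rw [this] at e4
    refine e4.mono ?_
    simp only [BExpr.cost, WExpr.cost]
    rw [Nat.mul_succ]
    omega

theorem search_attempt (hf : Fits M d E b) {k K n : ℕ} (hk : k < 2 ^ M.w) :
    Search M d E b X (Ctr k K n) (Ctr k K n) attempt ((2 * unit M * (k + 1) : ℕ))
      (groverFail M.N (imp M d X).card k) := by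
  have hw := hf.lt_word
  have hU := hf.two_hundred_le
  have hN := hf.N_pos
  intro lam g kk A B s q h h5 hctr h1 h2
  obtain ⟨h8, h10, h17⟩ := hctr
  set s₁ := (s.setReg 12 1).setReg 9 0 with hs₁
  have hag : Agree s s₁ := ((Agree.refl s).setReg (by norm_num)).setReg (by norm_num)
  have x1 := Exec.wset_of (M := M) (s := s) (q := q) (r := 12) (e₁ := .const 1) (a := 1)
    (eval_const (by omega))
  have x2 := Exec.prep M (s.setReg 12 1) q (.reg 0)
  have hprep : (WExpr.reg 0).eval M (s.setReg 12 1) = 1 * M.N := by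
    simp [WExpr.eval, h.reg_zero]
  have x3 := Exec.wset_of (M := M) (s := s.setReg 12 1) (r := 9) (e₁ := .const 0) (a := 0)
    (q := q.prep ((WExpr.reg 0).eval M (s.setReg 12 1))) (eval_const (by omega))
  obtain ⟨q₂, x4, hq⟩ := exec_flipLoop hf hk k (i := 0) (by omega) (s := s₁)
    (q := q.prep ((WExpr.reg 0).eval M (s.setReg 12 1))) (h.congr hag) (by simp [hs₁, h8])
    (by simp [hs₁]) (by simp [hs₁]) (by
      rw [hprep]
      have := Amp.prep q (K := 1 * M.N) (by omega)
      refine ⟨this.1, fun z => ?_⟩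
      rw [this.2 z]
      simp [twoLevel, groverAmp])
  have x5 := ev_finish hf (h.congr (hag.setReg (r := 9) (n := k) (by norm_num))) one_ne_zero
    (by omega) hq (by simp [hs₁, h5]) (k := kk) (A := A) (B := B) h1 fun s' q' a1 a2 a3 =>
      h2 s' q' a1 a2 ⟨by rw [a3 8 le_rfl]; simp [hs₁, h8],
        by rw [a3 10 (by norm_num)]; simp [hs₁, h10], by rw [a3 17 (by norm_num)]; simp [hs₁, h17]⟩
  refine (Ev.seq (x1 _ _ _ _ (Ev.seq (x2 _ _ _ _ (Ev.seq (x3 _ _ _ _ (Ev.seq (x4 _ _ _ _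
    x5)))))))).mono ?_
  rw [← groverFail]
  simp only [WExpr.cost]
  calc _ = lam * ((1 + 1 + (1 + 1) + (1 + 1) + (2 * unit M * k + 4) + unit M : ℕ)) +
        avg (imp M d X) A + groverFail M.N (imp M d X).card k * B := by push_cast; ring
    _ ≤ _ := by
        gcongr
        rw [Nat.mul_succ]
        omega

/-- The iteration numbers `0, 1, 4, 13, …`. -/
def third (i : ℕ) : ℕ := (3 ^ i - 1) / 2

theorem two_mul_third (i : ℕ) : 2 * third i + 1 = 3 ^ i := by
  have h : 3 ^ i % 2 = 1 := by rw [Nat.pow_mod]; simp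
  unfold third
  generalize 3 ^ i = x at h ⊢
  omega

theorem third_succ (i : ℕ) : third (i + 1) = 3 * third i + 1 := by
  have h1 := two_mul_third i
  have h2 := two_mul_third (i + 1)
  rw [pow_succ] at h2
  omega

theorem third_le_iff (i j : ℕ) : third i ≤ third j ↔ i ≤ j := by
  have h1 := two_mul_third i
  have h2 := two_mul_third j
  rw [← Nat.pow_le_pow_iff_right (a := 3) (by norm_num) (n := i), ← h1, ← h2]
  omega

/-- The counters that are not changed by a sweep. -/
def KN (K n : ℕ) (s : Store α) : Prop := s.reg 10 = K ∧ s.reg 17 = n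

/-- Each attempt starts from a fresh superposition, so the failure probabilities multiply; the costs
form a geometric sum. -/
theorem search_sweepLoop (hf : Fits M d E b) {L n : ℕ} (hL : 2 * 3 ^ L < 2 ^ M.w) (j : ℕ) {i : ℕ}
    (hij : i + j = L + 1) :
    Search M d E b X (Ctr (third i) (third L) n) (KN (third L) n) sweepLoop
      ((3 * unit M * (∑ l ∈ Finset.Ico i (L + 1), 3 ^ l) + 9 : ℕ))
      (∏ l ∈ Finset.Ico i (L + 1), groverFail M.N (imp M d X).card (third l)) := by
  have hw := hf.lt_word
  have hU := hf.two_hundred_le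
  have hN := hf.N_pos
  have hbx : ∀ (i : ℕ) (s : Store α), Ctr (third i) (third L) n s →
      ((BExpr.not (.wlt (.reg 10) (.reg 8))).Holds M s ↔ i ≤ L) := by
    intro i s h
    simp only [BExpr.Holds, WExpr.eval, h.1, h.2.1]
    rw [not_lt, third_le_iff]
  have hcost : (BExpr.not (.wlt (.reg 10) (.reg 8))).cost M = 4 := by simp [BExpr.cost, WExpr.cost]
  induction j generalizing i with
  | zero =>
    have hi : i = L + 1 := by omega
    subst hi
    have := Search.loop_neg (M := M) (d := d) (E := E) (b := b) (X := X)
      (P := Ctr (third (L + 1)) (third L) n)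
      (C := .seq attempt (.cond found0 (.wset 8 (.op .add (.op .mul (.const 3) (.reg 8))
        (.const 1))) nop)) fun s _ h => (not_congr (hbx _ s h)).2 (by omega)
    rw [hcost] at this
    refine this.mono (fun _ h => h) (fun s h => h.2) ?_ ?_
    · simp; norm_num
    · simp
  | succ j ih =>
    have hiL : i ≤ L := by omega
    have h3 : 3 ^ i ≤ 3 ^ L := Nat.pow_le_pow_right (by norm_num) hiL
    have h2t := two_mul_third i
    have s1 := search_attempt (X := X) hf (k := third i) (K := third L) (n := n) (by omega)
    have s2 : Search M d E b X (Ctr (third i) (third L) n) (Ctr (third (i + 1)) (third L) n)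
        (.wset 8 (.op .add (.op .mul (.const 3) (.reg 8)) (.const 1))) ((6 : ℕ)) 1 := by
      refine Search.of_exec fun s q h h5 hc => ⟨_, q, Exec.wset_of (a := third (i + 1)) ?_,
        (Agree.refl s).setReg (by norm_num), by simpa using h5, ?_⟩
      · rw [third_succ]
        exact eval_add (eval_mul (eval_const (by omega)) hc.1 (by omega)) (eval_const (by omega))
          (by omega)
      · exact ⟨by simp, by simpa using hc.2.1, by simpa using hc.2.2⟩
    have s3 := Search.loop_pos (fun s _ h => (hbx i s h).2 hiL) (s1.seq s2) (ih (by omega))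
    have hp := groverFail_le_one (N := M.N) (t := (imp M d X).card) (by omega) (card_imp_le M d X)
      (third i)
    refine s3.mono (fun _ h => h) (fun _ h => h) ?_ ?_
    · rw [hcost, mul_one]
      calc _ ≤ ((2 * unit M * (third i + 1) : ℕ) : ℝ≥0∞) + 6 + 1 * ((6 : ℕ) + 4) +
            2 * ((4 : ℕ) + 5) + 1 * ((3 * unit M * (∑ l ∈ Finset.Ico (i + 1) (L + 1), 3 ^ l) + 9 : ℕ)) := by
            gcongr
        _ = ((2 * unit M * (third i + 1) + 34 +
            (3 * unit M * (∑ l ∈ Finset.Ico (i + 1) (L + 1), 3 ^ l) + 9) : ℕ) : ℝ≥0∞) := by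
            push_cast; ring
        _ ≤ _ := by
            rw [Finset.sum_eq_sum_Ico_succ_bot (show i < L + 1 by omega)]
            norm_cast
            have : 2 * unit M * (third i + 1) + 34 ≤ 3 * unit M * 3 ^ i := by
              have : third i + 1 ≤ 3 ^ i := by have := Nat.one_le_pow i 3 (by norm_num); omega
              have h1 : 2 * unit M * (third i + 1) ≤ 2 * unit M * 3 ^ i := Nat.mul_le_mul_left _ this
              have h2 : 200 * 1 ≤ unit M * 3 ^ i := Nat.mul_le_mul hU (Nat.one_le_pow _ _ (by norm_num))
              nlinarith
            rw [mul_add (3 * unit M)]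
            omega
    · rw [mul_one, Finset.prod_eq_prod_Ico_succ_bot (show i < L + 1 by omega)]

theorem two_mul_sum_pow_le (i j : ℕ) : 2 * ∑ l ∈ Finset.Ico i j, 3 ^ l ≤ 3 ^ j := by
  induction j with
  | zero => simp
  | succ j ih =>
    rcases Nat.lt_or_ge j i with h | h
    · rw [Finset.Ico_eq_empty (by omega)]; simp
    · rw [Finset.sum_Ico_succ_top h, pow_succ]
      omega

/-- The alternative `1 ≤ p` serves levels too low for any guarantee, where only the cost matters. -/
theorem search_sweep (hf : Fits M d E b) {L n : ℕ} (hL : 2 * 3 ^ L < 2 ^ M.w) {p : ℝ≥0∞}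
    (hp : (1 ≤ p) ∨ (1 / 2 ≤ p ∧ M.N ≤ 9 ^ L * (imp M d X).card)) :
    Search M d E b X (KN (third L) n) (KN (third L) n) sweep ((5 * unit M * 3 ^ L : ℕ)) p := by
  have hU := hf.two_hundred_le
  have hN := hf.N_pos
  have hw := hf.lt_word
  have s1 : ∀ (s : Store α) (q : QState), Rep M d E b s X → s.reg 5 = 0 → KN (third L) n s →
      ∃ s' q', Exec M (.wset 8 (.const 0)) s q s' q' 2 ∧ Agree s s' ∧ s'.reg 5 = 0 ∧
        Ctr (third 0) (third L) n s' := by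
    intro s q h h5 hk
    refine ⟨_, q, Exec.wset_of (eval_const (a := 0) (by omega)), (Agree.refl s).setReg (by norm_num),
      by simpa using h5, ?_⟩
    exact ⟨by simp [third], by simpa using hk.1, by simpa using hk.2⟩
  have hone : ∀ l, groverFail M.N (imp M d X).card (third l) ≤ 1 := fun l =>
    groverFail_le_one (by omega) (card_imp_le M d X) _
  refine (Search.exec_seq s1 (search_sweepLoop hf hL (L + 1) (i := 0) (by omega))).mono
    (fun _ h => h) (fun _ h => h) ?_ ?_
  · norm_cast
    have h1 := two_mul_sum_pow_le 0 (L + 1)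
    have h2 : 200 * 1 ≤ unit M * 3 ^ L := Nat.mul_le_mul hU (Nat.one_le_pow _ _ (by norm_num))
    have h3 := Nat.mul_le_mul_left (3 * unit M) h1
    rw [pow_succ] at h3
    nlinarith
  · rcases hp with hp | ⟨hp, hL⟩
    · exact (Finset.prod_le_one' fun l _ => hone l).trans hp
    · obtain ⟨i, hi, hi'⟩ := exists_groverFail_le_half (N := M.N) (by omega)
        (card_imp_le M d X) hL
      refine le_trans ?_ ((hi' (third i) (two_mul_third i)).trans hp)
      rw [← Finset.mul_prod_erase _ _ (show i ∈ Finset.Ico 0 (L + 1) by simp; omega)]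
      exact mul_le_of_le_one_right' (Finset.prod_le_one' fun l _ => hone l)

theorem quick_holds (hf : Fits M d E b) {L : ℕ} (hL : 9 ^ L < 100 * M.N) {s : Store α}
    (h : Rep M d E b s X) (hs : KN (third L) 0 s) :
    (BExpr.wlt (.op .mul span10 span10) (.op .mul (.const 9) (.reg 0))).Holds M s ↔
      9 ^ L < 9 * M.N := by
  have hw := hf.lt_word
  have h1 := two_mul_third L
  have h2 : 3 ^ L ≤ 9 ^ L := Nat.pow_le_pow_left (by norm_num) L
  have e1 : span10.eval M s = 3 ^ L := by
    rw [← h1]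
    exact eval_add (eval_mul (eval_const (by omega)) hs.1 (by omega)) (eval_const (by omega))
      (by omega)
  have e3 : 3 ^ L * 3 ^ L = 9 ^ L := by rw [← mul_pow]; norm_num
  have e2 := eval_mul e1 e1 (by rw [e3]; omega)
  have e4 := eval_mul (M := M) (s := s) (e₁ := .const 9) (e₂ := .reg 0)
    (eval_const (by omega)) h.reg_zero (by omega)
  rw [BExpr.Holds, e2, e4, e3]

theorem search_quickBody (hf : Fits M d E b) {L : ℕ} (hL : 9 ^ L < 9 * M.N) {p : ℝ≥0∞} (hp1 : p ≤ 1)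
    (hp : (1 ≤ p) ∨ (1 / 2 ≤ p ∧ M.N ≤ 9 ^ L * (imp M d X).card)) {Q : Store α → Prop}
    {c₂ p₂ : ℝ≥0∞} (h : Search M d E b X (KN (third (L + 1)) 0) Q quickLoop c₂ p₂) :
    Search M d E b X (KN (third L) 0) Q quickLoop ((37 * unit M * 3 ^ L : ℕ) + p ^ 7 * c₂)
      (p ^ 7 * p₂) := by
  have hw := hf.lt_word
  have hU := hf.two_hundred_le
  have h3 : 3 ^ L ≤ 9 ^ L := Nat.pow_le_pow_left (by norm_num) L
  have h2t := two_mul_third L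
  have s1 := (search_sweep (X := X) hf (n := 0) (by omega) hp).rep hp1 7
  have s2 : Search M d E b X (KN (third L) 0) (KN (third (L + 1)) 0) triple10 ((6 : ℕ)) 1 := by
    refine Search.of_exec fun s q h h5 hc => ⟨_, q, Exec.wset_of (a := third (L + 1)) ?_,
      (Agree.refl s).setReg (by norm_num), by simpa using h5, ?_⟩
    · rw [third_succ]
      exact eval_add (eval_mul (eval_const (by omega)) hc.1 (by omega)) (eval_const (by omega))
        (by omega)
    · exact ⟨by simp, by simpa using hc.2⟩
  have s3 := Search.loop_pos (fun s hr hs => (quick_holds hf (by omega) hr hs).2 hL) (s1.seq s2) h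
  refine s3.mono (fun _ h => h) (fun _ h => h) ?_ (by rw [mul_one])
  have hcost : (BExpr.wlt (.op .mul span10 span10) (.op .mul (.const 9) (.reg 0))).cost M = 15 := by
    simp [BExpr.cost, WExpr.cost, span10]
  have hp7 : p ^ 7 ≤ 1 := pow_le_one' hp1 7
  rw [hcost, mul_one]
  calc _ ≤ ((7 : ℕ) : ℝ≥0∞) * ((5 * unit M * 3 ^ L : ℕ) + 12) + 2 + 6 + 1 * ((6 : ℕ) + 4) +
        2 * ((15 : ℕ) + 5) + p ^ 7 * c₂ := by gcongr
    _ = ((7 * (5 * unit M * 3 ^ L + 12) + 2 + 6 + 10 + 40 : ℕ) : ℝ≥0∞) + p ^ 7 * c₂ := by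
        push_cast; ring
    _ ≤ _ := by
        gcongr
        have h2 : 200 * 1 ≤ unit M * 3 ^ L := Nat.mul_le_mul hU (Nat.one_le_pow _ _ (by norm_num))
        nlinarith

theorem search_quickLoop_low (hf : Fits M d E b) (j : ℕ) {L : ℕ} (hL : 9 ^ (L + j) < 81 * M.N)
    {Q : Store α → Prop} {c₂ p₂ : ℝ≥0∞}
    (h : Search M d E b X (KN (third (L + j)) 0) Q quickLoop c₂ p₂) :
    Search M d E b X (KN (third L) 0) Q quickLoop
      ((37 * unit M * ∑ l ∈ Finset.Ico L (L + j), 3 ^ l : ℕ) + c₂) p₂ := by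
  induction j generalizing L with
  | zero => simpa using h
  | succ j ih =>
    have h1 := ih (L := L + 1) (by rwa [add_assoc, add_comm 1 j]) (by rwa [add_assoc, add_comm 1 j])
    have hL' : 9 ^ L < 9 * M.N := by
      have : 9 ^ (L + 1) ≤ 9 ^ (L + (j + 1)) := Nat.pow_le_pow_right (by norm_num) (by omega)
      rw [pow_succ] at this
      omega
    refine (search_quickBody hf hL' le_rfl (Or.inl le_rfl) h1).mono (fun _ h => h) (fun _ h => h)
      ?_ (by simp)
    rw [Finset.sum_eq_sum_Ico_succ_bot (show L < L + (j + 1) by omega),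
      show L + 1 + j = L + (j + 1) by omega, one_pow, one_mul, ← add_assoc, mul_add]
    push_cast
    exact le_rfl

theorem search_quickLoop_exit (hf : Fits M d E b) {L : ℕ} (hL : 9 ^ L < 100 * M.N)
    (hL' : 9 * M.N ≤ 9 ^ L) :
    Search M d E b X (KN (third L) 0) (fun _ => True) quickLoop 20 1 := by
  have := Search.loop_neg (M := M) (d := d) (E := E) (b := b) (X := X) (P := KN (third L) 0)
    (C := .seq (rep sweep 7) (.cond found0 triple10 nop))
    fun s h hs => (not_congr (quick_holds hf hL h hs)).2 (by omega)
  refine this.mono (fun _ h => h) (fun s h => trivial) ?_ le_rfl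
  simp [BExpr.cost, WExpr.cost, span10]
  norm_num

/-- From a sufficient level onward each of the `j` levels fails with probability at most `1 / 114`,
while its cost triples, so the first level dominates. -/
theorem search_quickLoop_high (hf : Fits M d E b) (j : ℕ) {L : ℕ} (hL : 9 ^ (L + j) < 81 * M.N)
    (hL' : 9 * M.N ≤ 9 ^ (L + j)) (ht : M.N ≤ 9 ^ L * (imp M d X).card) :
    Search M d E b X (KN (third L) 0) (fun _ => True) quickLoop ((38 * unit M * 3 ^ L : ℕ))
      (114⁻¹ ^ j) := by
  have hU := hf.two_hundred_le
  have hN := hf.N_pos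
  induction j generalizing L with
  | zero =>
    rw [add_zero] at hL hL'
    refine (search_quickLoop_exit hf (by omega) hL').mono (fun _ h => h)
      (fun _ h => h) ?_ (by simp)
    have h2 : 200 * 1 ≤ unit M * 3 ^ L := Nat.mul_le_mul hU (Nat.one_le_pow _ _ (by norm_num))
    norm_cast
    nlinarith
  | succ j ih =>
    have h1 := ih (L := L + 1) (by rwa [add_assoc, add_comm 1 j]) (by rwa [add_assoc, add_comm 1 j])
      (ht.trans (Nat.mul_le_mul_right _ (Nat.pow_le_pow_right (by norm_num) (by omega))))
    have hL1 : 9 ^ L < 9 * M.N := by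
      have : 9 ^ (L + 1) ≤ 9 ^ (L + (j + 1)) := Nat.pow_le_pow_right (by norm_num) (by omega)
      rw [pow_succ] at this
      omega
    have hp : ((1 / 2 : ℝ≥0∞)) ^ 7 ≤ 114⁻¹ := by
      rw [one_div, ← ENNReal.inv_pow]
      exact ENNReal.inv_le_inv.2 (by norm_num)
    refine (search_quickBody hf hL1 (p := 1 / 2) (by simp) (Or.inr ⟨le_rfl, ht⟩) h1).mono
      (fun _ h => h) (fun _ h => h) ?_ ?_
    -- The constant reproduces itself: `38 = 37 + 3 * 38 / 114`.
    · calc _ ≤ ((37 * unit M * 3 ^ L : ℕ) : ℝ≥0∞) + 114⁻¹ * (38 * unit M * 3 ^ (L + 1) : ℕ) := by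
            gcongr
        _ = ((37 * unit M * 3 ^ L : ℕ) : ℝ≥0∞) + 114⁻¹ * (114 * (unit M * 3 ^ L : ℕ)) := by
            congr 2; push_cast; ring
        _ = _ := by
            rw [← mul_assoc, ENNReal.inv_mul_cancel (by norm_num) (by norm_num)]
            push_cast; ring
    · rw [pow_succ' (114⁻¹ : ℝ≥0∞) j]
      exact mul_le_mul' hp le_rfl

end QuickSearch
-- Time and failure of the quick search
section QuickBounds

variable {α : Type u} [LinearOrder α] {M : Machine α} {d E b : ℕ} {X : Finset (Fin M.N)}

theorem three_pow_le_of_lt {L N t : ℕ} (ht : 1 ≤ t) (h : 9 ^ L * t ≤ 9 * N) :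
    (3 : ℝ) ^ L ≤ 3 * Real.sqrt (N / t) := by
  have ht' : (0 : ℝ) < t := by exact_mod_cast ht
  refine abs_le_of_sq_le_sq' ?_ (by positivity) |>.2
  rw [mul_pow, Real.sq_sqrt (by positivity), ← pow_mul, mul_comm L 2, pow_mul]
  norm_num
  rw [← mul_div_assoc, le_div_iff₀ ht']
  exact_mod_cast h

/-- The least level that reaches about `√(N / t)` iterations; minimality loses at most a factor `9`.
-/
theorem exists_level {N t : ℕ} (ht : 1 ≤ t) (htN : t ≤ 9 * N) :
    ∃ L, N ≤ 9 ^ L * t ∧ 9 ^ L * t ≤ 9 * N ∧ ∀ i < L, 9 ^ i * t < N := by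
  classical
  have hex : ∃ L, N ≤ 9 ^ L * t := by
    refine ⟨N, ?_⟩
    calc N ≤ 9 ^ N * 1 := by rw [mul_one]; exact (Nat.lt_pow_self (by norm_num)).le
      _ ≤ _ := Nat.mul_le_mul_left _ ht
  refine ⟨Nat.find hex, Nat.find_spec hex, ?_, fun i hi => not_le.1 (Nat.find_min hex hi)⟩
  rcases Nat.eq_zero_or_pos (Nat.find hex) with h0 | h0
  · rw [h0]; omega
  · obtain ⟨j, hj⟩ : ∃ j, Nat.find hex = j + 1 := ⟨Nat.find hex - 1, by omega⟩
    have := Nat.find_min hex (m := j) (by omega)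
    rw [hj, pow_succ]
    have e : 9 ^ j * 9 * t = 9 * (9 ^ j * t) := by ring
    omega

theorem exec_resetCounters (hf : Fits M d E b) (s : Store α) (q : QState) (h5 : s.reg 5 = 0) :
    ∃ s' q', Exec M (.seq (.wset 17 (.const 0)) (.wset 10 (.const 0))) s q s' q' 4 ∧ Agree s s' ∧
      s'.reg 5 = 0 ∧ KN (third 0) 0 s' := by
  have hw := hf.lt_word
  have e : ∀ s : Store α, (WExpr.const 0).eval M s = 0 := fun s => eval_const (by omega)
  have h := (Exec.wset_of (q := q) (r := 17) (e s)).seq (Exec.wset_of (r := 10) (e (s.setReg 17 0)))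
  have ha : Agree s ((s.setReg 17 0).setReg 10 0) :=
    ((Agree.refl s).setReg (by norm_num)).setReg (by norm_num)
  have hk : KN (third 0) 0 ((s.setReg 17 0).setReg 10 0) := by
    constructor <;> simp [third]
  refine ⟨(s.setReg 17 0).setReg 10 0, q, h.mono ?_, ha, by simpa using h5, hk⟩
  simp [WExpr.cost]

/-- The last level, at which the search gives up. -/
theorem exists_last_level {N : ℕ} (hN : 1 ≤ N) : ∃ L, 9 * N ≤ 9 ^ L ∧ 9 ^ L < 81 * N := by
  classical
  have hex : ∃ L, 9 * N ≤ 9 ^ L :=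
    ⟨9 * N, (Nat.lt_pow_self (by norm_num)).le⟩
  refine ⟨Nat.find hex, Nat.find_spec hex, ?_⟩
  rcases Nat.eq_zero_or_pos (Nat.find hex) with h0 | h0
  · rw [h0]; omega
  · obtain ⟨j, hj⟩ : ∃ j, Nat.find hex = j + 1 := ⟨Nat.find hex - 1, by omega⟩
    have := Nat.find_min hex (m := j) (by omega)
    rw [hj, pow_succ]
    omega

theorem natCast_le_ofReal {n : ℕ} {x : ℝ} (h : (n : ℝ) ≤ x) : (n : ℝ≥0∞) ≤ ENNReal.ofReal x := by
  rw [← ENNReal.ofReal_natCast]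
  exact ENNReal.ofReal_le_ofReal h

/-- The search without assumption on the number of improving elements. -/
theorem search_quick_any (hf : Fits M d E b) :
    Search M d E b X (fun _ => True) (fun _ => True) quickSearch
      (ENNReal.ofReal (200 * unit M * Real.sqrt M.N)) 1 := by
  have hN := hf.N_pos
  have hU := hf.two_hundred_le
  obtain ⟨L, h1, h2⟩ := exists_last_level hN
  have s1 := search_quickLoop_low hf L (L := 0) (by simpa using h2)
    (search_quickLoop_exit (X := X) hf (L := 0 + L) (by simp; omega) (by simpa using h1))
  refine (Search.exec_seq (fun s q _ h5 _ => exec_resetCounters hf s q h5) s1).mono (fun _ h => h)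
    (fun _ h => h) ?_ le_rfl
  have e : ((4 : ℕ) : ℝ≥0∞) + ((37 * unit M * ∑ l ∈ Finset.Ico 0 (0 + L), 3 ^ l : ℕ) + 20) =
    ((4 + (37 * unit M * ∑ l ∈ Finset.Ico 0 (0 + L), 3 ^ l + 20) : ℕ) : ℝ≥0∞) := by push_cast; rfl
  rw [e]
  refine natCast_le_ofReal ?_
  have h4 : 4 + (37 * unit M * ∑ l ∈ Finset.Ico 0 (0 + L), 3 ^ l + 20) ≤ 20 * unit M * 3 ^ L := by
    have h5 := Nat.mul_le_mul_left (37 * unit M) (two_mul_sum_pow_le 0 (0 + L))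
    rw [zero_add] at h5 ⊢
    have h6 : 200 * 1 ≤ unit M * 3 ^ L := Nat.mul_le_mul hU (Nat.one_le_pow _ _ (by norm_num))
    nlinarith
  have h5 : (3 : ℝ) ^ L ≤ 9 * Real.sqrt M.N := by
    have h6 : 9 ^ L * 1 ≤ 9 * (9 * M.N) := by omega
    have := three_pow_le_of_lt le_rfl h6
    refine this.trans (le_of_eq ?_)
    push_cast
    rw [div_one, Real.sqrt_mul (by norm_num), show (9 : ℝ) = 3 ^ 2 by norm_num,
      Real.sqrt_sq (by norm_num)]
    ring
  calc _ ≤ ((20 * unit M * 3 ^ L : ℕ) : ℝ) := by exact_mod_cast h4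
    _ = 20 * unit M * 3 ^ L := by push_cast; rfl
    _ ≤ 20 * unit M * (9 * Real.sqrt M.N) := by gcongr
    _ ≤ _ := by
      have : 0 ≤ (unit M : ℝ) * Real.sqrt M.N := by positivity
      linarith

/-- The levels below the first sufficient level `i` cost a geometric sum dominated by `3 ^ i ≤ 3 √(N
/ t)`, and those above it are reached too rarely to matter. -/
theorem search_quick (hf : Fits M d E b) (ht : 1 ≤ (imp M d X).card) :
    Search M d E b X (fun _ => True) (fun _ => True) quickSearch
      (ENNReal.ofReal (200 * unit M * Real.sqrt (M.N / (imp M d X).card)))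
      (ENNReal.ofReal (1 / ((imp M d X).card : ℝ) ^ 2)) := by
  have hN := hf.N_pos
  have hU := hf.two_hundred_le
  have htN := card_imp_le M d X
  obtain ⟨L, h1, h2⟩ := exists_last_level hN
  obtain ⟨i, h3, h4, -⟩ := exists_level (N := M.N) ht (by omega)
  set t := (imp M d X).card with htdef
  obtain ⟨j, rfl⟩ : ∃ j, L = i + j := by
    refine Nat.exists_eq_add_of_le ?_
    by_contra hc
    have h6 : 9 ^ (L + 1) ≤ 9 ^ i := Nat.pow_le_pow_right (by norm_num) (by omega)
    rw [pow_succ] at h6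
    have : 9 ^ i * 1 ≤ 9 ^ i * t := Nat.mul_le_mul_left _ ht
    omega
  have s2 := search_quickLoop_high hf j h2 h1 h3
  have s1 := search_quickLoop_low hf i (L := 0) (lt_of_le_of_lt
    (Nat.pow_le_pow_right (by norm_num) (by omega)) h2) (by rw [zero_add]; exact s2)
  refine (Search.exec_seq (fun s q _ h5 _ => exec_resetCounters hf s q h5) s1).mono (fun _ h => h)
    (fun _ h => h) ?_ ?_
  · have e : ((4 : ℕ) : ℝ≥0∞) + ((37 * unit M * ∑ l ∈ Finset.Ico 0 (0 + i), 3 ^ l : ℕ) +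
        (38 * unit M * 3 ^ i : ℕ)) = ((4 + (37 * unit M * ∑ l ∈ Finset.Ico 0 (0 + i), 3 ^ l +
          38 * unit M * 3 ^ i) : ℕ) : ℝ≥0∞) := by push_cast; rfl
    rw [e]
    refine natCast_le_ofReal ?_
    have h4' : 4 + (37 * unit M * ∑ l ∈ Finset.Ico 0 (0 + i), 3 ^ l + 38 * unit M * 3 ^ i) ≤
        60 * unit M * 3 ^ i := by
      have h5 := Nat.mul_le_mul_left (37 * unit M) (two_mul_sum_pow_le 0 (0 + i))
      rw [zero_add] at h5 ⊢
      have h6 : 200 * 1 ≤ unit M * 3 ^ i := Nat.mul_le_mul hU (Nat.one_le_pow _ _ (by norm_num))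
      nlinarith
    calc _ ≤ ((60 * unit M * 3 ^ i : ℕ) : ℝ) := by exact_mod_cast h4'
      _ = 60 * unit M * 3 ^ i := by push_cast; rfl
      _ ≤ 60 * unit M * (3 * Real.sqrt (M.N / t)) := by
          gcongr; exact three_pow_le_of_lt ht h4
      _ ≤ _ := by
        have : 0 ≤ (unit M : ℝ) * Real.sqrt (M.N / t) := by positivity
        linarith
  -- The last level satisfies `9 ^ (i + j) ≥ 9 * N ≥ 9 ^ i * t`. So the failure probability `114⁻ʲ`
  -- is at most `81⁻ʲ ≤ t⁻²`.
  · have h5 : t ≤ 9 ^ j := by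
      rw [pow_add] at h1
      by_contra hc
      have : 9 ^ i * (9 ^ j + 1) ≤ 9 ^ i * t := Nat.mul_le_mul_left _ (by omega)
      have : 1 ≤ 9 ^ i := Nat.one_le_pow _ _ (by norm_num)
      nlinarith
    have ht0 : (0 : ℝ) < t := by exact_mod_cast ht
    have h6 : (114⁻¹ : ℝ≥0∞) = ENNReal.ofReal (114⁻¹) := by
      rw [ENNReal.ofReal_inv_of_pos (by norm_num)]; norm_num
    rw [h6, ← ENNReal.ofReal_pow (by norm_num)]
    refine ENNReal.ofReal_le_ofReal ?_
    rw [one_div, inv_pow]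
    refine inv_anti₀ (by positivity) ?_
    have h7 : (t : ℝ) ≤ 9 ^ j := by exact_mod_cast h5
    calc (t : ℝ) ^ 2 ≤ (9 ^ j) ^ 2 := by gcongr
      _ = 81 ^ j := by rw [← pow_mul, mul_comm, pow_mul]; norm_num
      _ ≤ _ := by gcongr; norm_num

end QuickBounds

/-! ### Integer tracking of the amplitudes and the last partial iteration -/

section Tracking

/-- Integer approximations of `Q` times the Grover amplitudes. -/
def track (N T Q : ℕ) : ℕ → ℕ × ℕ
  | 0 => (Q, Q)
  | k + 1 =>
    ((2 * (N - T) * (track N T Q k).1 - 2 * T * (track N T Q k).2) / N - (track N T Q k).1,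
     (2 * (N - T) * (track N T Q k).1 - 2 * T * (track N T Q k).2) / N + (track N T Q k).2)

/-- The next Grover iteration does not overshoot. -/
def Continues (N T Q k : ℕ) : Prop :=
  N * (track N T Q k).1 + 2 * T * (track N T Q k).2 ≤ 2 * (N - T) * (track N T Q k).1

variable {N T Q k : ℕ}

/-- An iteration preserves the weighted norm `(N - T) x² + T y²`, and rounding subtracts the same
`r` in `[0, 1]` from both coordinates, a vector of norm at most `√N`. This is the triangle
inequality; the cross term is controlled by Cauchy–Schwarz, `|N μ| ≤ k N`. -/
theorem track_error_step {N T k x y μ r : ℝ} (hN : 0 < N) (hT0 : 0 ≤ T) (hT : T ≤ N) (hk : 0 ≤ k)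
    (h : (N - T) * x ^ 2 + T * y ^ 2 ≤ k ^ 2 * N) (hμ : N * μ = (N - T) * x - T * y)
    (hr0 : 0 ≤ r) (hr1 : r ≤ 1) :
    (N - T) * (2 * μ - x - r) ^ 2 + T * (2 * μ + y - r) ^ 2 ≤ (k + 1) ^ 2 * N := by
  have hcs : (N * μ) ^ 2 ≤ (k * N) ^ 2 := by
    have h1 : N * ((N - T) * x ^ 2 + T * y ^ 2) - (N * μ) ^ 2 = T * (N - T) * (x + y) ^ 2 := by
      rw [hμ]; ring
    have h2 : 0 ≤ T * (N - T) * (x + y) ^ 2 :=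
      mul_nonneg (mul_nonneg hT0 (by linarith)) (sq_nonneg _)
    have h3 := mul_le_mul_of_nonneg_left h hN.le
    have h4 : (k * N) ^ 2 = N * (k ^ 2 * N) := by ring
    linarith
  have habs := (abs_le_of_sq_le_sq' hcs (by positivity)).1
  have hexp : (N - T) * (2 * μ - x - r) ^ 2 + T * (2 * μ + y - r) ^ 2 =
      ((N - T) * x ^ 2 + T * y ^ 2) - 2 * (r * (N * μ)) + N * r ^ 2 := by
    linear_combination (4 * μ - 2 * r) * hμ
  have h1 : r * (-(N * μ)) ≤ r * (k * N) := mul_le_mul_of_nonneg_left (by linarith) hr0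
  have h2 : r * (k * N) ≤ 1 * (k * N) := mul_le_mul_of_nonneg_right hr1 (by positivity)
  have h3 : N * r ^ 2 ≤ N * 1 := mul_le_mul_of_nonneg_left (pow_le_one₀ hr0 hr1) hN.le
  have h4 : (k + 1) ^ 2 * N = k ^ 2 * N + 2 * (k * N) + N := by ring
  rw [hexp, h4]
  linarith

/-- `Continues` says that the truncated subtractions in `track` are genuine; the division then
causes the same rounding loss in both coordinates. -/
theorem track_error (hN : N ≠ 0) (hT : T ≤ N) (k : ℕ) (hc : ∀ j < k, Continues N T Q j) :
    ((N : ℝ) - T) * ((track N T Q k).1 - Q * (groverAmp N T k).1) ^ 2 +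
      T * ((track N T Q k).2 - Q * (groverAmp N T k).2) ^ 2 ≤ k ^ 2 * N := by
  have hN' : (0 : ℝ) < N := by exact_mod_cast Nat.pos_of_ne_zero hN
  have hT' : (T : ℝ) ≤ N := by exact_mod_cast hT
  induction k with
  | zero => simp [track, groverAmp]
  | succ k ih =>
    have ih := ih fun j hj => hc j (by omega)
    have hck := hc k (by omega)
    unfold Continues at hck
    simp only [groverAmp, track, flipMean]
    generalize (track N T Q k).1 = A at *
    generalize (track N T Q k).2 = G at *
    generalize (groverAmp N T k).1 = a at *
    generalize (groverAmp N T k).2 = g at *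
    obtain ⟨V, hV⟩ : ∃ V, 2 * (N - T) * A - 2 * T * G = V := ⟨_, rfl⟩
    have hV' : N * A ≤ V := by omega
    have hVr : (V : ℝ) = 2 * (N - T) * A - 2 * T * G := by
      rw [← hV, Nat.cast_sub (by omega)]
      push_cast [Nat.cast_sub hT]
      ring
    have hAm : A ≤ V / N := (Nat.le_div_iff_mul_le (Nat.pos_of_ne_zero hN)).2 (by rwa [mul_comm])
    rw [hV]
    obtain ⟨r, hr⟩ : ∃ r : ℝ, r = (V : ℝ) / N - (V / N : ℕ) := ⟨_, rfl⟩
    have hr0 : 0 ≤ r := by rw [hr, sub_nonneg]; exact Nat.cast_div_le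
    have hr1 : r ≤ 1 := by
      have h' : (V : ℝ) / N ≤ ((V / N : ℕ) + 1) := by
        rw [div_le_iff₀ hN']
        have h3 : V ≤ (V / N + 1) * N := by
          have := Nat.div_add_mod V N
          have h4 := Nat.mod_lt V (Nat.pos_of_ne_zero hN)
          rw [add_mul, mul_comm (V / N)]
          omega
        exact_mod_cast h3
      rw [hr]
      linarith
    have e1 : ((V / N - A : ℕ) : ℝ) - Q * (2 * (((N - T) * a + T * (1 - 2 * 1) * g) / N) - a) =
        2 * (((N - T) * (A - Q * a) - T * (G - Q * g)) / N) - (A - Q * a) - r := by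
      rw [Nat.cast_sub hAm, hr, hVr]
      field_simp
      ring
    have e2 : ((V / N + G : ℕ) : ℝ) - Q * (2 * (((N - T) * a + T * (1 - 2 * 1) * g) / N) + g) =
        2 * (((N - T) * (A - Q * a) - T * (G - Q * g)) / N) + (G - Q * g) - r := by
      push_cast
      rw [hr, hVr]
      field_simp
      ring
    rw [e1, e2, Nat.cast_succ]
    exact track_error_step hN' (by positivity) hT' (by positivity) ih (by field_simp) hr0 hr1

theorem track_le (k : ℕ) :
    (track N T Q k).1 ≤ Q ∧ Q ≤ (track N T Q k).2 ∧ (track N T Q k).2 ≤ Q * (1 + 2 * k) := by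
  induction k with
  | zero => simp [track]
  | succ k ih =>
    simp only [track]
    have h : (2 * (N - T) * (track N T Q k).1 - 2 * T * (track N T Q k).2) / N ≤
        2 * (track N T Q k).1 := by
      refine Nat.div_le_of_le_mul ((Nat.sub_le _ _).trans ?_)
      calc 2 * (N - T) * (track N T Q k).1 ≤ 2 * N * (track N T Q k).1 := by gcongr; omega
        _ = _ := by ring
    have e : Q * (1 + 2 * (k + 1)) = Q * (1 + 2 * k) + 2 * Q := by ring
    rw [e]
    generalize (2 * (N - T) * (track N T Q k).1 - 2 * T * (track N T Q k).2) / N = m at *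
    generalize Q * (1 + 2 * k) = B at *
    omega

/-- The tracked bad amplitude is a natural number, while the true one, multiplied by `cos θ`, is at
most `- Q / 2`. The gap must be covered by the tracking error, which is at most `k`. -/
theorem le_of_cos_le (hN : N ≠ 0) (hT : T ≤ N) (hall : ∀ j < k, Continues N T Q j)
    (hcos : Real.cos ((2 * k + 1) * groverAngle N T) ≤ -(1 / 2)) : (Q : ℝ) ≤ 2 * k := by
  have hN0 : (0 : ℝ) < N := by exact_mod_cast Nat.pos_of_ne_zero hN
  have herr := track_error hN hT k hall
  have hcl := (groverAmp_closed (N := N) (t := T) hN hT k).1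
  have hc2 := cos_groverAngle_sq hN hT
  have hcpos : 0 ≤ Real.cos (groverAngle N T) :=
    Real.cos_arcsin_nonneg _
  generalize groverAngle N T = θ at *
  have h3 : (Q : ℝ) * Real.cos ((2 * k + 1) * θ) ≤ Q * -(1 / 2) :=
    mul_le_mul_of_nonneg_left hcos (by positivity)
  have h2 : 0 ≤ Real.cos θ * ((track N T Q k).1 : ℝ) := by positivity
  have hx2 : (Real.cos θ * ((track N T Q k).1 - Q * (groverAmp N T k).1)) ^ 2 ≤ (k : ℝ) ^ 2 := by
    rw [mul_pow, hc2, div_mul_eq_mul_div, div_le_iff₀ hN0]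
    have : 0 ≤ (T : ℝ) * ((track N T Q k).2 - Q * (groverAmp N T k).2) ^ 2 := by positivity
    linarith
  have hxJ := (abs_le_of_sq_le_sq' hx2 (by positivity)).2
  have h1 : Real.cos θ * ((track N T Q k).1 - Q * (groverAmp N T k).1) =
      Real.cos θ * (track N T Q k).1 - Q * Real.cos ((2 * k + 1) * θ) := by
    rw [← hcl]; ring
  rw [h1] at hxJ
  linarith

/-- Consecutive odd multiples of `θ` differ by at most `π / 3`, less than the length `π / 2` of the
interval; take the first one that is not below the interval. -/
theorem exists_odd_multiple {θ : ℝ} (h0 : 0 < θ) (h1 : θ ≤ Real.pi / 6) :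
    ∃ j : ℕ, 3 * Real.pi / 4 ≤ (2 * (j + 1 : ℕ) + 1) * θ ∧
      (2 * (j + 1 : ℕ) + 1) * θ ≤ 5 * Real.pi / 4 ∧ (2 * (j : ℝ) + 1) * θ < 3 * Real.pi / 4 := by
  classical
  have hpi := Real.pi_pos
  have hex : ∃ J : ℕ, 3 * Real.pi / 4 ≤ (2 * J + 1) * θ := by
    obtain ⟨n, hn⟩ := exists_nat_ge (3 * Real.pi / 4 / θ)
    refine ⟨n, ?_⟩
    rw [div_le_iff₀ h0] at hn
    have : 0 ≤ (n : ℝ) * θ := by positivity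
    linarith
  have hJ := Nat.find_spec hex
  have hmin := fun j => Nat.find_min hex (m := j)
  obtain ⟨J, hJJ⟩ : ∃ J, Nat.find hex = J := ⟨_, rfl⟩
  rw [hJJ] at hJ hmin
  rcases J with _ | j
  · rw [Nat.cast_zero] at hJ
    linarith
  · have hjlt := not_le.1 (hmin j (by omega))
    refine ⟨j, hJ, ?_, hjlt⟩
    push_cast
    have : (2 * ((j : ℝ) + 1) + 1) * θ = (2 * j + 1) * θ + 2 * θ := by ring
    linarith

/-- Overshooting is noticed after at most `2 √(N / T)` iterations. -/
theorem exists_not_continues (hN : 1 ≤ N) (hT1 : 1 ≤ T) (hT : T ≤ N) (hQ : 8 * N ≤ Q) :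
    ∃ k : ℕ, (∀ j < k, Continues N T Q j) ∧ ¬ Continues N T Q k ∧
      (k : ℝ) ≤ 2 * Real.sqrt (N / T) := by
  classical
  have hN0 : (0 : ℝ) < N := by exact_mod_cast hN
  have hT0 : (0 : ℝ) < T := by exact_mod_cast hT1
  have hS1 : 1 ≤ Real.sqrt ((N : ℝ) / T) := by
    rw [Real.one_le_sqrt, one_le_div hT0]; exact_mod_cast hT
  have hSinv : Real.sqrt ((T : ℝ) / N) = 1 / Real.sqrt ((N : ℝ) / T) := by
    rw [one_div, ← Real.sqrt_inv, inv_div]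
  have hSN : Real.sqrt ((N : ℝ) / T) ≤ N := by
    rw [Real.sqrt_le_left hN0.le, div_le_iff₀ hT0]
    have h1 : (1 : ℝ) ≤ N := by exact_mod_cast hN
    have h2 : (1 : ℝ) ≤ T := by exact_mod_cast hT1
    have h3 : (N : ℝ) * 1 ≤ N * N := mul_le_mul_of_nonneg_left h1 hN0.le
    have h4 : (N : ℝ) ^ 2 * 1 ≤ N ^ 2 * T := mul_le_mul_of_nonneg_left h2 (by positivity)
    linarith
  have hQr : (8 : ℝ) * N ≤ Q := by exact_mod_cast hQ
  have hθ := sqrt_le_groverAngle hT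
  have hθpos : 0 < groverAngle N T := lt_of_lt_of_le (Real.sqrt_pos.2 (by positivity)) hθ
  rw [hSinv] at hθ
  suffices h : ∃ k : ℕ, ¬ Continues N T Q k ∧ (k : ℝ) ≤ 2 * Real.sqrt ((N : ℝ) / T) by
    obtain ⟨k, hk, hkS⟩ := h
    have hex : ∃ k, ¬ Continues N T Q k := ⟨k, hk⟩
    refine ⟨Nat.find hex, fun j hj => not_not.1 (Nat.find_min hex hj), Nat.find_spec hex, ?_⟩
    have : Nat.find hex ≤ k := Nat.find_min' hex hk
    have : (Nat.find hex : ℝ) ≤ k := by exact_mod_cast this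
    linarith
  generalize Real.sqrt ((N : ℝ) / T) = S at *
  by_contra hno
  push Not at hno
  -- Continuing at step `0` forces `4 T ≤ N`, that is, `sin θ ≤ 1 / 2`.
  have hθ6 : groverAngle N T ≤ Real.pi / 6 := by
    have h0 : Continues N T Q 0 := by
      by_contra hc
      have := hno 0 hc
      rw [Nat.cast_zero] at this
      linarith
    have h4T : 4 * T ≤ N := by
      unfold Continues at h0
      simp only [track] at h0
      have : (N + 2 * T) * Q ≤ (2 * (N - T)) * Q := by linarith
      have := Nat.le_of_mul_le_mul_right this (by omega)
      omega
    have hpi := Real.pi_pos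
    rw [groverAngle, ← Real.arcsin_sin (x := Real.pi / 6) (by linarith) (by linarith)]
    refine Real.arcsin_le_arcsin ?_
    rw [Real.sin_pi_div_six, Real.sqrt_le_left (by norm_num), div_le_iff₀ hN0]
    have : (4 : ℝ) * T ≤ N := by exact_mod_cast h4T
    linarith
  obtain ⟨j, h1, h2, h3⟩ := exists_odd_multiple hθpos hθ6
  have hpi2 : Real.pi < 3.15 := Real.pi_lt_d2
  -- From `(2 j + 1) θ < 3 π / 4 < 2.4` and `θ ≥ 1 / S`.
  have hjS : (2 * (j : ℝ) + 1) ≤ 2.4 * S := by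
    have h4 : (2 * (j : ℝ) + 1) * (1 / S) ≤ (2 * (j : ℝ) + 1) * groverAngle N T := by gcongr
    have h5 : (2 * (j : ℝ) + 1) * (1 / S) ≤ 2.4 := by linarith
    rwa [mul_one_div, div_le_iff₀ (by linarith)] at h5
  have hJS : ((j + 1 : ℕ) : ℝ) ≤ 2 * S := by push_cast; linarith
  have hall : ∀ i < j + 1, Continues N T Q i := by
    intro i hi
    by_contra hc
    have h1 := hno i hc
    have : (i : ℝ) ≤ (j + 1 : ℕ) := by exact_mod_cast hi.le
    linarith
  have hcos : Real.cos ((2 * (j + 1 : ℕ) + 1) * groverAngle N T) ≤ -(1 / 2) := by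
    have h4 := Real.one_sub_sq_div_two_le_cos
      (x := (2 * ((j + 1 : ℕ) : ℝ) + 1) * groverAngle N T - Real.pi)
    rw [Real.cos_sub_pi] at h4
    have h5 : ((2 * ((j + 1 : ℕ) : ℝ) + 1) * groverAngle N T - Real.pi) ^ 2 ≤ 1 ^ 2 := by
      have hpi := Real.pi_pos
      exact sq_le_sq' (by linarith) (by linarith)
    linarith
  -- The conclusion `Q ≤ 2 (j + 1) ≤ 4 S ≤ 4 N` contradicts `Q ≥ 8 N`.
  have := le_of_cos_le (by omega) hT hall hcos
  linarith

/-- How many of the indices of a good element are flipped in the last iteration. -/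
def lastFlip (N T Q A G : ℕ) : ℕ := Q * (2 * (N - T) * A + 2 * T * G - N * A) / (4 * T * G)

/-- `lastFlip / Q` is the solution `x` of `2 * flipMean … x = A` for the tracked amplitudes, rounded
down. Overshooting at `x = 1` means that this solution is below `1`. -/
theorem lastFlip_le (hk : ¬ Continues N T Q k) :
    lastFlip N T Q (track N T Q k).1 (track N T Q k).2 ≤ Q := by
  unfold Continues at hk
  refine Nat.div_le_of_le_mul ?_
  rw [mul_comm]
  refine Nat.mul_le_mul_right _ ?_
  have : 2 * (2 * T * (track N T Q k).2) = 4 * T * (track N T Q k).2 := by ring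
  omega

theorem le_of_weighted_sq_le {N T k x y : ℝ} (hT1 : 1 ≤ T) (hT : T + 1 ≤ N)
    (hk : k ^ 2 * T ≤ 4 * N) (h : (N - T) * x ^ 2 + T * y ^ 2 ≤ k ^ 2 * N) :
    k ≤ 2 * N ∧ |x| ≤ 2 * N ∧ |T * y| ≤ 2 * N := by
  have hx2 := sq_nonneg x
  have hy2 := sq_nonneg y
  have hN : 0 ≤ N := by linarith
  have h1 : k ^ 2 * 1 ≤ k ^ 2 * T := mul_le_mul_of_nonneg_left hT1 (sq_nonneg _)
  have h2 : k ^ 2 * T * N ≤ 4 * N * N := mul_le_mul_of_nonneg_right hk hN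
  have h3 : N * 1 ≤ N * N := mul_le_mul_of_nonneg_left (by linarith) hN
  have h4 : k ^ 2 * 1 * N ≤ k ^ 2 * T * N := mul_le_mul_of_nonneg_right h1 hN
  have h5 : 1 * x ^ 2 ≤ (N - T) * x ^ 2 := mul_le_mul_of_nonneg_right (by linarith) hx2
  have h6 : 0 ≤ T * y ^ 2 := mul_nonneg (by linarith) hy2
  refine ⟨(abs_le_of_sq_le_sq' (by linarith) (by linarith)).2,
    abs_le_of_sq_le_sq (by linarith) (by linarith), abs_le_of_sq_le_sq ?_ (by linarith)⟩
  have h7 : T * (T * y ^ 2) ≤ T * (k ^ 2 * N) :=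
    mul_le_mul_of_nonneg_left (by linarith) (by linarith)
  linarith

/-- Multiplied by `Q * N`, the remaining bad amplitude is a sum of three errors: the rounding of
`R`, at most `20 N²`, and the tracking errors in the two parts of the mean, at most `6 N²` and `8
N²`. -/
theorem last_amplitude_le {N T Q G R D x y af : ℝ} (hT1 : 1 ≤ T) (hT : T + 1 ≤ N)
    (hQ0 : 0 < Q) (hR0 : 0 ≤ R) (hRQ : R ≤ Q) (hGr : G ≤ Q * (1 + 4 * N))
    (hR1 : R * (4 * T * G) ≤ Q * D) (hR2 : Q * D ≤ (R + 1) * (4 * T * G))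
    (hx : |x| ≤ 2 * N) (hy : |T * y| ≤ 2 * N)
    (haf : Q * (N * af) = (D - 4 * T * G * (R / Q)) - ((N - 2 * T) * x + 2 * (T * y)) +
      4 * (R / Q) * (T * y)) : Q * |af| ≤ 34 * N := by
  have hN0 : 0 < N := by linarith
  have hb1 : 0 ≤ D - 4 * T * G * (R / Q) := by
    rw [sub_nonneg, ← mul_div_assoc, div_le_iff₀ hQ0]; linarith
  have hb2 : D - 4 * T * G * (R / Q) ≤ 20 * N ^ 2 := by
    have h1 : D - 4 * T * G * (R / Q) ≤ 4 * T * G / Q := by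
      rw [sub_le_iff_le_add, ← mul_div_assoc, ← add_div, le_div_iff₀ hQ0]; linarith
    refine h1.trans ?_
    rw [div_le_iff₀ hQ0]
    calc 4 * T * G ≤ 4 * T * (Q * (1 + 4 * N)) := by gcongr
      _ ≤ 4 * N * (Q * (1 + 4 * N)) := by gcongr; linarith
      _ ≤ 4 * N * (Q * (N + 4 * N)) := by gcongr; linarith
      _ = _ := by ring
  have hNN : N * 1 ≤ N * N := mul_le_mul_of_nonneg_left (by linarith) hN0.le
  have hb3 : |(N - 2 * T) * x + 2 * (T * y)| ≤ 6 * N ^ 2 := by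
    have h1 : |(N - 2 * T) * x| ≤ N * (2 * N) := by
      rw [abs_mul]
      refine mul_le_mul ?_ hx (abs_nonneg _) hN0.le
      rw [abs_le]; constructor <;> linarith
    have h2 : |2 * (T * y)| ≤ 2 * (2 * N) := by
      rw [abs_mul, abs_of_pos (by norm_num : (0 : ℝ) < 2)]; gcongr
    refine (abs_add_le _ _).trans ?_
    linarith
  have hb4 : |4 * (R / Q) * (T * y)| ≤ 8 * N ^ 2 := by
    have hq : R / Q ≤ 1 := (div_le_one hQ0).2 hRQ
    have hq0 : 0 ≤ R / Q := by positivity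
    rw [abs_mul, abs_of_nonneg (by positivity)]
    have : 4 * (R / Q) * |T * y| ≤ 4 * 1 * (2 * N) := by gcongr
    linarith
  have habs : |Q * (N * af)| ≤ 34 * N ^ 2 := by
    rw [haf]
    rw [abs_le] at hb3 hb4 ⊢
    constructor <;> linarith [hb3.1, hb3.2, hb4.1, hb4.2]
  rw [abs_mul, abs_mul, abs_of_pos hQ0, abs_of_pos hN0] at habs
  have : N * (Q * |af|) ≤ N * (34 * N) := by linarith
  exact le_of_mul_le_mul_left this hN0

/-- After the last iteration hardly any amplitude is left on the bad elements. -/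
theorem lastFlip_fail (hT1 : 1 ≤ T) (hT : T ≤ N) {E : ℕ} (hE : 1 ≤ E)
    (hQ : Q = 64 * N * E) (hall : ∀ j < k, Continues N T Q j) (hk : ¬ Continues N T Q k)
    (hkS : (k : ℝ) ≤ 2 * Real.sqrt (N / T)) :
    ((N : ℝ) - T) / N * (2 * flipMean N T (groverAmp N T k).1 (groverAmp N T k).2
      ((lastFlip N T Q (track N T Q k).1 (track N T Q k).2 : ℕ) / Q) - (groverAmp N T k).1) ^ 2 ≤
      1 / (2 * E) := by
  have hN : 1 ≤ N := hT1.trans hT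
  have hN0 : (0 : ℝ) < N := by exact_mod_cast hN
  have hT0 : (0 : ℝ) < T := by exact_mod_cast hT1
  have hE0 : (1 : ℝ) ≤ E := by exact_mod_cast hE
  have hT1' : (1 : ℝ) ≤ T := by exact_mod_cast hT1
  have hQr : (Q : ℝ) = 64 * N * E := by rw [hQ]; push_cast; ring
  have hQ0 : (0 : ℝ) < Q := by rw [hQr]; positivity
  rcases hT.lt_or_eq with hlt | heq
  swap
  -- If `T = N` there are no bad elements.
  · rw [heq, sub_self, zero_div, zero_mul]; positivity
  have hlt' : (T : ℝ) + 1 ≤ N := by exact_mod_cast hlt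
  have herr := track_error (Q := Q) (by omega) hT k hall
  obtain ⟨hAQ, hQG, hG⟩ := track_le (N := N) (T := T) (Q := Q) k
  have hR := lastFlip_le hk
  have hk2 : (k : ℝ) ^ 2 * T ≤ 4 * N := by
    have h1 : (k : ℝ) ^ 2 ≤ (2 * Real.sqrt (N / T)) ^ 2 := by gcongr
    rw [mul_pow, Real.sq_sqrt (by positivity)] at h1
    calc (k : ℝ) ^ 2 * (T : ℝ) ≤ 2 ^ 2 * ((N : ℝ) / T) * T := by gcongr
      _ = 4 * (N : ℝ) := by field_simp; norm_num
  clear hall hk hkS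
  generalize (track N T Q k).1 = A at *
  generalize (track N T Q k).2 = G at *
  generalize (groverAmp N T k).1 = a at *
  generalize (groverAmp N T k).2 = g at *
  obtain ⟨hkN, hx, hy⟩ := le_of_weighted_sq_le hT1' hlt' hk2 herr
  obtain ⟨D, hD⟩ : ∃ D, 2 * (N - T) * A + 2 * T * G - N * A = D := ⟨_, rfl⟩
  have hDr : (D : ℝ) = 2 * (N - T) * A + 2 * T * G - N * A := by
    have hle : N * A ≤ 2 * (N - T) * A + 2 * T * G := by
      obtain ⟨x, hx⟩ := Nat.exists_eq_add_of_le hT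
      have e1 : N - T = x := by omega
      have e2 := Nat.mul_le_mul_left T (hAQ.trans hQG)
      calc N * A = T * A + x * A := by rw [hx]; ring
        _ ≤ T * G + x * A := by omega
        _ ≤ T * G + x * A + (x * A + T * G) := by omega
        _ = _ := by rw [e1]; ring
    rw [← hD, Nat.cast_sub hle]
    push_cast [Nat.cast_sub hT]
    ring
  have hG0 : (0 : ℝ) < G := by
    have : (Q : ℝ) ≤ G := by exact_mod_cast hQG
    linarith
  have h4TG : 0 < 4 * T * G := by
    have : 0 < G := by exact_mod_cast hG0
    positivity
  have hRD : lastFlip N T Q A G = Q * D / (4 * T * G) := by rw [lastFlip, hD]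
  generalize lastFlip N T Q A G = R at *
  have hR1 : (R : ℝ) * (4 * T * G) ≤ Q * D := by
    have := Nat.div_mul_le_self (Q * D) (4 * T * G)
    rw [← hRD] at this
    exact_mod_cast this
  have hR2 : (Q : ℝ) * D ≤ (R + 1) * (4 * T * G) := by
    have h1 := Nat.div_add_mod (Q * D) (4 * T * G)
    have h2 := Nat.mod_lt (Q * D) h4TG
    rw [← hRD] at h1
    have : Q * D ≤ (R + 1) * (4 * T * G) := by
      rw [add_mul, mul_comm R]
      omega
    exact_mod_cast this
  have hGr : (G : ℝ) ≤ Q * (1 + 4 * N) := by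
    have h1 : (G : ℝ) ≤ Q * (1 + 2 * k) := by exact_mod_cast hG
    have h2 : (Q : ℝ) * (1 + 2 * k) ≤ Q * (1 + 4 * N) := by
      refine mul_le_mul_of_nonneg_left ?_ hQ0.le
      linarith
    linarith
  have hNaf : Q * (N * (2 * flipMean N T a g (R / Q) - a)) = (D - 4 * T * G * (R / Q)) -
      ((N - 2 * T) * (A - Q * a) + 2 * (T * (G - Q * g))) +
      4 * (R / Q) * (T * (G - Q * g)) := by
    rw [flipMean, hDr]
    field_simp
    ring
  have hafE := last_amplitude_le hT1' hlt' hQ0 (by positivity) (by exact_mod_cast hR) hGr hR1 hR2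
    hx hy hNaf
  generalize 2 * flipMean N T a g (R / Q) - a = af at *
  have haf : |af| ≤ 34 / (64 * E) := by
    rw [hQr] at hafE
    rw [le_div_iff₀ (by positivity)]
    have : (N : ℝ) * (|af| * (64 * E)) ≤ N * 34 := by linarith
    exact le_of_mul_le_mul_left this hN0
  have h1 : ((N : ℝ) - T) / N ≤ 1 := by rw [div_le_one hN0]; linarith
  have h2 : af ^ 2 ≤ (34 / (64 * E)) ^ 2 := by
    rw [← sq_abs]; gcongr
  -- This is the reason for the factor `64` in `Q`: `(34 / 64)² < 1 / 2`, and `E ≤ E²`.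
  have h3 : (34 / (64 * (E : ℝ))) ^ 2 ≤ 1 / (2 * E) := by
    rw [div_pow, div_le_div_iff₀ (by positivity) (by positivity)]
    have : (E : ℝ) * 1 ≤ E * E := mul_le_mul_of_nonneg_left hE0 (by linarith)
    linarith
  calc ((N : ℝ) - T) / N * af ^ 2 ≤ 1 * af ^ 2 := mul_le_mul_of_nonneg_right h1 (sq_nonneg _)
    _ ≤ _ := by linarith

end Tracking

/-! ### The program: search for a known number of elements -/

/-- `2 * (N - T) * A` -/
def badWeight : WExpr := .op .mul (.op .mul (.const 2) (.op .sub (.reg 0) (.reg 17))) (.reg 14)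

/-- `2 * T * G` -/
def goodWeight : WExpr := .op .mul (.op .mul (.const 2) (.reg 17)) (.reg 15)

/-- Grover search, with the amplitudes tracked in `reg 14` and `reg 15`, as long as it does not
overshoot when there are `reg 17` improving elements. -/
def exactLoop : Cmd :=
  .loop (.not (.wlt badWeight (.op .add (.op .mul (.reg 0) (.reg 14)) goodWeight)))
    (.seq (.wset 16 (.op .div (.op .sub badWeight goodWeight) (.reg 0))) <|
      .seq (.wset 14 (.op .sub (.reg 16) (.reg 14))) <|
      .seq (.wset 15 (.op .add (.reg 16) (.reg 15))) flip)

/-- Each element is paired with `64 * N * E` indices, so that the fraction flipped in the last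
iteration can be adjusted finely enough for an error of order `1 / E`. -/
def exactInit : Cmd :=
  .seq (.wset 11 (.op .mul (.op .mul (.const 64) (.reg 0)) (.reg 2))) <|
    .seq (.wset 12 (.reg 11)) <| .seq (.wset 14 (.reg 11)) <| .seq (.wset 15 (.reg 11)) <|
    .prep (.op .mul (.reg 11) (.reg 0))

/-- The number of indices to be flipped in the last iteration. -/
def lastFlipExpr : WExpr :=
  .op .div (.op .mul (.reg 11) (.op .sub (.op .add badWeight goodWeight)
    (.op .mul (.reg 0) (.reg 14)))) (.op .mul (.op .mul (.const 4) (.reg 17)) (.reg 15))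

/-- The search that hardly ever fails if there are `reg 17` improving elements. -/
def exact : Cmd :=
  .seq exactInit <| .seq exactLoop <| .seq (.wset 12 lastFlipExpr) <| .seq flip finish

/-! ### Correctness and cost of the exact search -/

section Exact

variable {α : Type u} [LinearOrder α] {M : Machine α} {d E b : ℕ} {X : Finset (Fin M.N)}

/-- `Amp.sum_outcome` with payoff `0` on success and `1` on failure compares the bad probability
with the total one. It covers wrong guesses of the number of improving elements. -/
theorem Amp.fail_le_one {N : ℕ} {q : QState} {S : Finset (Fin N)} {m : ℕ} {a : ℝ} {g : ℕ → ℝ}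
    (hN : N ≠ 0) (hm : m ≠ 0) (h : Amp q (m * N) (twoLevel S a g)) :
    ENNReal.ofReal ((N - S.card) / N * a ^ 2) ≤ 1 := by
  classical
  have h1 := Amp.sum_outcome hN hm h (fun _ => 0) 1
  have h0 : avg S (fun _ => 0) = 0 := by simp [avg]
  rw [h0, zero_add, mul_one, zero_add] at h1
  rw [← h1]
  have htot : ∑ z, ENNReal.ofReal (‖q.vec z‖ ^ 2) = 1 := by
    rw [← ENNReal.ofReal_sum_of_nonneg fun _ _ => by positivity, ← EuclideanSpace.norm_sq_eq,
      q.norm_vec]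
    simp
  refine le_trans ?_ htot.le
  refine Finset.sum_le_sum fun z _ => mul_le_of_le_one_right' ?_
  split_ifs <;> simp

/-- The registers of the exact search. -/
structure Tracked (M : Machine α) (Q T k : ℕ) (s : Store α) : Prop where
  reg0 : s.reg 0 = M.N
  reg11 : s.reg 11 = Q
  reg17 : s.reg 17 = T
  reg14 : s.reg 14 = (track M.N T Q k).1
  reg15 : s.reg 15 = (track M.N T Q k).2

variable {Q T k : ℕ} {s : Store α}

/-- Size assumptions of the exact search. -/
structure TrackFits (M : Machine α) (Q T k : ℕ) : Prop where
  N_pos : 1 ≤ M.N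
  N_le : 64 * M.N ≤ Q
  T_le : T ≤ M.N
  k_le : k ≤ 2 * M.N
  word : Q ^ 6 < 2 ^ M.w

/-- The intermediate results stay below `8 Q⁴ ≤ Q⁶`; this is what the exponent in `Fits.word`
provides for. -/
theorem TrackFits.bounds (h : TrackFits M Q T k) :
    2 * (M.N - T) * (track M.N T Q k).1 ≤ Q * Q ∧ 2 * T * (track M.N T Q k).2 ≤ Q * Q * Q ∧
      M.N * (track M.N T Q k).1 ≤ Q * Q ∧ Q * (8 * (Q * Q * Q)) < 2 ^ M.w ∧ Q * Q ≤ Q * Q * Q ∧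
      Q ≤ Q * Q ∧ 8 * (Q * Q * Q) < 2 ^ M.w := by
  obtain ⟨h1, h2, h3⟩ := track_le (N := M.N) (T := T) (Q := Q) k
  have hN := h.N_pos
  have hNQ := h.N_le
  have hT := h.T_le
  have hk := h.k_le
  have hG : (track M.N T Q k).2 ≤ Q * Q := h3.trans (Nat.mul_le_mul_left _ (by omega))
  have hw : Q * (8 * (Q * Q * Q)) < 2 ^ M.w := by
    refine lt_of_le_of_lt ?_ h.word
    calc Q * (8 * (Q * Q * Q)) = 8 * 1 * Q ^ 4 := by ring
      _ ≤ Q * Q * Q ^ 4 := Nat.mul_le_mul_right _ (Nat.mul_le_mul (by omega) (by omega))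
      _ = _ := by ring
  refine ⟨Nat.mul_le_mul (by omega) h1, ?_, Nat.mul_le_mul (by omega) h1, hw,
    Nat.le_mul_of_pos_right _ (by omega), Nat.le_mul_of_pos_right _ (by omega),
    lt_of_le_of_lt (Nat.le_mul_of_pos_left _ (by omega)) hw⟩
  rw [mul_assoc Q Q Q]
  exact Nat.mul_le_mul (by omega) hG

theorem eval_badWeight (h : TrackFits M Q T k) (hs : Tracked M Q T k s) :
    badWeight.eval M s = 2 * (M.N - T) * (track M.N T Q k).1 := by
  obtain ⟨h1, h2, h3, h4, h5, h6, h7⟩ := h.bounds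
  have hN := h.N_pos
  have hNQ := h.N_le
  have hT := h.T_le
  exact eval_mul (eval_mul (eval_const (by omega)) (eval_sub hs.reg0 hs.reg17 (by omega)) (by omega))
    hs.reg14 (by omega)

theorem eval_goodWeight (h : TrackFits M Q T k) (hs : Tracked M Q T k s) :
    goodWeight.eval M s = 2 * T * (track M.N T Q k).2 := by
  obtain ⟨h1, h2, h3, h4, h5, h6, h7⟩ := h.bounds
  have hN := h.N_pos
  have hNQ := h.N_le
  have hT := h.T_le
  exact eval_mul (eval_mul (eval_const (by omega)) hs.reg17 (by omega)) hs.reg15 (by omega)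

theorem continues_holds (h : TrackFits M Q T k) (hs : Tracked M Q T k s) :
    (BExpr.not (.wlt badWeight (.op .add (.op .mul (.reg 0) (.reg 14)) goodWeight))).Holds M s ↔
      Continues M.N T Q k := by
  obtain ⟨h1, h2, h3, h4, h5, h6, h7⟩ := h.bounds
  have hN := h.N_pos
  have hNQ := h.N_le
  have e2 := eval_add (eval_mul (e₁ := .reg 0) (e₂ := .reg 14) hs.reg0 hs.reg14 (by omega))
    (eval_goodWeight h hs) (by omega)
  rw [BExpr.Holds, BExpr.Holds, e2, eval_badWeight h hs, not_lt, Continues]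

theorem eval_lastFlipExpr (h : TrackFits M Q T k) (hs : Tracked M Q T k s) :
    lastFlipExpr.eval M s = lastFlip M.N T Q (track M.N T Q k).1 (track M.N T Q k).2 := by
  obtain ⟨h1, h2, h3, h4, h5, h6, h7⟩ := h.bounds
  have hN := h.N_pos
  have hNQ := h.N_le
  have hT := h.T_le
  have h9 : 4 * T * (track M.N T Q k).2 = 2 * (2 * T * (track M.N T Q k).2) := by ring
  have e1 := eval_sub (eval_add (eval_badWeight h hs) (eval_goodWeight h hs) (by omega))
    (eval_mul (e₁ := .reg 0) (e₂ := .reg 14) hs.reg0 hs.reg14 (by omega)) (by omega)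
  have h8 : Q * (2 * (M.N - T) * (track M.N T Q k).1 + 2 * T * (track M.N T Q k).2 -
      M.N * (track M.N T Q k).1) < 2 ^ M.w :=
    lt_of_le_of_lt (Nat.mul_le_mul_left _ (by omega)) h4
  exact eval_div (eval_mul hs.reg11 e1 h8) (eval_mul (eval_mul (eval_const (by omega)) hs.reg17
    (by omega)) hs.reg15 (by omega)) h8

/-- Agreement except on the registers of the tracking loop. -/
def SameCounters (s s' : Store α) : Prop :=
  Agree s s' ∧ ∀ r, r ≤ 13 ∨ r = 17 → s'.reg r = s.reg r

theorem SameCounters.refl (s : Store α) : SameCounters s s := ⟨Agree.refl s, fun _ _ => rfl⟩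

theorem SameCounters.setReg {s s' : Store α} (h : SameCounters s s') {r n : ℕ} (hr : 14 ≤ r)
    (hr' : r ≤ 16) : SameCounters s (s'.setReg r n) := by
  refine ⟨h.1.setReg (by omega), fun r' h' => ?_⟩
  rw [← h.2 r' h', setReg_reg, if_neg (by omega)]

theorem SameCounters.trans {s s' s'' : Store α} (h : SameCounters s s') (h' : SameCounters s' s'') :
    SameCounters s s'' := ⟨h.1.trans h'.1, fun r hr => (h'.2 r hr).trans (h.2 r hr)⟩

/-- The tracked numbers depend on the guess `T`, the quantum amplitudes on the true number of
improving elements. The number of iterations is thus determined by `T` alone. -/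
theorem exec_exactLoop (hf : Fits M d E b) (hQ : Q = 64 * M.N * E) (hT : T ≤ M.N)
    (hk : k ≤ 2 * M.N) (hall : ∀ j < k, Continues M.N T Q j) (hover : ¬ Continues M.N T Q k)
    (hQw : Q * M.N < 2 ^ M.w) (j : ℕ) {i : ℕ} (hij : i + j = k) {s : Store α} {q : QState}
    (h : Rep M d E b s X) (hs : Tracked M Q T i s) (h12 : s.reg 12 = Q)
    (hq : Amp q (Q * M.N) (twoLevel (imp M d X) (groverAmp M.N (imp M d X).card i).1
      fun _ => (groverAmp M.N (imp M d X).card i).2)) :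
    ∃ s' q', Exec M exactLoop s q s' q' (2 * unit M * j + 20) ∧ SameCounters s s' ∧
      Tracked M Q T k s' ∧ Amp q' (Q * M.N) (twoLevel (imp M d X)
        (groverAmp M.N (imp M d X).card k).1 fun _ => (groverAmp M.N (imp M d X).card k).2) := by
  have hU := hf.two_hundred_le
  have hN := hf.N_pos
  have hNQ : 64 * M.N ≤ Q := by rw [hQ]; exact Nat.le_mul_of_pos_right _ hf.E_pos
  have htf : ∀ i ≤ k, TrackFits M Q T i := fun i hi => ⟨hN, hNQ, hT, by omega, hQ ▸ hf.word⟩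
  induction j generalizing i s q with
  | zero =>
    obtain rfl : i = k := by omega
    refine ⟨s, q, (Exec.loop_neg ((not_congr (continues_holds (htf _ le_rfl) hs)).2 hover)).mono ?_,
      SameCounters.refl s, hs, hq⟩
    simp [BExpr.cost, WExpr.cost, badWeight, goodWeight]
  | succ j ih =>
    have hc := hall i (by omega)
    have hfi := htf i (by omega)
    obtain ⟨g1, g2, g3, g4, g5, g6, g7⟩ := hfi.bounds
    set m := (2 * (M.N - T) * (track M.N T Q i).1 - 2 * T * (track M.N T Q i).2) / M.N with hm
    have hmle : m ≤ Q * Q := (Nat.div_le_self _ _).trans ((Nat.sub_le _ _).trans g1)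
    have hg := (track_le (N := M.N) (T := T) (Q := Q) i).2.2
    have hg' : (track M.N T Q i).2 ≤ Q * Q :=
      hg.trans (Nat.mul_le_mul_left _ (by omega))
    have x1 := Exec.wset_of (q := q) (r := 16) (eval_div (eval_sub (eval_badWeight hfi hs)
      (eval_goodWeight hfi hs) (by omega)) (e₂ := .reg 0) hs.reg0 (by omega))
    rw [← hm] at x1
    have x2 := Exec.wset_of (M := M) (q := q) (r := 14) (s := s.setReg 16 m)
      (e₁ := .op .sub (.reg 16) (.reg 14)) (a := m - (track M.N T Q i).1)
      (eval_sub (by simp [WExpr.eval]) (by simp [WExpr.eval, hs.reg14]) (by omega))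
    have x3 := Exec.wset_of (M := M) (q := q) (r := 15)
      (s := (s.setReg 16 m).setReg 14 (m - (track M.N T Q i).1))
      (e₁ := .op .add (.reg 16) (.reg 15)) (a := m + (track M.N T Q i).2)
      (eval_add (by simp [WExpr.eval]) (by simp [WExpr.eval, hs.reg15]) (by omega))
    set s₁ := ((s.setReg 16 m).setReg 14 (m - (track M.N T Q i).1)).setReg 15
      (m + (track M.N T Q i).2) with hs₁
    have hag : SameCounters s s₁ := (((SameCounters.refl s).setReg (by norm_num)
      (by norm_num)).setReg (by norm_num) (by norm_num)).setReg (by norm_num) (by norm_num)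
    obtain ⟨q₁, x4, hq1⟩ := exec_flip_all hf (h.congr hag.1) (s := s₁) (by omega) hQw
      (by rw [hag.2 12 (by norm_num), h12]) hq
    obtain ⟨s₂, q₂, x5, y1, y2, y3⟩ := ih (i := i + 1) (by omega) (h.congr hag.1) (s := s₁) (q := q₁)
      ⟨by rw [hag.2 0 (by norm_num), hs.reg0], by rw [hag.2 11 (by norm_num), hs.reg11],
        by rw [hag.2 17 (by norm_num), hs.reg17], by simp [hs₁, track, hm],
        by simp [hs₁, track, hm]⟩ (by rw [hag.2 12 (by norm_num), h12]) hq1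
    refine ⟨s₂, q₂, (Exec.loop_pos ((continues_holds hfi hs).2 hc)
      (x1.seq (x2.seq (x3.seq x4))) x5).mono ?_, hag.trans y1, y2, y3⟩
    simp only [BExpr.cost, WExpr.cost, badWeight, goodWeight]
    rw [Nat.mul_succ]
    omega

/-- For a wrong guess `T` only the running time matters, whence the alternative `1 ≤ p`. -/
theorem search_exact (hf : Fits M d E b) (hT1 : 1 ≤ T) (hT : T ≤ M.N) {p : ℝ≥0∞}
    (hp : 1 ≤ p ∨ ((imp M d X).card = T ∧ ENNReal.ofReal (1 / (2 * E)) ≤ p)) :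
    Search M d E b X (fun s => s.reg 17 = T) (fun s => s.reg 17 = T) exact
      (ENNReal.ofReal (7 * unit M * Real.sqrt (M.N / T))) p := by
  have hU := hf.two_hundred_le
  have hN := hf.N_pos
  obtain ⟨Q, hQ⟩ : ∃ Q, Q = 64 * M.N * E := ⟨_, rfl⟩
  have hNQ : 64 * M.N ≤ Q := by rw [hQ]; exact Nat.le_mul_of_pos_right _ hf.E_pos
  have hQQ : Q * M.N ≤ Q * Q := Nat.mul_le_mul_left _ (by omega)
  obtain ⟨k, hall, hover, hkS⟩ := exists_not_continues hN hT1 hT (Q := Q) (by omega)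
  have hS1 : 1 ≤ Real.sqrt (M.N / T) := by
    rw [Real.one_le_sqrt, one_le_div (by exact_mod_cast hT1)]
    exact_mod_cast hT
  have hkN : k ≤ 2 * M.N := by
    have h1 : Real.sqrt (M.N / T) ≤ M.N := by
      have hN1 : (1 : ℝ) ≤ M.N := by exact_mod_cast hN
      have hT1' : (1 : ℝ) ≤ T := by exact_mod_cast hT1
      rw [Real.sqrt_le_left (by positivity), div_le_iff₀ (by positivity)]
      have h3 : (M.N : ℝ) * 1 ≤ M.N * M.N := by gcongr
      have h4 : (M.N : ℝ) ^ 2 * 1 ≤ M.N ^ 2 * T := by gcongr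
      linarith
    have : (k : ℝ) ≤ 2 * M.N := by linarith
    exact_mod_cast this
  have hfit : TrackFits M Q T k := ⟨hN, hNQ, hT, hkN, hQ ▸ hf.word⟩
  obtain ⟨g1, g2, g3, g4, g5, g6, g7⟩ := hfit.bounds
  intro lam g kk A B s q h h5 h17 h1 h2
  obtain ⟨nd, hl, -⟩ := id h
  have x1 := Exec.wset_of (M := M) (s := s) (q := q) (r := 11) (a := Q)
    (e₁ := .op .mul (.op .mul (.const 64) (.reg 0)) (.reg 2)) (hQ ▸
      eval_mul (eval_mul (eval_const (by omega)) hl.reg0 (by omega)) hl.reg2 (by rw [← hQ]; omega))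
  have x2 := Exec.wset_of (M := M) (s := s.setReg 11 Q) (q := q) (r := 12) (a := Q)
    (e₁ := .reg 11) (by simp [WExpr.eval])
  have x3 := Exec.wset_of (M := M) (s := (s.setReg 11 Q).setReg 12 Q) (q := q) (r := 14) (a := Q)
    (e₁ := .reg 11) (by simp [WExpr.eval])
  have x4 := Exec.wset_of (M := M) (s := ((s.setReg 11 Q).setReg 12 Q).setReg 14 Q) (q := q)
    (r := 15) (a := Q) (e₁ := .reg 11) (by simp [WExpr.eval])
  set s₁ := (((s.setReg 11 Q).setReg 12 Q).setReg 14 Q).setReg 15 Q with hs₁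
  have hag : Agree s s₁ := ((((Agree.refl s).setReg (by norm_num)).setReg (by norm_num)).setReg
    (by norm_num)).setReg (by norm_num)
  have x5 := Exec.prep M s₁ q (.op .mul (.reg 11) (.reg 0))
  have e5 : (WExpr.op .mul (.reg 11) (.reg 0)).eval M s₁ = Q * M.N :=
    eval_mul (by simp [WExpr.eval, hs₁]) (by simp [WExpr.eval, hs₁, hl.reg0]) (by omega)
  rw [e5] at x5
  have hprep : Amp (q.prep (Q * M.N)) (Q * M.N) (twoLevel (imp M d X)
      (groverAmp M.N (imp M d X).card 0).1 fun _ => (groverAmp M.N (imp M d X).card 0).2) := by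
    have := Amp.prep q (K := Q * M.N) (Nat.mul_ne_zero (by omega) (by omega))
    refine ⟨this.1, fun z => ?_⟩
    rw [this.2 z]
    simp [twoLevel, groverAmp]
  obtain ⟨s₂, q₂, x6, y1, y2, y3⟩ := exec_exactLoop hf hQ hT hkN hall hover (by omega) k (i := 0)
    (by omega) (h.congr hag) ⟨by simp [hs₁, hl.reg0], by simp [hs₁], by simp [hs₁, h17],
      by simp [hs₁, track], by simp [hs₁, track]⟩ (by simp [hs₁]) hprep
  have x7 := Exec.wset_of (q := q₂) (r := 12) (eval_lastFlipExpr hfit y2)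
  have hR := lastFlip_le hover
  obtain ⟨R, hRdef⟩ : ∃ R, lastFlip M.N T Q (track M.N T Q k).1 (track M.N T Q k).2 = R :=
    ⟨_, rfl⟩
  rw [hRdef] at x7 hR
  have hag2 : Agree s (s₂.setReg 12 R) := (hag.trans y1.1).setReg (by norm_num)
  have h12 : (s₂.setReg 12 R).reg 12 = R := by simp
  obtain ⟨q₃, x8, hq3⟩ := exec_flip hf (h.congr hag2) (s := s₂.setReg 12 R) (q := q₂) (by omega)
    (show Q * M.N < 2 ^ M.w by omega) (by rw [h12]; exact hR) y3
  have h17' : ∀ r, r = 5 ∨ r = 17 → (s₂.setReg 12 R).reg r = s.reg r := by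
    intro r hr
    rw [setReg_reg, if_neg (by omega), y1.2 r (by omega)]
    simp [hs₁, show r ≠ 11 by omega, show r ≠ 12 by omega, show r ≠ 14 by omega,
      show r ≠ 15 by omega]
  have x9 := ev_finish hf (h.congr hag2) (by omega) (show Q * M.N < 2 ^ M.w by omega) hq3
    (by rw [h17' 5 (by norm_num), h5]) (k := kk) (A := A) (B := B) h1 fun s' q' a1 a2 a3 =>
      h2 s' q' a1 a2 ((a3 17 (by norm_num)).trans ((h17' 17 (by norm_num)).trans h17))
  have hfail := Amp.fail_le_one (by omega) (by omega) hq3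
  refine (Ev.seq ((x1.seq (x2.seq (x3.seq (x4.seq x5)))) _ _ _ _ (Ev.seq (x6 _ _ _ _ (Ev.seq
    (x7 _ _ _ _ (Ev.seq (x8 _ _ _ _ x9)))))))).mono ?_
  have hcost : ∀ f : ℝ≥0∞, f ≤ p → lam * ((WExpr.op .mul (.op .mul (.const 64) (.reg 0))
      (.reg 2)).cost M + 1 + ((WExpr.reg 11).cost M + 1 + ((WExpr.reg 11).cost M + 1 +
      ((WExpr.reg 11).cost M + 1 + ((WExpr.op .mul (.reg 11) (.reg 0)).cost M + 1)))) : ℕ) +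
      (lam * (2 * unit M * k + 20 : ℕ) + (lam * (lastFlipExpr.cost M + 1 : ℕ) + (lam * (unit M : ℕ) +
      (lam * (unit M : ℕ) + avg (imp M d X) A + f * B)))) ≤
      lam * ENNReal.ofReal (7 * unit M * Real.sqrt (M.N / T)) + avg (imp M d X) A + p * B := by
    intro f hfp
    simp only [WExpr.cost, lastFlipExpr, badWeight, goodWeight]
    calc _ = lam * ((2 * unit M * k + 2 * unit M + 62 : ℕ)) + avg (imp M d X) A + f * B := by
          push_cast; ring
      _ ≤ _ := by
          gcongr
          refine natCast_le_ofReal ?_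
          push_cast
          have hU' : (200 : ℝ) ≤ unit M := by exact_mod_cast hU
          have a1 : (unit M : ℝ) * k ≤ unit M * (2 * Real.sqrt (M.N / T)) := by gcongr
          have a2 : (unit M : ℝ) * 1 ≤ unit M * Real.sqrt (M.N / T) := by gcongr
          linarith
  refine hcost _ ?_
  rcases hp with hp | ⟨ht, hp⟩
  · exact hfail.trans hp
  · refine le_trans (ENNReal.ofReal_le_ofReal ?_) hp
    rw [h12, ht, ← hRdef]
    exact lastFlip_fail hT1 hT hf.E_pos hQ hall hover hkS

end Exact

/-! ### The program: search with a small probability of failure -/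

def exactAllLoop : Cmd :=
  .loop (.and found0 (.not (.wlt (.reg 4) (.reg 17))))
    (.seq exact (.cond found0 (.wset 17 (.op .add (.reg 17) (.const 1))) nop))

/-- Search for every number of elements up to `reg 4`. -/
def exactAll : Cmd := .seq (.wset 17 (.const 1)) exactAllLoop

def levelLoop : Cmd :=
  .loop (.wlt (.op .mul (.op .mul span10 span10) (.reg 4)) (.reg 0)) triple10

/-- The level that is needed for `reg 4` elements. -/
def level : Cmd := .seq (.wset 10 (.const 0)) levelLoop

def sweepsLoop : Cmd :=
  .loop (.and found0 (.wlt (.const 0) (.reg 17)))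
    (.seq sweep (.cond found0 (.wset 17 (.op .sub (.reg 17) (.const 1))) nop))

/-- The search that hardly ever fails. -/
def slowSearch : Cmd :=
  .seq exactAll (.cond found0 (.seq (.seq level (.wset 17 (.reg 4))) sweepsLoop) nop)

theorem sum_sqrt_div_le (N b : ℕ) :
    ∑ l ∈ Finset.Ico 1 (b + 1), Real.sqrt ((N : ℝ) / l) ≤ 2 * Real.sqrt (N * b) := by
  rw [Finset.sum_Ico_eq_sum_range, Nat.add_sub_cancel]
  have h : ∀ j ∈ Finset.range b, Real.sqrt ((N : ℝ) / (1 + j : ℕ)) =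
      Real.sqrt N * (1 / Real.sqrt (j + 1)) := by
    intro j _
    rw [Real.sqrt_div (by positivity), mul_one_div]
    push_cast
    rw [add_comm (1 : ℝ)]
  rw [Finset.sum_congr rfl h, ← Finset.mul_sum, Real.sqrt_mul (by positivity)]
  have := mul_le_mul_of_nonneg_left (sum_inv_sqrt_le b) (Real.sqrt_nonneg (N : ℝ))
  linarith

/-! ### The slow search -/

section Slow

variable {α : Type u} [LinearOrder α] {M : Machine α} {d E b : ℕ} {X : Finset (Fin M.N)}

theorem Rep.reg_four {s : Store α} (h : Rep M d E b s X) : s.reg 4 = b := by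
  obtain ⟨nd, hl, -⟩ := h; exact hl.reg4

theorem search_exactAllLoop (hf : Fits M d E b) (j : ℕ) {T : ℕ} (hT1 : 1 ≤ T) (hj : T + j = b + 1)
    {p : ℝ≥0∞} (hp1 : p ≤ 1) (hp : 1 ≤ p ∨ (T ≤ (imp M d X).card ∧ (imp M d X).card ≤ b ∧
      ENNReal.ofReal (1 / (2 * E)) ≤ p)) :
    Search M d E b X (fun s => s.reg 17 = T) (fun _ => True) exactAllLoop
      (ENNReal.ofReal (8 * unit M * ∑ l ∈ Finset.Ico T (b + 1), Real.sqrt (M.N / l) + 10)) p := by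
  have hw := hf.lt_word
  have hU := hf.two_hundred_le
  have hN := hf.N_pos
  have hb := hf.b_le
  have hbx : ∀ (T : ℕ) (s : Store α), Rep M d E b s X → s.reg 17 = T →
      ((BExpr.not (.wlt (.reg 4) (.reg 17))).Holds M s ↔ T ≤ b) := by
    intro T s h h17
    simp only [BExpr.Holds, WExpr.eval, h17, h.reg_four, not_lt]
  have hcost : (BExpr.not (.wlt (.reg 4) (.reg 17))).cost M = 4 := by simp [BExpr.cost, WExpr.cost]
  induction j generalizing T p with
  | zero =>
    have := Search.loop_neg (M := M) (d := d) (E := E) (b := b) (X := X)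
      (P := fun s => s.reg 17 = T)
      (C := .seq exact (.cond found0 (.wset 17 (.op .add (.reg 17) (.const 1))) nop))
      fun s h hs => (not_congr (hbx T s h hs)).2 (by omega)
    rw [hcost] at this
    refine this.mono (fun _ h => h) (fun _ _ => trivial) ?_ ?_
    · rw [Finset.Ico_eq_empty (by omega), Finset.sum_empty, mul_zero, zero_add]
      have := natCast_le_ofReal (n := 9) (x := 10) (by norm_num)
      refine le_trans (le_of_eq ?_) this
      norm_num
    · rcases hp with hp | ⟨h1, h2, -⟩
      · exact hp
      · omega
  | succ j ih =>
    have hTb : T ≤ b := by omega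
    have hT0 : (0 : ℝ) < T := by exact_mod_cast hT1
    have hη1 : ENNReal.ofReal (1 / (2 * E)) ≤ 1 := by
      rw [ENNReal.ofReal_le_one]
      have : (1 : ℝ) ≤ E := by exact_mod_cast hf.E_pos
      exact div_le_one_of_le₀ (by linarith) (by positivity)
    -- Only the round in which the guess is right contributes to the failure bound; the other rounds
    -- get the trivial bound `1`.
    obtain ⟨p₁, p₂, h1, h2, h3, h4, h5⟩ : ∃ p₁ p₂ : ℝ≥0∞, p₁ ≤ 1 ∧ p₂ ≤ 1 ∧ p₁ * p₂ ≤ p ∧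
        (1 ≤ p₁ ∨ ((imp M d X).card = T ∧ ENNReal.ofReal (1 / (2 * E)) ≤ p₁)) ∧
        (1 ≤ p₂ ∨ (T + 1 ≤ (imp M d X).card ∧ (imp M d X).card ≤ b ∧
          ENNReal.ofReal (1 / (2 * E)) ≤ p₂)) := by
      rcases hp with hp | ⟨h1, h2, h3⟩
      · exact ⟨1, 1, le_rfl, le_rfl, by rwa [one_mul], Or.inl le_rfl, Or.inl le_rfl⟩
      · rcases h1.eq_or_lt with h1 | h1
        · exact ⟨ENNReal.ofReal (1 / (2 * E)), 1, hη1, le_rfl, by rwa [mul_one],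
            Or.inr ⟨h1.symm, le_rfl⟩, Or.inl le_rfl⟩
        · exact ⟨1, p, le_rfl, hp1, by rw [one_mul], Or.inl le_rfl, Or.inr ⟨h1, h2, h3⟩⟩
    have s1 := search_exact (X := X) hf hT1 (hTb.trans hb) h4
    have s2 : Search M d E b X (fun s => s.reg 17 = T) (fun s => s.reg 17 = T + 1)
        (.wset 17 (.op .add (.reg 17) (.const 1))) ((4 : ℕ)) 1 := by
      refine Search.of_exec fun s q h h5 hc => ⟨_, q, Exec.wset_of (a := T + 1)
        (eval_add hc (eval_const (by omega)) (by omega)),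
        (Agree.refl s).setReg (by norm_num), by simpa using h5, by simp⟩
    have s3 := Search.loop_pos (fun s h hs => (hbx T s h hs).2 hTb) (s1.seq s2)
      (ih (T := T + 1) (by omega) (by omega) h2 h5)
    refine s3.mono (fun _ h => h) (fun _ h => h) ?_ (by rwa [mul_one])
    rw [hcost, mul_one, Finset.sum_eq_sum_Ico_succ_bot (show T < b + 1 by omega)]
    set S := ∑ l ∈ Finset.Ico (T + 1) (b + 1), Real.sqrt (M.N / l)
    have hS0 : 0 ≤ S := Finset.sum_nonneg fun _ _ => Real.sqrt_nonneg _
    have hS1 : 1 ≤ Real.sqrt (M.N / T) := by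
      rw [Real.one_le_sqrt, one_le_div hT0]
      exact_mod_cast hTb.trans hb
    calc _ ≤ ENNReal.ofReal (7 * unit M * Real.sqrt (M.N / T)) + 6 + 1 * ((4 : ℕ) + 4) +
            2 * ((4 : ℕ) + 5) + 1 * ENNReal.ofReal (8 * unit M * S + 10) := by gcongr
      _ = ENNReal.ofReal (7 * unit M * Real.sqrt (M.N / T)) + (32 : ℕ) +
            ENNReal.ofReal (8 * unit M * S + 10) := by push_cast; ring
      _ = ENNReal.ofReal (7 * unit M * Real.sqrt (M.N / T) + (32 : ℕ) + (8 * unit M * S + 10)) := by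
          rw [← ENNReal.ofReal_natCast, ← ENNReal.ofReal_add (by positivity) (by positivity),
            ← ENNReal.ofReal_add (by positivity) (by positivity)]
      _ ≤ _ := by
          refine ENNReal.ofReal_le_ofReal ?_
          have hU' : (200 : ℝ) ≤ unit M := by exact_mod_cast hU
          have a2 : (unit M : ℝ) * 1 ≤ unit M * Real.sqrt (M.N / T) := by gcongr
          push_cast
          linarith

theorem search_exactAll (hf : Fits M d E b) (hb : 1 ≤ b) {p : ℝ≥0∞} (hp1 : p ≤ 1)
    (hp : 1 ≤ p ∨ (1 ≤ (imp M d X).card ∧ (imp M d X).card ≤ b ∧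
      ENNReal.ofReal (1 / (2 * E)) ≤ p)) :
    Search M d E b X (fun _ => True) (fun _ => True) exactAll
      (ENNReal.ofReal (17 * unit M * Real.sqrt (M.N * b))) p := by
  have hw := hf.lt_word
  have hU := hf.two_hundred_le
  have hN := hf.N_pos
  have s1 : ∀ (s : Store α) (q : QState), Rep M d E b s X → s.reg 5 = 0 → True →
      ∃ s' q', Exec M (.wset 17 (.const 1)) s q s' q' 2 ∧ Agree s s' ∧ s'.reg 5 = 0 ∧
        s'.reg 17 = 1 := by
    intro s q h h5 _
    exact ⟨_, q, Exec.wset_of (eval_const (a := 1) (by omega)), (Agree.refl s).setReg (by norm_num),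
      by simpa using h5, by simp⟩
  refine (Search.exec_seq s1 (search_exactAllLoop hf b le_rfl (by omega) hp1 hp)).mono
    (fun _ h => h) (fun _ h => h) ?_ le_rfl
  have hS0 : 0 ≤ ∑ l ∈ Finset.Ico 1 (b + 1), Real.sqrt ((M.N : ℝ) / l) :=
    Finset.sum_nonneg fun _ _ => Real.sqrt_nonneg _
  rw [← ENNReal.ofReal_natCast, ← ENNReal.ofReal_add (by positivity) (by positivity)]
  refine ENNReal.ofReal_le_ofReal ?_
  have hU' : (200 : ℝ) ≤ unit M := by exact_mod_cast hU
  have h1 : 1 ≤ Real.sqrt (M.N * b) := by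
    rw [Real.one_le_sqrt]
    exact_mod_cast Nat.mul_le_mul hf.N_pos hb
  have a1 : (unit M : ℝ) * 1 ≤ unit M * Real.sqrt (M.N * b) := by gcongr
  have a2 := mul_le_mul_of_nonneg_left (sum_sqrt_div_le M.N b) (Nat.cast_nonneg (α := ℝ) (unit M))
  push_cast
  linarith

theorem exec_levelLoop (hf : Fits M d E b) {L : ℕ} (h1 : M.N ≤ 9 ^ L * b) (h2 : 9 ^ L * b ≤ 9 * M.N)
    (hb : 1 ≤ b) (hmin : ∀ i < L, 9 ^ i * b < M.N) (j : ℕ) {i : ℕ} (hij : i + j = L) {s : Store α}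
    {q : QState} (h : Rep M d E b s X) (h10 : s.reg 10 = third i) :
    Exec M levelLoop s q (s.setReg 10 (third L)) q (22 * j + 16) := by
  have hw := hf.lt_word
  have hN := hf.N_pos
  have key : ∀ (i : ℕ) (s : Store α), i ≤ L → Rep M d E b s X → s.reg 10 = third i →
      ((BExpr.wlt (.op .mul (.op .mul span10 span10) (.reg 4)) (.reg 0)).Holds M s ↔
        9 ^ i * b < M.N) := by
    intro i s hi h h10
    have g1 := two_mul_third i
    have g2 : 3 ^ i ≤ 9 ^ i := Nat.pow_le_pow_left (by norm_num) i
    have g3 : 9 ^ i ≤ 9 ^ L := Nat.pow_le_pow_right (by norm_num) hi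
    have g4 : 9 ^ i * b ≤ 9 ^ L * b := Nat.mul_le_mul_right _ g3
    have g5 : 9 ^ i * 1 ≤ 9 ^ i * b := Nat.mul_le_mul_left _ hb
    have e1 : span10.eval M s = 3 ^ i := by
      rw [← g1]
      exact eval_add (eval_mul (eval_const (by omega)) h10 (by omega)) (eval_const (by omega))
        (by omega)
    have e3 : 3 ^ i * 3 ^ i = 9 ^ i := by rw [← mul_pow]; norm_num
    have e2 := eval_mul e1 e1 (by rw [e3]; omega)
    have e4 := eval_mul e2 (e₂ := .reg 4) h.reg_four (by rw [e3]; omega)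
    have e5 : (WExpr.reg 0).eval M s = M.N := h.reg_zero
    rw [BExpr.Holds, e4, e3, e5]
  induction j generalizing i s with
  | zero =>
    obtain rfl : i = L := by omega
    rw [← h10, setReg_self]
    refine (Exec.loop_neg (fun hc => ?_)).mono ?_
    · have := (key _ s le_rfl h h10).1 hc; omega
    · simp [BExpr.cost, WExpr.cost, span10]
  | succ j ih =>
    have g1 := two_mul_third i
    have g2 : 3 ^ i ≤ 9 ^ i := Nat.pow_le_pow_left (by norm_num) i
    have g3 := hmin i (by omega)
    have g5 : 9 ^ i * 1 ≤ 9 ^ i * b := Nat.mul_le_mul_left _ hb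
    have x1 : Exec M triple10 s q (s.setReg 10 (third (i + 1))) q _ :=
      Exec.wset_of (a := third (i + 1)) (by
        rw [third_succ]
        exact eval_add (eval_mul (eval_const (by omega)) h10 (by omega)) (eval_const (by omega))
          (by omega))
    have x2 := ih (i := i + 1) (by omega) (s := s.setReg 10 (third (i + 1)))
      (h.congr ((Agree.refl s).setReg (by norm_num))) (by simp)
    have : (s.setReg 10 (third (i + 1))).setReg 10 (third L) = s.setReg 10 (third L) := by
      simp [Store.setReg]
    rw [this] at x2
    refine (Exec.loop_pos ((key i s (by omega) h h10).2 g3) x1 x2).mono ?_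
    simp [BExpr.cost, WExpr.cost, span10]
    omega

theorem search_sweepsLoop (hf : Fits M d E b) {L : ℕ} (hL : 2 * 3 ^ L < 2 ^ M.w) {p : ℝ≥0∞}
    (hp1 : p ≤ 1) (hp : (1 ≤ p) ∨ (1 / 2 ≤ p ∧ M.N ≤ 9 ^ L * (imp M d X).card)) {n : ℕ}
    (hn : n ≤ b) :
    Search M d E b X (KN (third L) n) (fun _ => True) sweepsLoop
      ((6 * unit M * 3 ^ L * n + 8 : ℕ)) (p ^ n) := by
  have hw := hf.lt_word
  have hU := hf.two_hundred_le
  have hb := hf.b_le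
  have hbx : ∀ (n : ℕ) (s : Store α), KN (third L) n s →
      ((BExpr.wlt (.const 0) (.reg 17)).Holds M s ↔ 0 < n) := by
    intro n s h
    rw [BExpr.Holds, eval_const (by omega), WExpr.eval, h.2]
  have hcost : (BExpr.wlt (.const 0) (.reg 17)).cost M = 3 := by simp [BExpr.cost, WExpr.cost]
  induction n with
  | zero =>
    have := Search.loop_neg (M := M) (d := d) (E := E) (b := b) (X := X)
      (P := KN (third L) 0)
      (C := .seq sweep (.cond found0 (.wset 17 (.op .sub (.reg 17) (.const 1))) nop))
      fun s _ hs => (not_congr (hbx 0 s hs)).2 (by omega)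
    rw [hcost] at this
    refine this.mono (fun _ h => h) (fun _ _ => trivial) ?_ ?_
    · simp; norm_num
    · rw [pow_zero]
  | succ n ih =>
    have s1 := search_sweep (X := X) hf (n := n + 1) hL hp
    have s2 : Search M d E b X (KN (third L) (n + 1)) (KN (third L) n)
        (.wset 17 (.op .sub (.reg 17) (.const 1))) ((4 : ℕ)) 1 := by
      refine Search.of_exec fun s q h h5 hc => ⟨_, q, Exec.wset_of (a := n)
        (eval_sub (e₁ := .reg 17) (a := n + 1) hc.2 (eval_const (by omega)) (by omega)),
        (Agree.refl s).setReg (by norm_num), by simpa using h5, ?_⟩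
      exact ⟨by simpa using hc.1, by simp⟩
    have s3 := Search.loop_pos (fun s _ hs => (hbx (n + 1) s hs).2 (by omega)) (s1.seq s2)
      (ih (by omega))
    refine s3.mono (fun _ h => h) (fun _ h => h) ?_ (by rw [mul_one, pow_succ'])
    rw [hcost, mul_one]
    calc _ ≤ ((5 * unit M * 3 ^ L : ℕ) : ℝ≥0∞) + 6 + 1 * ((4 : ℕ) + 4) + 2 * ((3 : ℕ) + 5) +
          1 * (6 * unit M * 3 ^ L * n + 8 : ℕ) := by gcongr
      _ = ((5 * unit M * 3 ^ L + 30 + (6 * unit M * 3 ^ L * n + 8) : ℕ) : ℝ≥0∞) := by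
          push_cast; ring
      _ ≤ _ := by
          have h2 : 200 * 1 ≤ unit M * 3 ^ L := Nat.mul_le_mul hU (Nat.one_le_pow _ _ (by norm_num))
          rw [Nat.mul_succ]
          norm_cast
          have e1 : 5 * unit M * 3 ^ L = 5 * (unit M * 3 ^ L) := by ring
          have e2 : 6 * unit M * 3 ^ L = 6 * (unit M * 3 ^ L) := by ring
          rw [e1]
          omega

/-- The guesses `1, …, b` cost `∑ √(N / T) = O(√(N b))`, and `b` sweeps at a level with `3 ^ L =
O(√(N / b))` cost the same order. -/
theorem search_slow (hf : Fits M d E b) (hb : 1 ≤ b) {p : ℝ≥0∞} (hp1 : p ≤ 1)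
    (hp : 1 ≤ p ∨ (1 ≤ (imp M d X).card ∧ (b = M.N ∨ 2 * E ≤ 2 ^ b) ∧
      ENNReal.ofReal (1 / (2 * E)) ≤ p)) :
    Search M d E b X (fun _ => True) (fun _ => True) slowSearch
      (ENNReal.ofReal (60 * unit M * Real.sqrt (M.N * b))) p := by
  have hw := hf.lt_word
  have hU := hf.two_hundred_le
  have hN := hf.N_pos
  have hbN := hf.b_le
  obtain ⟨L, h1, h2, hmin⟩ := exists_level (N := M.N) hb (by omega)
  have hL3 : 3 ^ L ≤ 9 ^ L := Nat.pow_le_pow_left (by norm_num) L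
  have hL9 : 9 ^ L * 1 ≤ 9 ^ L * b := Nat.mul_le_mul_left _ hb
  have htN := card_imp_le M d X
  have s2 : ∀ (s : Store α) (q : QState), Rep M d E b s X → s.reg 5 = 0 → True →
      ∃ s' q', Exec M (.seq level (.wset 17 (.reg 4))) s q s' q' (22 * L + 20) ∧ Agree s s' ∧
        s'.reg 5 = 0 ∧ KN (third L) b s' := by
    intro s q h h5 _
    have x1 := Exec.wset_of (M := M) (s := s) (q := q) (r := 10) (e₁ := .const 0) (a := third 0)
      (eval_const (a := 0) (by omega))
    have x2 := exec_levelLoop hf h1 h2 hb hmin L (i := 0) (by omega) (s := s.setReg 10 (third 0))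
      (q := q) (h.congr ((Agree.refl s).setReg (by norm_num))) (by simp)
    have x3 := Exec.wset_of (M := M) (s := (s.setReg 10 (third 0)).setReg 10 (third L)) (q := q)
      (r := 17) (e₁ := .reg 4) (a := b) (by simp [WExpr.eval, h.reg_four])
    refine ⟨_, q, ((x1.seq x2).seq x3).mono ?_, (((Agree.refl s).setReg (by norm_num)).setReg
      (by norm_num)).setReg (by norm_num), by simpa using h5, ?_⟩
    · simp only [WExpr.cost]; omega
    · constructor <;> simp
  -- If at most `b` elements are improving, one of the guesses is right. Otherwise `b < N`, hence `2
  -- ^ b ≥ 2 * E`, and the sweeps all fail with probability at most `2⁻ᵇ`.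
  obtain ⟨p₁, p₂, g1, g2, g3, g4, g5⟩ : ∃ p₁ p₂ : ℝ≥0∞, p₁ ≤ 1 ∧ p₂ ≤ 1 ∧ p₁ * p₂ ^ b ≤ p ∧
      (1 ≤ p₁ ∨ (1 ≤ (imp M d X).card ∧ (imp M d X).card ≤ b ∧
        ENNReal.ofReal (1 / (2 * E)) ≤ p₁)) ∧
      (1 ≤ p₂ ∨ (1 / 2 ≤ p₂ ∧ M.N ≤ 9 ^ L * (imp M d X).card)) := by
    rcases hp with hp | ⟨k1, k2, k3⟩
    · exact ⟨1, 1, le_rfl, le_rfl, by rwa [one_mul, one_pow], Or.inl le_rfl, Or.inl le_rfl⟩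
    · rcases le_or_gt (imp M d X).card b with k4 | k4
      · exact ⟨p, 1, hp1, le_rfl, by rw [one_pow, mul_one], Or.inr ⟨k1, k4, k3⟩, Or.inl le_rfl⟩
      · refine ⟨1, 1 / 2, le_rfl, by simp, ?_, Or.inl le_rfl,
          Or.inr ⟨le_rfl, h1.trans (Nat.mul_le_mul_left _ k4.le)⟩⟩
        rw [one_mul]
        refine le_trans ?_ k3
        rw [one_div, ENNReal.ofReal_div_of_pos
          (by have : (0 : ℝ) < E := by { exact_mod_cast hf.E_pos }
              positivity), ENNReal.ofReal_one, one_div, ← ENNReal.inv_pow, ENNReal.inv_le_inv,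
          show (2 * (E : ℝ)) = ((2 * E : ℕ) : ℝ) by push_cast; rfl, ENNReal.ofReal_natCast]
        have : 2 * E ≤ 2 ^ b := by omega
        exact_mod_cast this
  have s3 := (search_exactAll (X := X) hf hb g1 g4).seq
    (Search.exec_seq s2 (search_sweepsLoop hf (by omega) g2 g5 le_rfl))
  refine s3.mono (fun _ h => h) (fun _ h => h) ?_ g3
  have hLb : (3 : ℝ) ^ L * b ≤ 3 * Real.sqrt (M.N * b) := by
    have hb0 : (0 : ℝ) < b := by exact_mod_cast hb
    have k1 := mul_le_mul_of_nonneg_right (three_pow_le_of_lt hb h2) hb0.le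
    refine k1.trans (le_of_eq ?_)
    rw [mul_assoc]
    congr 1
    rw [Real.sqrt_div (by positivity), Real.sqrt_mul (by positivity), div_mul_eq_mul_div, div_eq_iff
      (Real.sqrt_pos.2 hb0).ne', mul_assoc, Real.mul_self_sqrt hb0.le]
  have hLn : L ≤ 3 ^ L * b := by
    have k1 : L < 3 ^ L := Nat.lt_pow_self (by norm_num)
    have k2 : 3 ^ L * 1 ≤ 3 ^ L * b := Nat.mul_le_mul_left _ hb
    omega
  have hLr : (L : ℝ) ≤ 3 ^ L * b := by exact_mod_cast hLn
  calc _ ≤ ENNReal.ofReal (17 * unit M * Real.sqrt (M.N * b)) + 6 + 1 * (((22 * L + 20 : ℕ) : ℝ≥0∞) +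
        (6 * unit M * 3 ^ L * b + 8 : ℕ) + 4) := by gcongr
    _ = ENNReal.ofReal (17 * unit M * Real.sqrt (M.N * b)) +
        ((22 * L + 20 + (6 * unit M * 3 ^ L * b + 8) + 10 : ℕ) : ℝ≥0∞) := by push_cast; ring
    _ = ENNReal.ofReal (17 * unit M * Real.sqrt (M.N * b) +
        (22 * L + 20 + (6 * unit M * 3 ^ L * b + 8) + 10 : ℕ)) := by
        rw [ENNReal.ofReal_add (by positivity) (by positivity), ENNReal.ofReal_natCast]
    _ ≤ _ := by
        refine ENNReal.ofReal_le_ofReal ?_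
        have hU' : (200 : ℝ) ≤ unit M := by exact_mod_cast hU
        have k1 : 1 ≤ Real.sqrt (M.N * b) := by
          rw [Real.one_le_sqrt]
          exact_mod_cast Nat.mul_le_mul hN hb
        have a1 : 200 * Real.sqrt (M.N * b) ≤ unit M * Real.sqrt (M.N * b) := by gcongr
        have a2 : unit M * ((3 : ℝ) ^ L * b) ≤ unit M * (3 * Real.sqrt (M.N * b)) := by gcongr
        push_cast
        linarith

end Slow

/-! ### The program -/

def find : Cmd := .seq quickSearch (.cond found0 slowSearch nop)

/-- Search and update until nothing is found. -/
def mainLoop : Cmd :=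
  .loop (.not found0) (.seq (.wset 5 (.const 0)) (.seq find
    (.cond found0 nop (.seq update (.wset 5 (.const 1))))))

section ScanCost

variable {ι : Type*} [Fintype ι] [DecidableEq ι] {I : Finset ι → Finset ι}

theorem scanCost_nonneg {c : ℕ → ℝ} (hc : ∀ n, 0 ≤ c n) (n : ℕ) (A : Finset ι) :
    0 ≤ scanCost I c n A := by
  induction n generalizing A with
  | zero => exact le_rfl
  | succ n ih =>
    rw [scanCost]
    have := Finset.sum_nonneg fun z (_ : z ∈ Aᶜ) => ih (insert z A)
    have := hc (I A).card
    positivity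

/-- Separates the search cost from the tree cost in `roundCost`. -/
theorem scanCost_linear (c c' : ℕ → ℝ) (x x' : ℝ) (n : ℕ) (A : Finset ι) :
    scanCost I (fun s => x * c s + x' * c' s) n A = x * scanCost I c n A + x' * scanCost I c' n A := by
  induction n generalizing A with
  | zero => simp [scanCost]
  | succ n ih =>
    simp only [scanCost, ih, Finset.sum_add_distrib, ← Finset.mul_sum]
    ring

end ScanCost

/-- `∑ 1 / i ^ 2` over `1 ≤ i ≤ n` -/
noncomputable def sumInvSq (n : ℕ) : ℝ := ∑ i ∈ Finset.range n, 1 / ((i + 1 : ℕ) : ℝ) ^ 2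

theorem sumInvSq_succ (n : ℕ) : sumInvSq (n + 1) = sumInvSq n + 1 / ((n + 1 : ℕ) : ℝ) ^ 2 :=
  Finset.sum_range_succ _ _

theorem sumInvSq_mono : Monotone sumInvSq :=
  monotone_nat_of_le_succ fun n => by
    rw [sumInvSq_succ]
    exact le_add_of_nonneg_right (by positivity)

theorem sumInvSq_nonneg (n : ℕ) : 0 ≤ sumInvSq n := Finset.sum_nonneg fun _ _ => by positivity

theorem sumInvSq_le_two (n : ℕ) : sumInvSq n ≤ 2 := by
  have h : ∀ n, sumInvSq (n + 1) ≤ 2 - 1 / ((n : ℝ) + 1) := by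
    intro n
    induction n with
    | zero => norm_num [sumInvSq]
    | succ n ih =>
      rw [sumInvSq_succ]
      have : 1 / (((n + 1 + 1 : ℕ) : ℝ)) ^ 2 ≤ 1 / ((n : ℝ) + 1) - 1 / (((n + 1 : ℕ) : ℝ) + 1) := by
        push_cast
        rw [div_sub_div _ _ (by positivity) (by positivity), div_le_div_iff₀ (by positivity)
          (by positivity)]
        have : (0 : ℝ) ≤ n := by positivity
        nlinarith
      linarith
  rcases n with _ | n
  · simp [sumInvSq]
  · refine (h n).trans ?_
    have : 0 ≤ 1 / ((n : ℝ) + 1) := by positivity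
    linarith

theorem avg_affine_le {N : ℕ} (S : Finset (Fin N)) (lam v : ℝ≥0∞) (w : ℕ → ℝ)
    (hw : ∀ y, 0 ≤ w y) :
    avg S (fun y => lam * ENNReal.ofReal (w y) + v) ≤
      lam * ENNReal.ofReal ((∑ y ∈ S, w y) / S.card) + v := by
  rcases S.eq_empty_or_nonempty with rfl | hS
  · simp [avg]
  have h0 : (S.card : ℝ≥0∞) ≠ 0 := by simpa using hS.ne_empty
  have h1 : (0 : ℝ) < S.card := by exact_mod_cast hS.card_pos
  rw [avg, Finset.sum_add_distrib, Finset.sum_const, nsmul_eq_mul, ENNReal.add_div,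
    ← Finset.mul_sum, mul_comm (S.card : ℝ≥0∞) v, ENNReal.mul_div_cancel_right h0 (by simp),
    ENNReal.ofReal_div_of_pos h1, ENNReal.ofReal_sum_of_nonneg fun _ _ => hw _,
    ENNReal.ofReal_natCast, mul_div_assoc]

/-! ### The main loop -/

section Main

variable {α : Type u} [LinearOrder α] {M : Machine α} {d E b : ℕ} {X : Finset (Fin M.N)}

theorem imp_mono (A : Finset (Fin M.N)) (z : Fin M.N) : imp M d (insert z A) ⊆ imp M d A :=
  improving_anti (Finset.subset_insert _ _)

theorem imp_disjoint (A : Finset (Fin M.N)) : Disjoint (imp M d A) A := by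
  rw [Finset.disjoint_left]
  intro y hy
  exact (mem_improving.1 hy).1

/-- Connects the machine, which inserts `y` into `X`, with the potential, which regards everything
outside the improving set as scanned. -/
theorem imp_insert_compl (y : Fin M.N) :
    imp M d (insert y (imp M d X)ᶜ) = imp M d (insert y X) := by
  have h1 : Disjoint (imp M d X)ᶜ (imp M d (insert y X)) :=
    (disjoint_compl_left).mono_right (imp_mono _ _)
  have h2 : imp M d (insert y X ∪ (imp M d X)ᶜ) = imp M d (insert y X) :=
    improving_union_of_disjoint h1
  rw [← h2, Finset.insert_union, Finset.union_eq_right.2]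
  intro x hx
  exact Finset.mem_compl.2 (Finset.disjoint_right.1 (imp_disjoint X) hx)

theorem card_imp_insert_lt {y : Fin M.N} (hy : y ∈ imp M d X) :
    (imp M d (insert y X)).card < (imp M d X).card := by
  refine Finset.card_lt_card (Finset.ssubset_iff_of_subset (imp_mono _ _) |>.2 ⟨y, hy, fun h => ?_⟩)
  exact Finset.disjoint_left.1 (imp_disjoint _) h (Finset.mem_insert_self _ _)

theorem search_find_any (hf : Fits M d E b) (hb : 1 ≤ b) :
    Search M d E b X (fun _ => True) (fun _ => True) find
      (ENNReal.ofReal (200 * unit M * Real.sqrt M.N + 60 * unit M * Real.sqrt (M.N * b) + 10)) 1 := by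
  refine ((search_quick_any hf).seq (search_slow hf hb le_rfl (Or.inl le_rfl))).mono (fun _ h => h)
    (fun _ h => h) ?_ (by rw [one_mul])
  rw [one_mul, ENNReal.ofReal_add (by positivity) (by norm_num),
    ENNReal.ofReal_add (by positivity) (by positivity)]
  refine le_of_eq ?_
  have : ENNReal.ofReal 10 = 6 + 4 := by
    rw [show (10 : ℝ) = ((10 : ℕ) : ℝ) by norm_num, ENNReal.ofReal_natCast]; norm_num
  rw [this]
  ring

theorem search_find (hf : Fits M d E b) (hb : 1 ≤ b) (hbE : b = M.N ∨ 2 * E ≤ 2 ^ b)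
    (ht : 1 ≤ (imp M d X).card) :
    Search M d E b X (fun _ => True) (fun _ => True) find
      (ENNReal.ofReal (200 * unit M * Real.sqrt (M.N / (imp M d X).card) +
        1 / ((imp M d X).card : ℝ) ^ 2 * (60 * unit M * Real.sqrt (M.N * b)) + 10))
      (ENNReal.ofReal (1 / ((imp M d X).card : ℝ) ^ 2 * (1 / (2 * E)))) := by
  have ht0 : (1 : ℝ) ≤ (imp M d X).card := by exact_mod_cast ht
  have hη1 : ENNReal.ofReal (1 / (2 * E)) ≤ 1 := by
    rw [ENNReal.ofReal_le_one]
    have : (1 : ℝ) ≤ E := by exact_mod_cast hf.E_pos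
    exact div_le_one_of_le₀ (by linarith) (by positivity)
  refine ((search_quick hf ht).seq (search_slow hf hb hη1 (Or.inr ⟨ht, hbE, le_rfl⟩))).mono
    (fun _ h => h) (fun _ h => h) ?_ (by rw [← ENNReal.ofReal_mul (by positivity)])
  have h1 : ENNReal.ofReal (1 / ((imp M d X).card : ℝ) ^ 2) ≤ 1 := by
    rw [ENNReal.ofReal_le_one]
    exact div_le_one_of_le₀ (one_le_pow₀ ht0) (by positivity)
  rw [ENNReal.ofReal_add (by positivity) (by norm_num),
    ENNReal.ofReal_add (by positivity) (by positivity),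
    ENNReal.ofReal_mul (p := 1 / ((imp M d X).card : ℝ) ^ 2) (by positivity)]
  have : ENNReal.ofReal 10 = 6 + 4 := by
    rw [show (10 : ℝ) = ((10 : ℕ) : ℝ) by norm_num, ENNReal.ofReal_natCast]; norm_num
  rw [this, mul_add]
  calc _ ≤ ENNReal.ofReal (200 * unit M * Real.sqrt (M.N / (imp M d X).card)) + 6 +
        (ENNReal.ofReal (1 / ((imp M d X).card : ℝ) ^ 2) *
          ENNReal.ofReal (60 * unit M * Real.sqrt (M.N * b)) + 1 * 4) := by gcongr
    _ = _ := by ring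

/-- The expected cost of finding an element among `n` improving ones and of the update, up to a
term which is paid rarely. -/
noncomputable def roundCost (M : Machine α) (d n : ℕ) : ℝ :=
  -- `200` units pay the quick search, and two more absorb the constant overhead and the oracle
  -- calls of an update. The factor `1` fits `scanCost_linear`.
  202 * unit M * Real.sqrt (M.N / n) + 80 * Nat.log 2 d * 1

/-- The expected time that remains. -/
noncomputable def remaining (M : Machine α) (d b : ℕ) (X : Finset (Fin M.N)) : ℝ :=
  potential (imp M d) (roundCost M d) X +
    sumInvSq (imp M d X).card * (60 * unit M * Real.sqrt (M.N * b)) +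
    (201 * unit M * Real.sqrt M.N + 60 * unit M * Real.sqrt (M.N * b))

theorem roundCost_nonneg (n : ℕ) : 0 ≤ roundCost M d n := by
  unfold roundCost; positivity

theorem potential_nonneg (X : Finset (Fin M.N)) : 0 ≤ potential (imp M d) (roundCost M d) X :=
  scanCost_nonneg roundCost_nonneg _ _

variable {lam : ℝ≥0∞} {g : Store α → ℝ≥0∞}

theorem found0_holds {s : Store α} : found0.Holds M s ↔ s.reg 5 = 0 := by
  simp [found0, BExpr.Holds, WExpr.eval]

/-- The end of the main loop when nothing has been found. -/
theorem ev_exit {s : Store α} {q : QState} (h5 : s.reg 5 = 0) {C : Cmd} :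
    Ev M lam g [.cond found0 nop C, mainLoop] s q (lam * 11 + g s) := by
  have h1 : Ev M lam g [mainLoop] s q _ :=
    Ev.loop_neg (b := .not found0) (fun h => h (found0_holds.2 h5)) (Ev.nil M lam g s q)
  have h2 : Exec M nop s q s q 2 := by
    have := Exec.wset M s q 5 (.reg 5)
    rwa [WExpr.eval, setReg_self] at this
  refine (Ev.cond_pos (found0_holds.2 h5) (h2 _ _ _ _ h1)).mono (le_of_eq ?_)
  have : (found0.cost M + 1 : ℕ) + 2 + ((BExpr.not found0).cost M + 1 : ℕ) = 11 := by
    simp [found0, BExpr.cost, WExpr.cost]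
  calc _ = lam * (((found0.cost M + 1 : ℕ) + 2 + ((BExpr.not found0).cost M + 1 : ℕ) : ℕ) : ℝ≥0∞) +
        g s := by push_cast; ring
    _ = _ := by rw [this]; norm_num

/-- A failed search ends the program, so `B` pays for the exit and for the terminal penalty. -/
theorem ev_round {s : Store α} {q : QState} {c p B : ℝ≥0∞} {A : ℕ → ℝ≥0∞} (hf : Fits M d E b)
    (h : Rep M d E b s X)
    (h5 : s.reg 5 ≠ 0) (hs : Search M d E b X (fun _ => True) (fun _ => True) find c p)
    (hA : ∀ y ∈ imp M d X, ∀ s' q', Rep M d E b s' X → s'.reg 5 = (y : ℕ) + 1 → Ev M lam g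
      [.cond found0 nop (.seq update (.wset 5 (.const 1))), mainLoop] s' q' (A y))
    (hB : ∀ s', Rep M d E b s' X → lam * 11 + g s' ≤ avg (imp M d X) A + B) :
    Ev M lam g [mainLoop] s q (lam * (7 + c) + avg (imp M d X) A + p * B) := by
  have hw := hf.lt_word
  have e0 := Exec.wset_of (M := M) (s := s) (q := q) (r := 5) (e₁ := .const 0) (a := 0)
    (eval_const (by omega))
  refine (Ev.loop_pos (b := .not found0) (fun hc => h5 (found0_holds.1 hc)) (Ev.seq (e0 _ _ _ _
    (Ev.seq (hs lam g _ A B (s.setReg 5 0) q (h.congr ((Agree.refl s).setReg (by norm_num)))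
      (by simp) trivial hA fun s' q' a1 a2 _ => (ev_exit a2).mono (hB s' a1)))))).mono (le_of_eq ?_)
  have : ((BExpr.not found0).cost M + 1 : ℕ) + ((WExpr.const 0).cost M + 1) = 7 := by
    simp [found0, BExpr.cost, WExpr.cost]
  calc _ = lam * (((BExpr.not found0).cost M + 1 : ℕ) + ((WExpr.const 0).cost M + 1) : ℕ) + (lam * c +
        avg (imp M d X) A + p * B) := by push_cast; ring
    _ = _ := by rw [this]; push_cast; ring

/-- Induction on the number `t` of improving elements, which drops with every update. Averaging over
the found element turns the induction hypothesis into the recursion `potential_eq`. A premature exit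
has probability at most `1 / (2 E t²)`, and the slow search is entered with probability at most `1 /
t²`, which accounts for the two occurrences of `sumInvSq`. -/
theorem ev_mainLoop (hf : Fits M d E b) (hb : 1 ≤ b) (hbE : b = M.N ∨ 2 * E ≤ 2 ^ b)
    (hg1 : ∀ s, g s ≤ 1) (hg0 : ∀ s X, Rep M d E b s X → imp M d X = ∅ → g s = 0)
    (n : ℕ) {X : Finset (Fin M.N)} (hn : (imp M d X).card = n) {s : Store α} {q : QState}
    (h : Rep M d E b s X) (h5 : s.reg 5 ≠ 0) :
    Ev M lam g [mainLoop] s q (lam * ENNReal.ofReal (remaining M d b X) +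
      ENNReal.ofReal (sumInvSq n * (1 / (2 * E)))) := by
  have hU : (200 : ℝ) ≤ unit M := by exact_mod_cast hf.two_hundred_le
  have hw := hf.lt_word
  have hN := hf.N_pos
  have hN1 : (1 : ℝ) ≤ M.N := by exact_mod_cast hN
  have hd := hf.d_le
  induction n using Nat.strong_induction_on generalizing X s q with
  | _ n ih =>
  have hpot := potential_nonneg (M := M) (d := d) X
  rcases Nat.eq_zero_or_pos n with h0 | h0
  -- The final search is fruitless and costs its full time, but the terminal penalty is `0`.
  · have hX : imp M d X = ∅ := by rw [← Finset.card_eq_zero, hn, h0]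
    refine (ev_round hf h h5 (search_find_any hf hb) (A := fun _ => 0) (B := lam * 11)
      (fun y hy => by simp [hX] at hy) fun s' h' => ?_).mono ?_
    · rw [hg0 s' X h' hX, add_zero]
      exact le_add_self
    · have hS1 : 1 ≤ Real.sqrt M.N := Real.one_le_sqrt.2 hN1
      have a1 : (unit M : ℝ) * 1 ≤ unit M * Real.sqrt M.N := by gcongr
      have h0' : avg (imp M d X) (fun _ => 0) = 0 := by simp [avg]
      rw [h0', add_zero, one_mul, ← mul_add]
      refine le_trans ?_ le_self_add
      refine mul_le_mul' le_rfl ?_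
      rw [show (7 : ℝ≥0∞) = ((7 : ℕ) : ℝ≥0∞) by norm_num,
        show (11 : ℝ≥0∞) = ((11 : ℕ) : ℝ≥0∞) by norm_num, ← ENNReal.ofReal_natCast,
        ← ENNReal.ofReal_natCast, ← ENNReal.ofReal_add (by positivity) (by positivity),
        ← ENNReal.ofReal_add (by positivity) (by positivity)]
      refine ENNReal.ofReal_le_ofReal ?_
      rw [remaining, hn, h0]
      have : sumInvSq 0 = 0 := by simp [sumInvSq]
      rw [this]
      push_cast
      linarith
  · obtain ⟨m, rfl⟩ : ∃ m, n = m + 1 := ⟨n - 1, by omega⟩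
    have hne : (imp M d X).Nonempty := Finset.card_pos.1 (by omega)
    have hfind := search_find (X := X) hf hb hbE (by omega)
    set Y : ℝ := 60 * unit M * Real.sqrt (M.N * b) with hY
    have hY0 : 0 ≤ Y := by positivity
    set Y0 : ℝ := 201 * unit M * Real.sqrt M.N + 60 * unit M * Real.sqrt (M.N * b) with hY0def
    have hY00 : 0 ≤ Y0 := by positivity
    set η : ℝ := 1 / (2 * (E : ℝ)) with hη
    have hη0 : 0 ≤ η := by positivity
    set K : ℝ := 246 + 80 * Nat.log 2 d + (M.tF + 2 * M.tG) with hK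
    have hK0 : 0 ≤ K := by positivity
    have hZ := sumInvSq_nonneg m
    let v : ℕ → ℝ := fun y => if hy : y < M.N then
      potential (imp M d) (roundCost M d) (insert ⟨y, hy⟩ (imp M d X)ᶜ) else 0
    have hv : ∀ y, 0 ≤ v y := by
      intro y
      simp only [v]
      split_ifs
      · exact potential_nonneg _
      · exact le_rfl
    have hvy : ∀ y : Fin M.N, v y = potential (imp M d) (roundCost M d) (insert y (imp M d X)ᶜ) :=
      fun y => by simp [v]
    set w : ℕ → ℝ := fun y => v y + (K + sumInvSq m * Y + Y0) with hw'
    have hw0 : ∀ y, 0 ≤ w y := fun y => by have := hv y; simp only [hw']; positivity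
    -- A premature exit costs time `11` and at most the full penalty `1`.
    refine (ev_round hf h h5 hfind
      (A := fun y => lam * ENNReal.ofReal (w y) + ENNReal.ofReal (sumInvSq m * η))
      (B := lam * 11 + 1) (fun y hy s' q' h' h5' => ?_) fun s' h' => ?_).mono ?_
    · obtain ⟨s₂, X', x1, x2, x3⟩ := exec_update (q := q') (by omega) (by omega) hf.d_pos h' hy h5'
      have x4 := Exec.wset_of (M := M) (s := s₂) (q := q') (r := 5) (e₁ := .const 1) (a := 1)
        (eval_const (by omega))
      have hlt := card_imp_insert_lt hy
      rw [← x3, hn] at hlt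
      have x5 := ih _ hlt (X := X') rfl (s := s₂.setReg 5 1) (q := q')
        (x2.congr ((Agree.refl s₂).setReg (by norm_num))) (by simp)
      refine (Ev.cond_neg (fun hc => by rw [found0_holds] at hc; omega)
        (Ev.seq (x1 _ _ _ _ (x4 _ _ _ _ x5)))).mono ?_
      have hzm : sumInvSq (imp M d X').card ≤ sumInvSq m := sumInvSq_mono (by omega)
      have hp : potential (imp M d) (roundCost M d) X' = v y := by
        rw [hvy]
        exact potential_congr (x3.trans (imp_insert_compl y).symm)
      have hrem : remaining M d b X' ≤ v y + sumInvSq m * Y + Y0 := by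
        rw [remaining, hp]
        gcongr
      have hcost : (found0.cost M + 1 : ℕ) + (240 + 80 * Nat.log 2 d + (M.tF + 2 * M.tG)) +
          ((WExpr.const 1).cost M + 1) = 246 + 80 * Nat.log 2 d + (M.tF + 2 * M.tG) := by
        simp only [found0, BExpr.cost, WExpr.cost]; omega
      calc _ = lam * ((((found0.cost M + 1 : ℕ) + (240 + 80 * Nat.log 2 d + (M.tF + 2 * M.tG)) +
            ((WExpr.const 1).cost M + 1) : ℕ) : ℝ≥0∞) + ENNReal.ofReal (remaining M d b X')) +
            ENNReal.ofReal (sumInvSq (imp M d X').card * η) := by push_cast; ring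
        _ ≤ _ := by
          rw [hcost, ← ENNReal.ofReal_natCast, ← ENNReal.ofReal_add (by positivity) ?_]
          · refine add_le_add (mul_le_mul' le_rfl (ENNReal.ofReal_le_ofReal ?_))
              (ENNReal.ofReal_le_ofReal (by gcongr))
            simp only [hw', hK]
            push_cast
            linarith
          · rw [remaining, hp]
            have := hv y
            have := sumInvSq_nonneg (imp M d X').card
            positivity
    · exact (add_le_add le_rfl (hg1 s')).trans le_add_self
    · have ht0 : (1 : ℝ) ≤ ((m + 1 : ℕ) : ℝ) := by push_cast; linarith [Nat.cast_nonneg (α := ℝ) m]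
      have hE1 : (1 : ℝ) ≤ E := by exact_mod_cast hf.E_pos
      have havg := avg_affine_le (imp M d X) lam (ENNReal.ofReal (sumInvSq m * η)) w hw0
      rw [hn] at havg ⊢
      obtain ⟨p, hp⟩ : ∃ p, p = 1 / ((m + 1 : ℕ) : ℝ) ^ 2 := ⟨_, rfl⟩
      have hp0 : 0 ≤ p := by rw [hp]; positivity
      have hp1 : p ≤ 1 := by rw [hp]; exact div_le_one_of_le₀ (one_le_pow₀ ht0) (by positivity)
      have hη1 : η ≤ 1 := by
        rw [hη]; exact div_le_one_of_le₀ (by linarith) (by positivity)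
      have hpη : ENNReal.ofReal (p * η) ≤ 1 := by
        rw [ENNReal.ofReal_le_one]; exact mul_le_one₀ hp1 hη0 hη1
      have hS1 : 1 ≤ Real.sqrt (M.N / (m + 1 : ℕ)) := by
        rw [Real.one_le_sqrt, one_le_div (by linarith), ← hn]
        exact_mod_cast card_imp_le M d X
      have hsum : (∑ y ∈ imp M d X, w y) / ((m + 1 : ℕ) : ℝ) =
          (∑ y ∈ imp M d X, v y) / ((m + 1 : ℕ) : ℝ) + (K + sumInvSq m * Y + Y0) := by
        simp only [hw', Finset.sum_add_distrib, Finset.sum_const, hn, nsmul_eq_mul]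
        field_simp
      have hpe := potential_eq (c := roundCost M d) (I := imp M d) imp_mono
        (fun A z hz => improving_insert_of_notMem hz) imp_disjoint X hne
      rw [hn] at hpe
      have hrem : remaining M d b X = roundCost M d (m + 1) +
          (∑ y ∈ imp M d X, v y) / ((m + 1 : ℕ) : ℝ) + (sumInvSq m + p) * Y + Y0 := by
        rw [remaining, hpe, hn, sumInvSq_succ, ← hp]
        simp only [hvy, hY, hY0def]
      have hsv : 0 ≤ (∑ y ∈ imp M d X, v y) / ((m + 1 : ℕ) : ℝ) :=
        div_nonneg (Finset.sum_nonneg fun y _ => hv y) (by positivity)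
      rw [← hp]
      have h7 : (7 : ℝ≥0∞) = ENNReal.ofReal 7 := by
        rw [show (7 : ℝ) = ((7 : ℕ) : ℝ) by norm_num, ENNReal.ofReal_natCast]; norm_num
      have h11 : (11 : ℝ≥0∞) = ENNReal.ofReal 11 := by
        rw [show (11 : ℝ) = ((11 : ℕ) : ℝ) by norm_num, ENNReal.ofReal_natCast]; norm_num
      set c : ℝ := 200 * unit M * Real.sqrt (M.N / (m + 1 : ℕ)) + p * Y + 10 with hc
      have hc0 : 0 ≤ c := by positivity
      calc _ ≤ lam * (7 + ENNReal.ofReal c) + (lam * ENNReal.ofReal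
            ((∑ y ∈ imp M d X, w y) / ((m + 1 : ℕ) : ℝ)) + ENNReal.ofReal (sumInvSq m * η)) +
            (lam * 11 + ENNReal.ofReal (p * η)) := by
            rw [mul_add (ENNReal.ofReal (p * η)), mul_one]
            exact add_le_add (add_le_add le_rfl havg)
              (add_le_add (mul_le_of_le_one_left' hpη) le_rfl)
        _ = lam * (ENNReal.ofReal 7 + ENNReal.ofReal c + ENNReal.ofReal
            ((∑ y ∈ imp M d X, w y) / ((m + 1 : ℕ) : ℝ)) + ENNReal.ofReal 11) +
            (ENNReal.ofReal (sumInvSq m * η) + ENNReal.ofReal (p * η)) := by rw [h7, h11]; ring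
        _ ≤ _ := by
            rw [hsum, ← ENNReal.ofReal_add (by norm_num) hc0,
              ← ENNReal.ofReal_add (by positivity) (by positivity),
              ← ENNReal.ofReal_add (by positivity) (by norm_num),
              ← ENNReal.ofReal_add (by positivity) (by positivity), sumInvSq_succ, ← hp, add_mul]
            refine add_le_add (mul_le_mul' le_rfl (ENNReal.ofReal_le_ofReal ?_)) le_rfl
            have hUd : (unit M : ℝ) = 100 * (M.tF + M.tG) := by rw [unit]; push_cast; ring
            have a1 : (unit M : ℝ) * 1 ≤ unit M * Real.sqrt (M.N / (m + 1 : ℕ)) := by gcongr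
            have hF0 : (0 : ℝ) ≤ M.tF := by positivity
            rw [hrem, hc, hK, roundCost]
            linarith

end Main

/-! ### Initialization -/

/-- `reg 4` becomes the least `b` with `b = N` or `2 ^ b ≥ 2 * E`. -/
def boundLoop : Cmd :=
  .loop (.and (.wlt (.reg 7) (.op .mul (.const 2) (.reg 2))) (.wlt (.reg 4) (.reg 0)))
    (.seq (.wset 7 (.op .mul (.reg 7) (.const 2))) (.wset 4 (.op .add (.reg 4) (.const 1))))

def init : Cmd :=
  .seq (.cond (.wlt (.reg 0) (.reg 1)) (.wset 1 (.reg 0)) nop) <|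
    .seq (.seq (.wset 4 (.const 0)) (.wset 7 (.const 1))) <| .seq boundLoop (.wset 5 (.const 1))

/-- Choose `d` objects of different types and minimal prices. -/
def mindiff : Cmd := .seq init mainLoop

section Init

variable {α : Type u} [LinearOrder α] {M : Machine α} {d E b : ℕ}

theorem rep_empty {s : Store α} (h0 : s.reg 0 = M.N) (h1 : s.reg 1 = d) (h2 : s.reg 2 = E)
    (h3 : s.reg 3 = 0) (h4 : s.reg 4 = b) (ha : s.arr = fun _ _ => 0) (hv : s.varr = fun _ _ => ⊤) :
    Rep M d E b s ∅ := by
  refine ⟨fun _ => none, ⟨h0, h1, h2, by simpa using h3, h4, ?_, ?_, ?_, ?_, ?_, ?_, ?_, ?_, ?_⟩, ?_,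
    ?_, rfl⟩ <;> simp [ha, hv, code, price, NodeRep, TreeExcept]

theorem exists_bound {N E : ℕ} (hN : 1 ≤ N) (hE : 1 ≤ E) :
    ∃ b, 1 ≤ b ∧ b ≤ N ∧ (b = N ∨ 2 * E ≤ 2 ^ b) ∧ (∀ j < b, 2 ^ j < 2 * E ∧ j < N) := by
  classical
  have hex : ∃ b, N ≤ b ∨ 2 * E ≤ 2 ^ b := ⟨N, Or.inl le_rfl⟩
  have hmin : ∀ j < Nat.find hex, 2 ^ j < 2 * E ∧ j < N := fun j hj => by
    have := Nat.find_min hex hj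
    push Not at this
    exact ⟨this.2, this.1⟩
  have hspec := Nat.find_spec hex
  have hle : Nat.find hex ≤ N := Nat.find_min' hex (Or.inl le_rfl)
  refine ⟨Nat.find hex, ?_, hle, ?_, hmin⟩
  · by_contra hc
    have h0 : Nat.find hex = 0 := by omega
    rw [h0, pow_zero] at hspec
    omega
  · rcases hspec with h | h
    · exact Or.inl (by omega)
    · exact Or.inr h

theorem exec_boundLoop {N : ℕ} (hE : 1 ≤ E) (hw : 4 * E < 2 ^ M.w) (hNw : N < 2 ^ M.w)
    (hmin : ∀ j < b, 2 ^ j < 2 * E ∧ j < N) (hover : b = N ∨ 2 * E ≤ 2 ^ b) (i : ℕ) {j : ℕ}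
    (hij : j + i = b) {s : Store α} {q : QState} (h0 : s.reg 0 = N) (h2 : s.reg 2 = E)
    (h4 : s.reg 4 = j) (h7 : s.reg 7 = 2 ^ j) :
    Exec M boundLoop s q ((s.setReg 7 (2 ^ b)).setReg 4 b) q (18 * i + 10) := by
  have hcond : ∀ (j : ℕ) (s : Store α), s.reg 0 = N → s.reg 2 = E → s.reg 4 = j →
      s.reg 7 = 2 ^ j → ((BExpr.and (.wlt (.reg 7) (.op .mul (.const 2) (.reg 2)))
      (.wlt (.reg 4) (.reg 0))).Holds M s ↔ 2 ^ j < 2 * E ∧ j < N) := by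
    intro j s h0 h2 h4 h7
    have e := eval_mul (M := M) (s := s) (e₁ := .const 2) (e₂ := .reg 2) (a := 2) (b := E)
      (eval_const (by omega)) h2 (by omega)
    rw [BExpr.Holds, BExpr.Holds, BExpr.Holds, e]
    simp [WExpr.eval, h0, h4, h7]
  induction i generalizing j s with
  | zero =>
    obtain rfl : j = b := by omega
    have : (s.setReg 7 (2 ^ j)).setReg 4 j = s := by
      rw [← h7, setReg_self, ← h4, setReg_self]
    rw [this]
    refine (Exec.loop_neg (fun hc => ?_)).mono (by simp [BExpr.cost, WExpr.cost])
    have := (hcond j s h0 h2 h4 h7).1 hc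
    omega
  | succ i ih =>
    have hj := hmin j (by omega)
    have x1 := Exec.wset_of (M := M) (s := s) (q := q) (r := 7) (a := 2 ^ (j + 1))
      (e₁ := .op .mul (.reg 7) (.const 2)) (by
        rw [pow_succ]
        exact eval_mul h7 (eval_const (by omega)) (by omega))
    have x2 := Exec.wset_of (M := M) (s := s.setReg 7 (2 ^ (j + 1))) (q := q) (r := 4) (a := j + 1)
      (e₁ := .op .add (.reg 4) (.const 1))
      (eval_add (by simp [WExpr.eval, h4]) (eval_const (by omega)) (by omega))
    set s₁ := (s.setReg 7 (2 ^ (j + 1))).setReg 4 (j + 1) with hs₁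
    have x3 := ih (j := j + 1) (by omega) (s := s₁) (by simp [hs₁, h0]) (by simp [hs₁, h2])
      (by simp [hs₁]) (by simp [hs₁])
    have : (s₁.setReg 7 (2 ^ b)).setReg 4 b = (s.setReg 7 (2 ^ b)).setReg 4 b := by
      simp only [hs₁, Store.setReg, Store.mk.injEq, and_self, and_true]
      ext r
      simp only [Function.update_apply]
      split_ifs <;> rfl
    rw [this] at x3
    refine (Exec.loop_pos ((hcond j s h0 h2 h4 h7).2 hj) (x1.seq x2) x3).mono ?_
    simp [BExpr.cost, WExpr.cost]
    omega

theorem exec_init {D : ℕ} (hE : 1 ≤ E) (hw : 4 * E < 2 ^ M.w)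
    (hNw : M.N < 2 ^ M.w) (hmin : ∀ j < b, 2 ^ j < 2 * E ∧ j < M.N)
    (hover : b = M.N ∨ 2 * E ≤ 2 ^ b) (q : QState) :
    ∃ s', Exec M init (start mindiff [M.N, D, E] : Config α).store q s' q (18 * b + 30) ∧
      Rep M (min D M.N) E b s' ∅ ∧ s'.reg 5 ≠ 0 := by
  obtain ⟨s, hs⟩ : ∃ s, s = (start mindiff [M.N, D, E] : Config α).store := ⟨_, rfl⟩
  have r0 : s.reg 0 = M.N := by rw [hs]; rfl
  have r1 : s.reg 1 = D := by rw [hs]; rfl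
  have r2 : s.reg 2 = E := by rw [hs]; rfl
  have r3 : s.reg 3 = 0 := by rw [hs]; rfl
  have harr : s.arr = fun _ _ => 0 := by rw [hs]; rfl
  have hvarr : s.varr = fun _ _ => ⊤ := by rw [hs]; rfl
  rw [← hs]
  have x1 : Exec M (.cond (.wlt (.reg 0) (.reg 1)) (.wset 1 (.reg 0)) nop) s q
      (s.setReg 1 (min D M.N)) q 6 := by
    by_cases hlt : M.N < D
    · refine (Exec.cond_pos (by simpa [BExpr.Holds, WExpr.eval, r0, r1] using hlt)
        (Exec.wset_of (a := min D M.N) ?_)).mono (by simp [BExpr.cost, WExpr.cost])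
      rw [min_eq_right hlt.le]
      exact r0
    · rw [min_eq_left (by omega), ← r1, setReg_self]
      have h2 : Exec M nop s q s q 2 := by
        have := Exec.wset M s q 5 (.reg 5)
        rwa [WExpr.eval, setReg_self] at this
      exact (Exec.cond_neg (by simpa [BExpr.Holds, WExpr.eval, r0, r1] using hlt) h2).mono
        (by simp [BExpr.cost, WExpr.cost])
  set s₁ := s.setReg 1 (min D M.N) with hs₁
  have x2 := Exec.wset_of (M := M) (s := s₁) (q := q) (r := 4) (e₁ := .const 0) (a := 0)
    (eval_const (by omega))
  have x3 := Exec.wset_of (M := M) (s := s₁.setReg 4 0) (q := q) (r := 7) (e₁ := .const 1)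
    (a := 2 ^ 0) (eval_const (by omega))
  have x4 := exec_boundLoop hE hw hNw hmin hover b (j := 0) (by omega)
    (s := (s₁.setReg 4 0).setReg 7 (2 ^ 0)) (q := q) (by simp [hs₁, r0]) (by simp [hs₁, r2])
    (by simp) (by simp)
  have x5 := Exec.wset_of (M := M) (q := q) (r := 5) (e₁ := .const 1) (a := 1)
    (s := (((s₁.setReg 4 0).setReg 7 (2 ^ 0)).setReg 7 (2 ^ b)).setReg 4 b)
    (eval_const (by omega))
  refine ⟨_, (x1.seq ((x2.seq x3).seq (x4.seq x5))).mono ?_, rep_empty ?_ ?_ ?_ ?_ ?_ harr hvarr,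
    by simp⟩
  · simp only [WExpr.cost]; omega
  all_goals simp [hs₁, r0, r2, r3]

end Init

/-! ### Estimates of the total time and of the word size -/

section Bounds

variable {α : Type u} [LinearOrder α] {M : Machine α} {d E b : ℕ}

theorem remaining_empty_le (hd : 1 ≤ d) :
    remaining M d b ∅ ≤ 808 * unit M * Real.sqrt (M.N * d) +
      80 * (Nat.log 2 d * (d * (1 + Real.log M.N))) + 180 * unit M * Real.sqrt (M.N * b) +
      201 * unit M * Real.sqrt M.N := by
  have hcard : ∀ B : Finset (Fin M.N), (B.filter fun z => z ∈ imp M d (B.erase z)).card ≤ d :=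
    fun B => card_filter_mem_improving_le (key_injective M) hd B
  have h0 := scanCost_eq_potential (c := roundCost M d) (I := imp M d) imp_mono
    (fun A z hz => improving_insert_of_notMem hz) imp_disjoint ∅
  rw [Finset.compl_empty, Finset.card_univ] at h0
  have h1 := scanCost_sqrt_le (I := imp M d) hd hcard imp_disjoint
  have h2 := scanCost_one_le (I := imp M d) hcard imp_disjoint
  have h3 := scanCost_linear (I := imp M d) (fun s => Real.sqrt (M.N / s)) (fun _ => 1)
    (202 * unit M) (80 * Nat.log 2 d) (Fintype.card (Fin M.N)) ∅
  rw [Fintype.card_fin] at h0 h1 h2 h3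
  have h4 : scanCost (imp M d) (roundCost M d) M.N ∅ ≤
      202 * unit M * (4 * Real.sqrt (M.N * d)) + 80 * Nat.log 2 d * (d * (1 + Real.log M.N)) := by
    refine le_trans (le_of_eq h3) ?_
    gcongr
  have h5 : sumInvSq (imp M d ∅).card * (60 * unit M * Real.sqrt (M.N * b)) ≤
      2 * (60 * unit M * Real.sqrt (M.N * b)) := by
    gcongr
    exact sumInvSq_le_two _
  -- `808 = 4 * 202`, and `180 = 2 * 60 + 60` includes the final slow search.
  rw [remaining, ← h0]
  linarith

/-- For `D < 2` the left side vanishes; this covers `N = 1`, where `lg N = 0`. Otherwise `lg N ≥ 1`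
absorbs the summand `1`. -/
theorem log_mul_le {N d D : ℕ} (hN : 1 ≤ N) (hD : D = min d N) (hd : 1 ≤ d) :
    (Nat.log 2 D : ℝ) * (D * (1 + Real.log N)) ≤
      2 * (d * Real.logb 2 N * Real.logb 2 d) := by
  have hlogN : 0 ≤ Real.logb 2 N := Real.logb_nonneg (by norm_num) (by exact_mod_cast hN)
  have hlogd : 0 ≤ Real.logb 2 d := Real.logb_nonneg (by norm_num) (by exact_mod_cast hd)
  rcases Nat.lt_or_ge D 2 with h | h
  · have : Nat.log 2 D = 0 := Nat.log_of_lt h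
    rw [this, Nat.cast_zero, zero_mul]
    positivity
  have hN2 : 2 ≤ N := by omega
  have h1 : (1 : ℝ) ≤ Real.logb 2 N := by
    rw [Real.le_logb_iff_rpow_le (by norm_num) (by positivity), Real.rpow_one]
    exact_mod_cast hN2
  have h2 : Real.log N ≤ Real.logb 2 N := by
    have hl2 : Real.log 2 ≤ 1 := by linarith [Real.log_two_lt_d9]
    rw [Real.logb, le_div_iff₀ (Real.log_pos (by norm_num))]
    exact mul_le_of_le_one_right (Real.log_nonneg (by exact_mod_cast hN)) hl2
  have h3 : (Nat.log 2 D : ℝ) ≤ Real.logb 2 d := by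
    refine (Real.natLog_le_logb D 2).trans ?_
    have hD0 : (0 : ℝ) < D := by exact_mod_cast (show 0 < D by omega)
    exact Real.logb_le_logb_of_le (by norm_num) hD0 (by exact_mod_cast (show D ≤ d by omega))
  have h4 : (D : ℝ) ≤ d := by exact_mod_cast (show D ≤ d by omega)
  have hln : 0 ≤ Real.log N := Real.log_nonneg (by exact_mod_cast hN)
  calc (Nat.log 2 D : ℝ) * (D * (1 + Real.log N)) ≤
        Real.logb 2 d * (d * (Real.logb 2 N + Real.logb 2 N)) := by gcongr
    _ = _ := by ring

/-- Minimality of `b`, applied to `b - 1`, gives `2 ^ (b - 1) < 2 ⌈ε⁻¹⌉ ≤ 4 ε⁻¹`. -/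
theorem bound_le {ε : ℝ} (hε : 0 < ε) (hε1 : ε < 1) (hb : 1 ≤ b)
    (hmin : ∀ j < b, 2 ^ j < 2 * ⌈ε⁻¹⌉₊) : (b : ℝ) ≤ 3 + Real.logb 2 ε⁻¹ := by
  have hinv : 1 ≤ ε⁻¹ := (one_le_inv₀ hε).2 hε1.le
  have h1 : (⌈ε⁻¹⌉₊ : ℝ) ≤ 2 * ε⁻¹ := by
    have := (Nat.ceil_lt_add_one (zero_le_one.trans hinv)).le
    linarith
  have h2 := hmin (b - 1) (by omega)
  have h3 : (2 : ℝ) ^ (b - 1) ≤ 4 * ε⁻¹ := by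
    have : ((2 : ℝ)) ^ (b - 1) ≤ 2 * ⌈ε⁻¹⌉₊ := by exact_mod_cast h2.le
    linarith
  have h4 : ((b - 1 : ℕ) : ℝ) ≤ Real.logb 2 (4 * ε⁻¹) := by
    rw [Real.le_logb_iff_rpow_le (by norm_num) (by positivity), Real.rpow_natCast]
    exact h3
  rw [Real.logb_mul (by norm_num) (by positivity), Nat.cast_sub hb,
    show (4 : ℝ) = 2 ^ (2 : ℕ) by norm_num, Real.logb_pow, Real.logb_self_eq_one (by norm_num)] at h4
  push_cast at h4
  linarith

theorem sqrt_mul_bound_le {N d b l : ℝ} (hN : 0 ≤ N) (hd : 1 ≤ d) (hb : b ≤ 3 + l) (hl : 0 ≤ l) :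
    Real.sqrt (N * b) ≤ 2 * (Real.sqrt (N * d) + Real.sqrt (N * l)) := by
  have h1 := Real.sqrt_nonneg (N * d)
  have h2 := Real.sqrt_nonneg (N * l)
  rw [Real.sqrt_le_left (by positivity)]
  have h3 : Real.sqrt (N * d) ^ 2 = N * d := Real.sq_sqrt (by positivity)
  have h4 : Real.sqrt (N * l) ^ 2 = N * l := Real.sq_sqrt (by positivity)
  have h5 : 0 ≤ Real.sqrt (N * d) * Real.sqrt (N * l) := by positivity
  have h6 : N * b ≤ N * (3 + l) := mul_le_mul_of_nonneg_left hb hN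
  have h7 : N * 1 ≤ N * d := mul_le_mul_of_nonneg_left hd hN
  have h8 : 0 ≤ N * l := by positivity
  have e : (2 * (Real.sqrt (N * d) + Real.sqrt (N * l))) ^ 2 =
      4 * (N * d) + 4 * (N * l) + 8 * (Real.sqrt (N * d) * Real.sqrt (N * l)) := by
    linear_combination 4 * h3 + 4 * h4
  rw [e]
  linarith

theorem total_le {ε : ℝ} {D : ℕ} (hf : Fits M (min D M.N) ⌈ε⁻¹⌉₊ b) (hb : 1 ≤ b) (hD : 1 ≤ D)
    (hε : 0 < ε) (hε1 : ε < 1) (hmin : ∀ j < b, 2 ^ j < 2 * ⌈ε⁻¹⌉₊) :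
    18 * b + 31 + remaining M (min D M.N) b ∅ ≤ 140000 *
      (((M.tF : ℝ) + M.tG) * (Real.sqrt ((M.N : ℝ) * D) + Real.sqrt (M.N * Real.logb 2 ε⁻¹)) +
        D * Real.logb 2 M.N * Real.logb 2 D) := by
  have hN := hf.N_pos
  have hN1 : (1 : ℝ) ≤ M.N := by exact_mod_cast hN
  have hD1 : (1 : ℝ) ≤ D := by exact_mod_cast hD
  have hb1 : (1 : ℝ) ≤ b := by exact_mod_cast hb
  have hbN : (b : ℝ) ≤ M.N := by exact_mod_cast hf.b_le
  have hF : (1 : ℝ) ≤ M.tF := by exact_mod_cast hf.tF_pos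
  have hG : (1 : ℝ) ≤ M.tG := by exact_mod_cast hf.tG_pos
  have hl : 0 ≤ Real.logb 2 ε⁻¹ :=
    Real.logb_nonneg (by norm_num) ((one_le_inv₀ hε).2 hε1.le)
  have h1 := remaining_empty_le (M := M) (b := b) hf.d_pos
  have h2 := log_mul_le hN rfl hD
  have h3 := sqrt_mul_bound_le (N := M.N) (d := D) (by positivity) hD1
    (bound_le hε hε1 hb hmin) hl
  have hlogN : 0 ≤ Real.logb 2 M.N := Real.logb_nonneg (by norm_num) hN1
  have hlogd : 0 ≤ Real.logb 2 D := Real.logb_nonneg (by norm_num) hD1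
  have h4 : 0 ≤ D * Real.logb 2 M.N * Real.logb 2 D := by positivity
  have h5 : Real.sqrt (M.N * (min D M.N : ℕ)) ≤ Real.sqrt (M.N * D) := by
    gcongr
    exact min_le_left _ _
  have h6 : Real.sqrt M.N ≤ Real.sqrt (M.N * D) :=
    Real.sqrt_le_sqrt (le_mul_of_one_le_right (by positivity) hD1)
  have h7 : (1 : ℝ) ≤ Real.sqrt M.N := Real.one_le_sqrt.2 hN1
  have h8 : (b : ℝ) ≤ Real.sqrt (M.N * b) := by
    refine Real.le_sqrt_of_sq_le ?_
    rw [sq]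
    gcongr
  have h9 := Real.sqrt_nonneg (M.N * Real.logb 2 ε⁻¹)
  have hU : (unit M : ℝ) = 100 * (M.tF + M.tG) := by rw [unit]; push_cast; ring
  set R := Real.sqrt ((M.N : ℝ) * D) + Real.sqrt (M.N * Real.logb 2 ε⁻¹) with hR
  have a1 : (unit M : ℝ) * Real.sqrt (M.N * (min D M.N : ℕ)) ≤ unit M * R := by gcongr; linarith
  have a2 : (unit M : ℝ) * Real.sqrt (M.N * b) ≤ unit M * (2 * R) := by gcongr
  have a3 : (unit M : ℝ) * Real.sqrt M.N ≤ unit M * R := by gcongr; linarith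
  have a4 : 1 * R ≤ ((M.tF : ℝ) + M.tG) * R :=
    mul_le_mul_of_nonneg_right (by linarith) (by linarith)
  have a5 : (unit M : ℝ) * R = 100 * (((M.tF : ℝ) + M.tG) * R) := by rw [hU]; ring
  -- The terms of `remaining` contribute `80800 + 36000 + 20100`, the initialization `36 + 31`, and
  -- the logarithmic term needs only `160`.
  linarith

end Bounds

/-- The base is at least `4`, so `64 = 4 ^ 3` costs three powers and `N`, `E` one each; the sixth
power gives exponent `30`, and one more makes the inequality strict. -/
theorem word_of_le {N d E w : ℕ} (hN : 1 ≤ N) (hd : 1 ≤ d) (hE : 2 ≤ E)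
    (h : (N + d + E) ^ 31 ≤ 2 ^ w) : (64 * N * E) ^ 6 < 2 ^ w := by
  refine lt_of_lt_of_le ?_ h
  have h1 : 64 * N * E ≤ (N + d + E) ^ 5 := by
    calc 64 * N * E ≤ (N + d + E) ^ 3 * (N + d + E) * (N + d + E) := by
          refine Nat.mul_le_mul (Nat.mul_le_mul ?_ (by omega)) (by omega)
          calc 64 = 4 ^ 3 := by norm_num
            _ ≤ _ := Nat.pow_le_pow_left (by omega) 3
      _ = _ := by ring
  calc (64 * N * E) ^ 6 ≤ ((N + d + E) ^ 5) ^ 6 := Nat.pow_le_pow_left h1 6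
    _ = (N + d + E) ^ 30 := by rw [← pow_mul]
    _ < _ := Nat.pow_lt_pow_right (by omega) (by norm_num)

/-! ### The whole program -/

section Run

variable {α : Type u} [LinearOrder α] {M : Machine α} {b : ℕ}

/-- The failure probabilities `1 / (2 E t²)` add up to at most `1 / E`, because `sumInvSq` is at
most `2`. -/
theorem ev_mindiff {d E : ℕ} {lam : ENNReal} {g : Store α → ENNReal}
    (hf : Fits M (min d M.N) E b) (hb : 1 ≤ b) (hbE : b = M.N ∨ 2 * E ≤ 2 ^ b)
    (hmin : ∀ j < b, 2 ^ j < 2 * E ∧ j < M.N) (hg1 : ∀ s, g s ≤ 1)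
    (hg0 : ∀ s X, Rep M (min d M.N) E b s X → imp M (min d M.N) X = ∅ → g s = 0) :
    Ev M lam g [mindiff] (start mindiff [M.N, d, E] : Config α).store
      (start mindiff [M.N, d, E] : Config α).q
      (lam * ENNReal.ofReal (18 * b + 30 + remaining M (min d M.N) b ∅) +
        ENNReal.ofReal (1 / E)) := by
  have hw := hf.word
  have hN := hf.N_pos
  have hE := hf.E_pos
  have h64 : 64 * M.N * E < 2 ^ M.w := lt_of_le_of_lt (Nat.le_self_pow (by norm_num) _) hw
  have hEN : 64 * 1 * E ≤ 64 * M.N * E :=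
    Nat.mul_le_mul_right _ (Nat.mul_le_mul_left _ hN)
  obtain ⟨s, x1, h, h5⟩ := exec_init (D := d) hE (by omega) (by have := hf.lt_word; omega) hmin hbE
    (start mindiff [M.N, d, E] : Config α).q
  refine (Ev.seq (x1 _ _ _ _ (ev_mainLoop hf hb hbE hg1 hg0 _ rfl h h5))).mono ?_
  have hr : 0 ≤ remaining M (min d M.N) b ∅ := by
    have := potential_nonneg (M := M) (d := min d M.N) ∅
    have := sumInvSq_nonneg (imp M (min d M.N) ∅).card
    rw [remaining]
    positivity
  rw [← ENNReal.ofReal_natCast, ← add_assoc, ← mul_add,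
    ← ENNReal.ofReal_add (by positivity) hr]
  push_cast
  refine add_le_add le_rfl (ENNReal.ofReal_le_ofReal ?_)
  have hE0 : (0 : ℝ) < E := by exact_mod_cast hE
  have := sumInvSq_le_two (imp M (min d M.N) ∅).card
  rw [mul_one_div, div_le_div_iff₀ (by positivity) hE0]
  nlinarith

end Run

end QRam

theorem theorem4 :
    ∃ (P : QRam.Cmd) (c : ℕ) (C : ℝ), 0 < C ∧
      ∀ (α : Type u) [LinearOrder α] (M : QRam.Machine α) (d : ℕ) (ε : ℝ),
        1 ≤ M.N → 1 ≤ d → 0 < ε → ε < 1 → 1 ≤ M.tF → 1 ≤ M.tG →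
        (M.N + d + ⌈ε⁻¹⌉₊) ^ c ≤ 2 ^ M.w → (∀ y, M.G y < 2 ^ M.w) →
        ENNReal.ofReal (1 - ε) ≤
            QRam.haltProb M P [M.N, d, ⌈ε⁻¹⌉₊]
              (fun s => ∃ x : Fin d → Option (Fin M.N),
                QRam.Outputs x s ∧ QRam.IsMinDiff M.F M.G x) ∧
          QRam.expectedTime M P [M.N, d, ⌈ε⁻¹⌉₊] ≤
            ENNReal.ofReal (C *
              (((M.tF : ℝ) + M.tG) *
                  (Real.sqrt ((M.N : ℝ) * d) + Real.sqrt (M.N * Real.logb 2 ε⁻¹)) +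
                d * Real.logb 2 M.N * Real.logb 2 d)) := by
  classical
  refine ⟨QRam.mindiff, 31, 140000, by norm_num, ?_⟩
  intro α _ M d ε hN hd hε hε1 htF htG hw _
  have hE2 : 2 ≤ ⌈ε⁻¹⌉₊ := by
    have : 1 < ⌈ε⁻¹⌉₊ := Nat.lt_ceil.2 (by rw [Nat.cast_one]; exact (one_lt_inv₀ hε).2 hε1)
    omega
  have hE1 : (1 : ℝ) ≤ ⌈ε⁻¹⌉₊ := by exact_mod_cast (show 1 ≤ ⌈ε⁻¹⌉₊ by omega)
  obtain ⟨b, hb, hbN, hbE, hmin⟩ := QRam.exists_bound hN (show 1 ≤ ⌈ε⁻¹⌉₊ by omega)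
  have hd1 : 1 ≤ min d M.N := le_min hd hN
  have hf : QRam.Fits M (min d M.N) ⌈ε⁻¹⌉₊ b :=
    ⟨hN, hd1, min_le_right _ _, by omega, htF, htG, hbN, QRam.word_of_le hN hd hE2 hw⟩
  constructor
  · set post : QRam.Store α → Prop := fun s => ∃ x : Fin d → Option (Fin M.N),
      QRam.Outputs x s ∧ QRam.IsMinDiff M.F M.G x with hpost
    -- Time is ignored and a wrong result costs `1`: the bound is the failure probability.
    have h := QRam.ev_mindiff (lam := 0) (g := fun s => if post s then 0 else 1) hf hb hbE hmin
      (fun s => by split_ifs <;> simp)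
      (fun s X h hX => if_pos (QRam.exists_isMinDiff h hd1 rfl hX))
    refine le_trans ?_ (QRam.le_haltProb (fun s hs => by rw [if_neg hs]) h)
    rw [zero_mul, zero_add, ENNReal.ofReal_sub _ hε.le, ENNReal.ofReal_one]
    refine tsub_le_tsub_left (ENNReal.ofReal_le_ofReal ?_) _
    rw [one_div]
    exact inv_le_of_inv_le₀ hε (Nat.le_ceil _)
  · have h := QRam.ev_mindiff (lam := 1) (g := fun _ => 0) hf hb hbE hmin
      (fun s => zero_le_one) (fun s X h hX => rfl)
    refine (QRam.expectedTime_le h).trans ?_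
    have htot := QRam.total_le hf hb hd hε hε1 fun j hj => (hmin j hj).1
    have hr : 0 ≤ 18 * (b : ℝ) + 30 + QRam.remaining M (min d M.N) b ∅ := by
      have := QRam.potential_nonneg (M := M) (d := min d M.N) ∅
      have := QRam.sumInvSq_nonneg (QRam.imp M (min d M.N) ∅).card
      rw [QRam.remaining]
      positivity
    rw [one_mul, ← ENNReal.ofReal_add hr (by positivity)]
    refine ENNReal.ofReal_le_ofReal ?_
    -- The penalty term `1 / E` also occurs in the time bound; it is the difference between `30` and
    -- the `31` of `total_le`.
    have : 1 / (⌈ε⁻¹⌉₊ : ℝ) ≤ 1 := div_le_one_of_le₀ hE1 (by positivity)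
    linarith
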